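/- Let $G$ be a smooth affine algebraic group over $\mathbb{R}$ (for example, a connected reductive group) and let $X$ be a smooth affine variety over $\mathbb{R}$ with a right action $X \times G \to X$ of $G$. For a smooth affine $\mathbb{R}$-variety $Z$, a Nash function on $Z(\mathbb{R})$ is a real-valued $C^\infty$ function with semi-algebraic graph, a Nash vector field is a $C^\infty$ vector field whose coordinates in a closed embedding of $Z$ into an affine space are Nash functions, and the algebra of Nash differential operators on $Z(\mathbb{R})$ is the algebra of operators on $C^\infty(Z(\mathbb{R}), \mathbb{C})$ generated over $\mathbb{C}$ by multiplications by Nash functions and derivations along Nash vector fields. The Aizenbud–Gourevitch Schwartz space $\mathcal{S}(Z)$ consists of the $\xi \in C^\infty(Z(\mathbb{R}), \mathbb{C})$ such that $\|\xi\|_D := \sup_{Z(\mathbb{R})} |D\xi| < \infty$ for every Nash differential operator $D$; it is topologized by the semi-norms $\|\cdot\|_D$. Fix a left Haar measure $dg$ on $G(\mathbb{R})$, and use it to identify Schwartz sections of the density bundle of $G(\mathbb{R})$ with elements of $\mathcal{S}(G)$. Then: 1. For all $\Xi, \Xi' \in \mathcal{S}(G)$ the convolution $(\Xi * \Xi')(h)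 = \int_{G(\mathbb{R})} \Xi(g)\, \Xi'(g^{-1}h)\, dg$ converges absolutely for every $h \in G(\mathbb{R})$ and lies in $\mathcal{S}(G)$; it makes $\mathcal{S}(G)$ an associative algebra with jointly continuous product (the Schwartz algebra). 2. For all $\Xi \in \mathcal{S}(G)$ and $\xi \in \mathcal{S}(X)$ the integral $$(\Xi\xi)(x) = \int_{G(\mathbb{R})} \Xi(g)\, \xi(xg)\, dg$$ converges absolutely for every $x \in X(\mathbb{R})$, and $\Xi\xi \in \mathcal{S}(X)$. The map $(\Xi, \xi) \mapsto \Xi\xi$ is bilinear and is an action of the algebra $\mathcal{S}(G)$ on $\mathcal{S}(X)$, that is, $(\Xi * \Xi')\xi = \Xi(\Xi'\xi)$. 3. The action map $\mathcal{S}(G) \times \mathcal{S}(X) \to \mathcal{S}(X)$ is jointly continuous. -/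

import Mathlib

open scoped TensorProduct Topology ContDiff Polynomial

noncomputable section

namespace SchwartzAction

/-! ### Real points of an affine variety `Spec B` over `ℝ` -/

/-- The set `X(ℝ)` of real points of the affine `ℝ`-scheme `X = Spec B`. -/
@[ext]
structure RealPoints (B : Type*) [CommRing B] [Algebra ℝ B] where
  toAlgHom : B →ₐ[ℝ] ℝ

namespace RealPoints

variable {B : Type*} [CommRing B] [Algebra ℝ B]

/-- The value `b(x)` of a regular function `b` at a real point `x`. -/
instance : CoeFun (RealPoints B) (fun _ => B → ℝ) := ⟨fun x => x.toAlgHom⟩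

/-- The usual topology on `X(ℝ)`: the coarsest one making all regular functions continuous. For a
finitely generated `B` it is the subspace topology for any closed embedding of `X` in an affine
space. -/
instance : TopologicalSpace (RealPoints B) :=
  TopologicalSpace.induced (fun (x : RealPoints B) (b : B) => x b) inferInstance

instance : MeasurableSpace (RealPoints B) := borel _

instance : BorelSpace (RealPoints B) := ⟨rfl⟩

/-- Real points of `Spec A` as the type carrying Mathlib's convolution group structure. -/
def equivConv (A : Type*) [CommRing A] [Algebra ℝ A] :
    RealPoints A ≃ WithConv (A →ₐ[ℝ] ℝ) where
  toFun g := WithConv.toConv g.toAlgHom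
  invFun g := ⟨g.ofConv⟩
  left_inv _ := rfl
  right_inv _ := rfl

/-- For a commutative Hopf algebra `A`, i.e. an affine group scheme `G = Spec A`, the group `G(ℝ)`.
-/
instance {A : Type*} [CommRing A] [HopfAlgebra ℝ A] : Group (RealPoints A) :=
  (equivConv A).group

theorem mul_apply {A : Type*} [CommRing A] [HopfAlgebra ℝ A] (g h : RealPoints A) (a : A) :
    (g * h) a = Algebra.TensorProduct.productMap g.toAlgHom h.toAlgHom (Coalgebra.comul (R := ℝ) a) := by
  rw [Algebra.TensorProduct.productMap_eq_comp_map]; rfl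

theorem one_apply {A : Type*} [CommRing A] [HopfAlgebra ℝ A] (a : A) :
    (1 : RealPoints A) a = Coalgebra.counit (R := ℝ) a := rfl

end RealPoints

/-- A right action `X × G → X` of the affine group scheme `G = Spec A` on the affine scheme
`X = Spec B`, given by its comorphism `B → B ⊗ A`. -/
structure RightAction (A B : Type*) [CommRing A] [HopfAlgebra ℝ A] [CommRing B] [Algebra ℝ B] where
  coact : B →ₐ[ℝ] B ⊗[ℝ] A
  /-- `(x g) h = x (g h)` -/
  coassoc : (Algebra.TensorProduct.assoc ℝ ℝ ℝ B A A).toAlgHom.comp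
      ((Algebra.TensorProduct.map coact (AlgHom.id ℝ A)).comp coact) =
    (Algebra.TensorProduct.map (AlgHom.id ℝ B) (Bialgebra.comulAlgHom ℝ A)).comp coact
  /-- `x 1 = x` -/
  counit : (Algebra.TensorProduct.rid ℝ ℝ B).toAlgHom.comp
      ((Algebra.TensorProduct.map (AlgHom.id ℝ B) (Bialgebra.counitAlgHom ℝ A)).comp coact) =
    AlgHom.id ℝ B

/-- The point `x g` of `X(ℝ)`, for `x ∈ X(ℝ)` and `g ∈ G(ℝ)`. -/
def RightAction.act {A B : Type*} [CommRing A] [HopfAlgebra ℝ A] [CommRing B] [Algebra ℝ B]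
    (ρ : RightAction A B) (x : RealPoints B) (g : RealPoints A) : RealPoints B :=
  ⟨(Algebra.TensorProduct.productMap x.toAlgHom g.toAlgHom).comp ρ.coact⟩

section Smooth

variable (B : Type*) [CommRing B] [Algebra ℝ B]

/-! ### Smooth functions -/

variable {B} in
/-- A function on `X(ℝ)` is smooth if near every point it is a smooth function of finitely many
regular functions. For smooth `X` these are the smooth functions on the manifold `X(ℝ)`: in an
embedding `X(ℝ) ⊆ ℝⁿ`, they are the functions which locally extend to smooth functions on `ℝⁿ`. -/
def IsSmoothFunction (φ : RealPoints B → ℂ) : Prop :=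
  ∀ x : RealPoints B, ∃ (n : ℕ) (b : Fin n → B) (F : (Fin n → ℝ) → ℂ), ContDiff ℝ ∞ F ∧
    ∀ᶠ y in 𝓝 x, φ y = F (fun i => y (b i))

variable {B} in
theorem IsSmoothFunction.comp₂ {φ ψ : RealPoints B → ℂ} (hφ : IsSmoothFunction φ)
    (hψ : IsSmoothFunction ψ) (op : ℂ → ℂ → ℂ)
    (hop : ContDiff ℝ ∞ (fun p : ℂ × ℂ => op p.1 p.2)) :
    IsSmoothFunction (fun x => op (φ x) (ψ x)) := by
  intro x
  obtain ⟨n, b, F, hF, hFe⟩ := hφ x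
  obtain ⟨m, c, H, hH, hHe⟩ := hψ x
  refine ⟨n + m, Fin.append b c,
    fun v => op (F (fun i => v (Fin.castAdd m i))) (H (fun i => v (Fin.natAdd n i))), ?_, ?_⟩
  · have h1 : ContDiff ℝ ∞ (fun v : Fin (n + m) → ℝ => F (fun i => v (Fin.castAdd m i))) :=
      hF.comp (contDiff_pi.2 fun i => contDiff_apply ℝ ℝ _)
    have h2 : ContDiff ℝ ∞ (fun v : Fin (n + m) → ℝ => H (fun i => v (Fin.natAdd n i))) :=
      hH.comp (contDiff_pi.2 fun i => contDiff_apply ℝ ℝ _)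
    exact hop.comp (h1.prodMk h2)
  · filter_upwards [hFe, hHe] with y h1 h2
    simp [h1, h2]

/-- The algebra `C^∞(X(ℝ))` of complex-valued smooth functions on `X(ℝ)`. -/
def smoothFunctions : Subalgebra ℂ (RealPoints B → ℂ) where
  carrier := {φ | IsSmoothFunction φ}
  mul_mem' hφ hψ := hφ.comp₂ hψ (· * ·) contDiff_mul
  add_mem' hφ hψ := hφ.comp₂ hψ (· + ·) contDiff_add
  algebraMap_mem' z := fun _ =>
    ⟨0, Fin.elim0, fun _ => z, contDiff_const, Filter.Eventually.of_forall fun _ => rfl⟩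

variable {B} in
/-- A regular function, viewed as a smooth function on `X(ℝ)`. -/
def regularFunction (b : B) : smoothFunctions B :=
  ⟨fun x => ((x b : ℝ) : ℂ), fun _ => ⟨1, fun _ => b, fun v => ((v 0 : ℝ) : ℂ),
    Complex.ofRealCLM.contDiff.comp (contDiff_apply ℝ ℝ _),
    Filter.Eventually.of_forall fun _ => rfl⟩⟩

/-! ### Nash functions and Nash differential operators -/

/-- The semi-algebraic subsets of `X(ℝ)`: the Boolean algebra of subsets generated by the sets
`{x | b(x) > 0}`, where `b` is a regular function on `X`. -/
def semialgebraicSets : BooleanSubalgebra (Set (RealPoints B)) :=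
  BooleanSubalgebra.closure {S | ∃ b : B, S = {x | 0 < x b}}

variable {B} in
/-- The graph of `r : X(ℝ) → ℝ`, as a set of real points of `X × 𝔸¹ = Spec B[T]`. -/
def graph (r : RealPoints B → ℝ) : Set (RealPoints B[X]) :=
  {z | z Polynomial.X = r ⟨z.toAlgHom.comp Polynomial.CAlgHom⟩}

variable {B} in
/-- Nash functions on `X(ℝ)`: real-valued smooth functions with semi-algebraic graph. -/
def IsNash (f : smoothFunctions B) : Prop :=
  ∃ r : RealPoints B → ℝ, (∀ x, f.1 x = (r x : ℂ)) ∧ graph r ∈ semialgebraicSets B[X]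

variable {B} in
/-- Nash vector fields on `X(ℝ)`: smooth vector fields, i.e. derivations of `C^∞(X(ℝ))`, whose
coordinates in an embedding of `X` in an affine space, i.e. whose values on regular functions, are
Nash functions. -/
def IsNashVectorField (V : Derivation ℂ (smoothFunctions B) (smoothFunctions B)) : Prop :=
  ∀ b : B, IsNash (V (regularFunction b))

/-- The algebra of Nash differential operators on `X(ℝ)`: the algebra of operators on `C^∞(X(ℝ))`
generated by multiplications by Nash functions and by derivations along Nash vector fields. -/
def nashDiffOps : Subalgebra ℂ (Module.End ℂ (smoothFunctions B)) :=
  Algebra.adjoin ℂ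
    ({D | ∃ f : smoothFunctions B, IsNash f ∧ D = LinearMap.mulLeft ℂ f} ∪
      {D | ∃ V : Derivation ℂ (smoothFunctions B) (smoothFunctions B),
        IsNashVectorField V ∧ D = (V : smoothFunctions B →ₗ[ℂ] smoothFunctions B)})

/-! ### The Schwartz space -/

/-- Schwartz functions: the smooth functions `ξ` such that `D ξ` is bounded for every Nash
differential operator `D`. -/
def schwartzSubmodule : Submodule ℂ (smoothFunctions B) where
  carrier := {ξ | ∀ D ∈ nashDiffOps B, ∃ C : ℝ, ∀ x, ‖(D ξ).1 x‖ ≤ C}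
  zero_mem' := fun D _ => ⟨0, fun x => by simp⟩
  add_mem' := by
    intro ξ η hξ hη D hD
    obtain ⟨C, hC⟩ := hξ D hD
    obtain ⟨C', hC'⟩ := hη D hD
    refine ⟨C + C', fun x => ?_⟩
    rw [map_add]
    exact (norm_add_le _ _).trans (add_le_add (hC x) (hC' x))
  smul_mem' := by
    intro z ξ hξ D hD
    obtain ⟨C, hC⟩ := hξ D hD
    refine ⟨‖z‖ * C, fun x => ?_⟩
    rw [map_smul]
    exact (norm_mul_le _ _).trans (mul_le_mul_of_nonneg_left (hC x) (norm_nonneg z))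

/-- The Schwartz space `𝒮(X)`. -/
def SchwartzSpace : Type _ := schwartzSubmodule B

namespace SchwartzSpace

instance : AddCommGroup (SchwartzSpace B) := inferInstanceAs (AddCommGroup (schwartzSubmodule B))

instance : Module ℂ (SchwartzSpace B) := inferInstanceAs (Module ℂ (schwartzSubmodule B))

variable {B}

/-- The smooth function underlying a Schwartz function. -/
def toSmooth : SchwartzSpace B →ₗ[ℂ] smoothFunctions B := (schwartzSubmodule B).subtype

instance : CoeFun (SchwartzSpace B) (fun _ => RealPoints B → ℂ) := ⟨fun ξ => (toSmooth ξ).1⟩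

theorem bddAbove (D : nashDiffOps B) (ξ : SchwartzSpace B) :
    BddAbove (Set.range fun x => ‖(D.1 (toSmooth ξ)).1 x‖) := by
  obtain ⟨C, hC⟩ := Subtype.property (p := (· ∈ schwartzSubmodule B)) ξ D.1 D.2
  exact ⟨C, by rintro _ ⟨x, rfl⟩; exact hC x⟩

/-- The semi-norm `ξ ↦ sup_{X(ℝ)} |D ξ|` attached to a Nash differential operator `D`. -/
def seminorm (D : nashDiffOps B) : Seminorm ℂ (SchwartzSpace B) :=
  Seminorm.of (fun ξ => ⨆ x, ‖(D.1 (toSmooth ξ)).1 x‖)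
    (fun ξ η => by
      refine Real.iSup_le (fun x => ?_) (add_nonneg (Real.iSup_nonneg fun _ => norm_nonneg _)
        (Real.iSup_nonneg fun _ => norm_nonneg _))
      rw [map_add, map_add]
      exact (norm_add_le _ _).trans
        (add_le_add (le_ciSup (bddAbove D ξ) x) (le_ciSup (bddAbove D η) x)))
    (fun z ξ => by
      rw [Real.mul_iSup_of_nonneg (norm_nonneg z)]
      congr 1
      funext x
      rw [map_smul, map_smul]
      exact norm_mul z _)

variable (B) in
/-- The family of semi-norms defining the topology of `𝒮(X)`. -/
def seminormFamily : SeminormFamily ℂ (SchwartzSpace B) (nashDiffOps B) := seminorm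

instance : TopologicalSpace (SchwartzSpace B) := (seminormFamily B).moduleFilterBasis.topology

theorem withSeminorms : WithSeminorms (seminormFamily B) := ⟨rfl⟩

end SchwartzSpace

end Smooth

end SchwartzAction

end

noncomputable section
namespace SchwartzAction

/-! ### Order isomorphisms of the line and signs of polynomials -/

theorem exists_orderIso_of_strictMonoOn (f : ℝ → ℝ) (T : Finset ℝ) (hf : StrictMonoOn f T) :
    ∃ ψ : ℝ ≃o ℝ, ∀ t ∈ T, ψ t = f t := by
  induction T using Finset.induction_on_max with
  | empty => exact ⟨OrderIso.refl ℝ, by simp⟩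
  | insert a s has ih =>
    obtain ⟨ψ, hψ⟩ := ih (hf.mono (by simp))
    rcases s.eq_empty_or_nonempty with rfl | hs
    · exact ⟨OrderIso.addRight (f a - a), by simp⟩
    set m := s.max' hs with hm
    have hms : m ∈ s := s.max'_mem hs
    have hma : m < a := has m hms
    have hfa : ψ m < f a := by
      rw [hψ m hms]; exact hf (by simp [hms]) (by simp) hma
    set κ := (f a - ψ m) / (a - m) with hκ
    have hκ0 : 0 < κ := div_pos (by linarith) (by linarith)
    have hmono : StrictMono (fun x => if x ≤ m then ψ x else ψ m + (x - m) * κ) := by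
      intro x y hxy
      by_cases hx : x ≤ m <;> by_cases hy : y ≤ m
      · simpa [hx, hy] using hxy
      · simp only [hx, hy, if_true, if_false]
        have : ψ x ≤ ψ m := ψ.monotone hx
        have : 0 < (y - m) * κ := mul_pos (by linarith) hκ0
        linarith
      · exact absurd (hxy.le.trans hy) hx
      · simp only [hx, hy, if_false]
        have := mul_lt_mul_of_pos_right (show x - m < y - m by linarith) hκ0
        linarith
    refine ⟨hmono.orderIsoOfSurjective _ fun y => ?_, fun t ht => ?_⟩
    · by_cases hy : y ≤ ψ m
      · refine ⟨ψ.symm y, ?_⟩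
        have : ψ.symm y ≤ m := by rwa [OrderIso.symm_apply_le]
        simp [this]
      · have : 0 < (y - ψ m) / κ := div_pos (by linarith) hκ0
        refine ⟨m + (y - ψ m) / κ, ?_⟩
        have h2 : ¬ (m + (y - ψ m) / κ ≤ m) := by linarith
        simp only [h2, if_false]
        rw [add_sub_cancel_left, div_mul_cancel₀ _ hκ0.ne', add_sub_cancel]
    · change (if t ≤ m then ψ t else ψ m + (t - m) * κ) = f t
      rcases Finset.mem_insert.1 ht with rfl | ht
      · have h2 : ¬ t ≤ m := by linarith
        have h3 : t - m ≠ 0 := by linarith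
        rw [if_neg h2, hκ, mul_div_cancel₀ _ h3, add_sub_cancel]
      · have : t ≤ m := s.le_max' t ht
        simp [this, hψ t ht]

theorem sign_eval_eq_of_forall_ne_zero (b : ℝ[X]) {x y : ℝ} (hxy : x ≤ y)
    (h : ∀ z ∈ Set.Icc x y, b.eval z ≠ 0) : SignType.sign (b.eval x) = SignType.sign (b.eval y) := by
  have hc : ContinuousOn (fun z => b.eval z) (Set.Icc x y) := b.continuous.continuousOn
  rcases lt_or_gt_of_ne (h x ⟨le_rfl, hxy⟩) with h1 | h1 <;>
    rcases lt_or_gt_of_ne (h y ⟨hxy, le_rfl⟩) with h2 | h2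
  · rw [sign_neg h1, sign_neg h2]
  · obtain ⟨z, hz, hz0⟩ := intermediate_value_Icc hxy hc ⟨h1.le, h2.le⟩
    exact absurd hz0 (h z hz)
  · obtain ⟨z, hz, hz0⟩ := intermediate_value_Icc' hxy hc ⟨h2.le, h1.le⟩
    exact absurd hz0 (h z hz)
  · rw [sign_pos h1, sign_pos h2]

theorem exists_sign_eval_eq_sign_leadingCoeff (u : ℝ[X]) :
    ∃ M, ∀ x, M ≤ x → SignType.sign (u.eval x) = SignType.sign u.leadingCoeff := by
  obtain ⟨w, hw, h0⟩ := u.isEquivalent_atTop_lead.exists_eq_mul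
  obtain ⟨M, hM⟩ := Filter.eventually_atTop.1
    ((h0.and (hw.eventually (lt_mem_nhds one_pos))).and (Filter.eventually_gt_atTop (0 : ℝ)))
  refine ⟨M, fun x hx => ?_⟩
  obtain ⟨⟨h1, h3⟩, h2⟩ := hM x hx
  rw [show u.eval x = w x * (u.leadingCoeff * x ^ u.natDegree) from h1, sign_mul, sign_mul, sign_pos h3, sign_pos (pow_pos h2 _), mul_one, one_mul]

theorem exists_sign_eval_eq_sign_leadingCoeff_atBot (u : ℝ[X]) :
    ∃ M, ∀ x, x ≤ M →
      SignType.sign (u.eval x) = SignType.sign ((-1) ^ u.natDegree * u.leadingCoeff) := by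
  obtain ⟨M, hM⟩ := exists_sign_eval_eq_sign_leadingCoeff (u.comp (-Polynomial.X))
  refine ⟨-M, fun x hx => ?_⟩
  have := hM (-x) (by linarith)
  simpa [Polynomial.leadingCoeff_comp, mul_comm] using this

theorem sign_eval_eq_sign_leadingCoeff (u : ℝ[X]) (x : ℝ) (h : ∀ z, x ≤ z → u.eval z ≠ 0) :
    SignType.sign (u.eval x) = SignType.sign u.leadingCoeff := by
  obtain ⟨M, hM⟩ := exists_sign_eval_eq_sign_leadingCoeff u
  rw [← hM (max x M) (le_max_right _ _)]
  exact sign_eval_eq_of_forall_ne_zero u (le_max_left _ _) fun z hz => h z hz.1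

/-- Mean value theorem for signs. -/
theorem exists_sign_eval_sub (u : ℝ[X]) {x y : ℝ} (hxy : x < y) :
    ∃ z ∈ Set.Ioo x y, SignType.sign (u.eval y - u.eval x) = SignType.sign (u.derivative.eval z) := by
  obtain ⟨z, hz, h⟩ := exists_hasDerivAt_eq_slope (fun x => u.eval x) (fun x => u.derivative.eval x)
    hxy u.continuous.continuousOn fun x _ => u.hasDerivAt x
  refine ⟨z, hz, ?_⟩
  rw [h, div_eq_mul_inv, sign_mul, sign_pos (inv_pos.2 (sub_pos.2 hxy)), mul_one]

theorem sign_eval_comp_of_eqOn {S : Finset ℝ} {φ ψ : ℝ ≃o ℝ} (hφψ : ∀ s ∈ S, ψ s = φ s)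
    {q q' : ℝ[X]} (h : ∀ x, SignType.sign (q.eval x) = SignType.sign (q'.eval (φ x)))
    (hS : ∀ x, q.eval x = 0 → x ∈ S) (x : ℝ) :
    SignType.sign (q.eval x) = SignType.sign (q'.eval (ψ x)) := by
  obtain ⟨z, hz⟩ := φ.surjective (ψ x)
  rw [← hz, ← h]
  by_cases hx : x ∈ S
  · rw [hφψ x hx, φ.apply_eq_iff_eq] at hz; rw [hz]
  rcases le_total x z with hxz | hxz
  · refine sign_eval_eq_of_forall_ne_zero q hxz fun w hw h0 => ?_
    have hw' := hS w h0
    have h1 : ψ w ≤ ψ x := by rw [hφψ w hw', ← hz]; exact φ.monotone hw.2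
    exact hx (le_antisymm hw.1 (ψ.le_iff_le.1 h1) ▸ hw')
  · refine (sign_eval_eq_of_forall_ne_zero q hxz fun w hw h0 => ?_).symm
    have hw' := hS w h0
    have h1 : ψ x ≤ ψ w := by rw [hφψ w hw', ← hz]; exact φ.monotone hw.1
    exact hx (le_antisymm hw.2 (ψ.le_iff_le.1 h1) ▸ hw')

theorem exists_root_in_same_gap {S : Finset ℝ} {φ : ℝ ≃o ℝ} {u v : ℝ[X]}
    (hlc : SignType.sign u.leadingCoeff = SignType.sign v.leadingCoeff)
    (hdeg : u.natDegree = v.natDegree)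
    (hdS : ∀ x, u.derivative.eval x = 0 → x ∈ S)
    (hS : ∀ x ∈ S, SignType.sign (u.eval x) = SignType.sign (v.eval (φ x)))
    {r : ℝ} (hr : r ∉ S) (hur : u.eval r = 0) :
    ∃ r', v.eval r' = 0 ∧ ∀ s ∈ S, (s < r → φ s < r') ∧ (r < s → r' < φ s) := by
  have hd0 : u.derivative.eval r ≠ 0 := fun h => hr (hdS r h)
  obtain ⟨x₁, hx₁r, hx₁S, hx₁⟩ : ∃ x₁ < r, (∀ s ∈ S, s < r → s ≤ x₁) ∧
      SignType.sign (u.eval x₁) = SignType.sign (v.eval (φ x₁)) := by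
    by_cases hne : (S.filter (· < r)).Nonempty
    · have hmem := Finset.max'_mem _ hne
      rw [Finset.mem_filter] at hmem
      exact ⟨_, hmem.2, fun s hs hsr => Finset.le_max' _ _ (by simp [hs, hsr]), hS _ hmem.1⟩
    · obtain ⟨M, hM⟩ := exists_sign_eval_eq_sign_leadingCoeff_atBot u
      obtain ⟨M', hM'⟩ := exists_sign_eval_eq_sign_leadingCoeff_atBot v
      refine ⟨min (r - 1) (min M (φ.symm M')), by simp, fun s hs hsr => ?_, ?_⟩
      · exact absurd ⟨s, by simp [hs, hsr]⟩ hne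
      · rw [hM _ (by simp), hM' _ (by rw [← φ.le_symm_apply]; simp), sign_mul, sign_mul, hlc, hdeg]
  obtain ⟨x₂, hx₂r, hx₂S, hx₂⟩ : ∃ x₂ > r, (∀ s ∈ S, r < s → x₂ ≤ s) ∧
      SignType.sign (u.eval x₂) = SignType.sign (v.eval (φ x₂)) := by
    by_cases hne : (S.filter (r < ·)).Nonempty
    · have hmem := Finset.min'_mem _ hne
      rw [Finset.mem_filter] at hmem
      exact ⟨_, hmem.2, fun s hs hsr => Finset.min'_le _ _ (by simp [hs, hsr]), hS _ hmem.1⟩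
    · obtain ⟨M, hM⟩ := exists_sign_eval_eq_sign_leadingCoeff u
      obtain ⟨M', hM'⟩ := exists_sign_eval_eq_sign_leadingCoeff v
      refine ⟨max (r + 1) (max M (φ.symm M')), by simp, fun s hs hsr => ?_, ?_⟩
      · exact absurd ⟨s, by simp [hs, hsr]⟩ hne
      · rw [hM _ (by simp), hM' _ (by rw [← φ.symm_apply_le]; simp), hlc]
  have h1 : SignType.sign (u.eval x₁) = - SignType.sign (u.derivative.eval r) := by
    obtain ⟨z, hz, h⟩ := exists_sign_eval_sub u hx₁r
    rw [hur, zero_sub, Left.sign_neg] at h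
    rw [← neg_neg (SignType.sign (u.eval x₁)), h, neg_inj]
    refine sign_eval_eq_of_forall_ne_zero _ hz.2.le fun w hw h0 => ?_
    have hwr : w ≠ r := fun h => hd0 (h ▸ h0)
    have := hx₁S w (hdS w h0) (lt_of_le_of_ne hw.2 hwr)
    linarith [hz.1, hw.1]
  have h2 : SignType.sign (u.eval x₂) = SignType.sign (u.derivative.eval r) := by
    obtain ⟨z, hz, h⟩ := exists_sign_eval_sub u hx₂r
    rw [hur, sub_zero] at h
    rw [h]
    refine (sign_eval_eq_of_forall_ne_zero _ hz.1.le fun w hw h0 => ?_).symm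
    have hwr : r ≠ w := fun h => hd0 (h ▸ h0)
    have := hx₂S w (hdS w h0) (lt_of_le_of_ne hw.1 hwr)
    linarith [hz.2, hw.2]
  rw [hx₁] at h1
  rw [hx₂] at h2
  have hlt : φ x₁ < φ x₂ := φ.strictMono (hx₁r.trans hx₂r)
  obtain ⟨r', hr', hv⟩ : ∃ r' ∈ Set.Icc (φ x₁) (φ x₂), v.eval r' = 0 := by
    by_contra! hcon
    have := sign_eval_eq_of_forall_ne_zero v hlt.le hcon
    rw [h1, h2] at this
    have h3 : SignType.sign (u.derivative.eval r) ≠ 0 := by simpa using hd0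
    revert h3 this
    generalize SignType.sign (u.derivative.eval r) = σ
    revert σ; decide
  have hne0 : SignType.sign (u.derivative.eval r) ≠ 0 := by simpa using hd0
  have hr1 : φ x₁ < r' := lt_of_le_of_ne hr'.1 fun h => by
    rw [h, hv, sign_zero] at h1; exact hne0 (by simpa using h1.symm)
  have hr2 : r' < φ x₂ := lt_of_le_of_ne hr'.2 fun h => by
    rw [← h, hv, sign_zero] at h2; exact hne0 h2.symm
  exact ⟨r', hv, fun s hs => ⟨fun h => (φ.monotone (hx₁S s hs h)).trans_lt hr1,
    fun h => hr2.trans_le (φ.monotone (hx₂S s hs h))⟩⟩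

theorem exists_orderIso_sign_eval {S : Finset ℝ} {φ : ℝ ≃o ℝ} {u v : ℝ[X]}
    (hlc : SignType.sign u.leadingCoeff = SignType.sign v.leadingCoeff)
    (hdeg : u.natDegree = v.natDegree) (hu0 : u ≠ 0)
    (hd : ∀ x, SignType.sign (u.derivative.eval x) = SignType.sign (v.derivative.eval (φ x)))
    (hdS : ∀ x, u.derivative.eval x = 0 → x ∈ S)
    (hS : ∀ x ∈ S, SignType.sign (u.eval x) = SignType.sign (v.eval (φ x))) :
    ∃ ψ : ℝ ≃o ℝ, (∀ s ∈ S, ψ s = φ s) ∧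
      ∀ x, SignType.sign (u.eval x) = SignType.sign (v.eval (ψ x)) := by
  classical
  have hroot : ∀ r, ∃ r', r ∉ S → u.eval r = 0 →
      v.eval r' = 0 ∧ ∀ s ∈ S, (s < r → φ s < r') ∧ (r < s → r' < φ s) := by
    intro r
    by_cases hr : r ∉ S ∧ u.eval r = 0
    · obtain ⟨r', h⟩ := exists_root_in_same_gap hlc hdeg hdS hS hr.1 hr.2
      exact ⟨r', fun _ _ => h⟩
    · exact ⟨0, fun h1 h2 => absurd ⟨h1, h2⟩ hr⟩
  choose f hf using hroot
  set g : ℝ → ℝ := fun x => if x ∈ S then φ x else f x with hg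
  set T : Finset ℝ := S ∪ u.roots.toFinset with hT
  have hTu : ∀ x, x ∈ T ↔ x ∈ S ∨ u.eval x = 0 := fun x => by
    simp [hT, hu0, Polynomial.IsRoot]
  have hmono : StrictMonoOn g T := by
    intro x hx y hy hxy
    rw [Finset.mem_coe, hTu] at hx hy
    by_cases hxS : x ∈ S <;> by_cases hyS : y ∈ S
    · simpa [hg, hxS, hyS] using hxy
    · simpa [hg, hxS, hyS] using ((hf y hyS (hy.resolve_left hyS)).2 x hxS).1 hxy
    · simpa [hg, hxS, hyS] using ((hf x hxS (hx.resolve_left hxS)).2 y hyS).2 hxy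
    · have hx0 := hx.resolve_left hxS
      have hy0 := hy.resolve_left hyS
      obtain ⟨z, hz, h⟩ := exists_sign_eval_sub u hxy
      rw [hx0, hy0, sub_zero, sign_zero, eq_comm, sign_eq_zero_iff] at h
      have hzS := hdS z h
      simp only [hg, hxS, hyS, if_false]
      exact (((hf x hxS hx0).2 z hzS).2 hz.1).trans (((hf y hyS hy0).2 z hzS).1 hz.2)
  obtain ⟨ψ, hψ⟩ := exists_orderIso_of_strictMonoOn g T hmono
  have hψS : ∀ s ∈ S, ψ s = φ s := fun s hs => by
    rw [hψ s ((hTu s).2 (Or.inl hs))]; simp [hg, hs]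
  have hψu : ∀ r, u.eval r = 0 → v.eval (ψ r) = 0 := by
    intro r hr
    by_cases hrS : r ∈ S
    · rw [hψS r hrS]
      exact sign_eq_zero_iff.1 (by rw [← hS r hrS, hr, sign_zero])
    · rw [hψ r ((hTu r).2 (Or.inr hr))]
      simpa [hg, hrS] using (hf r hrS hr).1
  have hdS' : ∀ x, v.derivative.eval x = 0 → φ.symm x ∈ S := fun x hx => hdS _ (by
    have := hd (φ.symm x)
    rwa [φ.apply_symm_apply, hx, sign_zero, sign_eq_zero_iff] at this)
  have hψv : ∀ r, v.eval (ψ r) = 0 → u.eval r = 0 := by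
    intro r hr
    by_cases hrS : r ∈ S
    · have := hS r hrS
      rwa [← hψS r hrS, hr, sign_zero, sign_eq_zero_iff] at this
    · obtain ⟨t, ht, htS⟩ := exists_root_in_same_gap (S := S.image φ) (φ := φ.symm) (u := v) (v := u)
        (r := ψ r) hlc.symm hdeg.symm
        (fun x hx => Finset.mem_image.2 ⟨_, hdS' x hx, by simp⟩)
        (fun x hx => by
          obtain ⟨s, hs, rfl⟩ := Finset.mem_image.1 hx
          simpa using (hS s hs).symm)
        (fun h => by
          obtain ⟨s, hs, h⟩ := Finset.mem_image.1 h
          rw [← hψS s hs, ψ.apply_eq_iff_eq] at h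
          exact hrS (h ▸ hs)) hr
      have htS' : ∀ s ∈ S, (s < r → s < t) ∧ (r < s → t < s) := by
        intro s hs
        have := htS (φ s) (Finset.mem_image_of_mem _ hs)
        rwa [← hψS s hs, ψ.lt_iff_lt, ψ.lt_iff_lt, hψS s hs, φ.symm_apply_apply] at this
      have key : ∀ z, v.derivative.eval z = 0 → ∃ s ∈ S, z = ψ s := fun z hz =>
        ⟨_, hdS' z hz, by rw [hψS _ (hdS' z hz)]; simp⟩
      rcases lt_trichotomy t r with h | h | h
      · obtain ⟨z, hz, h'⟩ := exists_sign_eval_sub v (ψ.strictMono h)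
        rw [hr, hψu t ht, sub_zero, sign_zero, eq_comm, sign_eq_zero_iff] at h'
        obtain ⟨s, hs, rfl⟩ := key z h'
        have h1 := ψ.lt_iff_lt.1 hz.1
        have h2 := ψ.lt_iff_lt.1 hz.2
        exact absurd ((htS' s hs).1 h2) (by linarith)
      · rwa [← h]
      · obtain ⟨z, hz, h'⟩ := exists_sign_eval_sub v (ψ.strictMono h)
        rw [hr, hψu t ht, sub_zero, sign_zero, eq_comm, sign_eq_zero_iff] at h'
        obtain ⟨s, hs, rfl⟩ := key z h'
        have h1 := ψ.lt_iff_lt.1 hz.1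
        have h2 := ψ.lt_iff_lt.1 hz.2
        exact absurd ((htS' s hs).2 h1) (by linarith)
  refine ⟨ψ, hψS, fun x => ?_⟩
  by_cases hx0 : u.eval x = 0
  · rw [hx0, hψu x hx0]
  by_cases hxS : x ∈ S
  · rw [hψS x hxS, hS x hxS]
  have hvψ : ∀ w, v.eval w = 0 → u.eval (ψ.symm w) = 0 := fun w hw => hψv _ (by simpa using hw)
  by_cases hne : (T.filter (x < ·)).Nonempty
  · set t := (T.filter (x < ·)).min' hne with ht
    have hmem := Finset.min'_mem _ hne
    rw [← ht, Finset.mem_filter] at hmem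
    have hmin : ∀ z ∈ T, x < z → t ≤ z := fun z hz hxz => Finset.min'_le _ _ (by simp [hz, hxz])
    have hT' : ∀ z ∈ T, x ≤ z → t ≤ z := fun z hz hxz => hmin z hz (lt_of_le_of_ne hxz (by
      rintro rfl; rw [hTu] at hz; tauto))
    by_cases ht0 : u.eval t = 0
    · obtain ⟨z, hz, h⟩ := exists_sign_eval_sub u hmem.2
      obtain ⟨w, hw, h'⟩ := exists_sign_eval_sub v (ψ.strictMono hmem.2)
      rw [ht0, zero_sub, Left.sign_neg] at h
      rw [hψu t ht0, zero_sub, Left.sign_neg] at h'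
      rw [← neg_inj, h, h']
      have e1 : SignType.sign (u.derivative.eval x) = SignType.sign (u.derivative.eval z) :=
        sign_eval_eq_of_forall_ne_zero _ hz.1.le fun y hy h0 => by
          have := hT' y ((hTu y).2 (Or.inl (hdS y h0))) hy.1
          linarith [hy.2, hz.2]
      have e2 : SignType.sign (v.derivative.eval (ψ x)) = SignType.sign (v.derivative.eval w) :=
        sign_eval_eq_of_forall_ne_zero _ hw.1.le fun y hy h0 => by
          have hyS := hdS' y h0
          have hyψ : y = ψ (φ.symm y) := by rw [hψS _ hyS]; simp
          have h3 := hT' _ ((hTu _).2 (Or.inl hyS)) (by rw [← ψ.le_iff_le, ← hyψ]; exact hy.1)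
          rw [← ψ.le_iff_le, ← hyψ] at h3
          linarith [hy.2, hw.2]
      rw [← e1, ← e2]
      exact sign_eval_comp_of_eqOn hψS hd hdS x
    · have htS : t ∈ S := ((hTu t).1 hmem.1).resolve_right ht0
      have e1 : SignType.sign (u.eval x) = SignType.sign (u.eval t) :=
        sign_eval_eq_of_forall_ne_zero _ hmem.2.le fun y hy h0 => by
          have := hT' y ((hTu y).2 (Or.inr h0)) hy.1
          exact ht0 (le_antisymm this hy.2 ▸ h0)
      have e2 : SignType.sign (v.eval (ψ x)) = SignType.sign (v.eval (ψ t)) :=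
        sign_eval_eq_of_forall_ne_zero _ (ψ.monotone hmem.2.le) fun y hy h0 => by
          have h3 := hvψ y h0
          have h4 := hT' _ ((hTu _).2 (Or.inr h3)) (by rw [ψ.le_symm_apply]; exact hy.1)
          have h5 : ψ.symm y ≤ t := by rw [ψ.symm_apply_le]; exact hy.2
          exact ht0 (le_antisymm h4 h5 ▸ h3)
      rw [e1, e2, hψS t htS, hS t htS]
  · have hno : ∀ z ∈ T, ¬ x < z := fun z hz h => hne ⟨z, by simp [hz, h]⟩
    rw [sign_eval_eq_sign_leadingCoeff u x fun z hz h0 => ?_,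
      sign_eval_eq_sign_leadingCoeff v (ψ x) fun z hz h0 => ?_, hlc]
    · have h1 := hno _ ((hTu _).2 (Or.inr (hvψ z h0)))
      have h2 : x ≤ ψ.symm z := by rwa [ψ.le_symm_apply]
      exact hx0 (le_antisymm h2 (not_lt.1 h1) ▸ hvψ z h0)
    · have h1 := hno _ ((hTu _).2 (Or.inr h0))
      exact hx0 (le_antisymm hz (not_lt.1 h1) ▸ h0)

end SchwartzAction
end

noncomputable section
namespace SchwartzAction

/-! ### Families of polynomials closed under derivatives, truncations and remainders -/

section Closure

variable {B : Type*} [CommRing B]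

theorem exists_pseudo_remainder (p q : B[X]) (hq : 0 < q.natDegree) :
    ∃ (k : ℕ) (s r : B[X]), Polynomial.C (q.leadingCoeff ^ k) * p = q * s + r ∧
      r.natDegree < q.natDegree := by
  induction hn : p.natDegree using Nat.strong_induction_on generalizing p with
  | _ n ih =>
    by_cases hpq : p.natDegree < q.natDegree
    · exact ⟨0, 0, p, by simp, hpq⟩
    rw [not_lt] at hpq
    set m := Polynomial.C p.leadingCoeff * Polynomial.X ^ (p.natDegree - q.natDegree) with hm
    set p₁ := Polynomial.C q.leadingCoeff * p - m * q with hp₁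
    have hle : p₁.natDegree ≤ p.natDegree := by
      refine (Polynomial.natDegree_sub_le _ _).trans (max_le (Polynomial.natDegree_C_mul_le _ _) ?_)
      refine Polynomial.natDegree_mul_le.trans ?_
      have := Polynomial.natDegree_C_mul_X_pow_le p.leadingCoeff (p.natDegree - q.natDegree)
      rw [← hm] at this
      omega
    have hco : p₁.coeff p.natDegree = 0 := by
      rw [hp₁, Polynomial.coeff_sub, Polynomial.coeff_C_mul, hm, mul_assoc, Polynomial.coeff_C_mul]
      nth_rw 3 [← Nat.sub_add_cancel hpq]
      rw [add_comm (p.natDegree - q.natDegree), Polynomial.coeff_X_pow_mul]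
      simp [mul_comm]
    have hlt : p₁.natDegree < n := by
      rw [← hn]
      refine lt_of_le_of_ne hle fun h => ?_
      rw [← h, Polynomial.coeff_natDegree, Polynomial.leadingCoeff_eq_zero] at hco
      rw [hco, Polynomial.natDegree_zero] at h
      omega
    obtain ⟨k, s, r, h, hr⟩ := ih _ hlt p₁ rfl
    refine ⟨k + 1, s + Polynomial.C (q.leadingCoeff ^ k) * m, r, ?_, hr⟩
    rw [pow_succ, Polynomial.C_mul]
    linear_combination h

def pseudoRem (p q : B[X]) : B[X] :=
  open Classical in
  if hq : 0 < q.natDegree then (exists_pseudo_remainder p q hq).choose_spec.choose_spec.choose else 0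

theorem pseudoRem_spec (p q : B[X]) (hq : 0 < q.natDegree) :
    (∃ (k : ℕ) (s : B[X]), Polynomial.C (q.leadingCoeff ^ k) * p = q * s + pseudoRem p q) ∧
      (pseudoRem p q).natDegree < q.natDegree := by
  rw [pseudoRem, dif_pos hq]
  have := (exists_pseudo_remainder p q hq).choose_spec.choose_spec.choose_spec
  exact ⟨⟨_, _, this.1⟩, this.2⟩

/-- `P` contains the derivative, the truncation, the leading coefficient, and the pseudo-remainders
of its non-constant elements. -/
def IsEliminationClosed (P : Finset B[X]) : Prop :=
  ∀ p ∈ P, 0 < p.natDegree → (p.derivative ∈ P ∧ p.eraseLead ∈ P ∧ Polynomial.C p.leadingCoeff ∈ P ∧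
    ∀ q ∈ P, 0 < q.natDegree → q.natDegree ≤ p.natDegree → pseudoRem p q ∈ P)

theorem exists_isEliminationClosed (F : Finset B[X]) :
    ∃ P : Finset B[X], F ⊆ P ∧ IsEliminationClosed P := by
  classical
  let N : Finset B[X] → Finset B[X] := fun F => F.filter (0 < ·.natDegree)
  let step : Finset B[X] → Finset B[X] := fun F => F ∪ ((N F).image Polynomial.derivative ∪
    (N F).image Polynomial.eraseLead ∪ (N F).image (fun p => Polynomial.C p.leadingCoeff) ∪
    (((N F) ×ˢ (N F)).filter (fun z => z.2.natDegree ≤ z.1.natDegree)).image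
      (fun z => pseudoRem z.1 z.2))
  have hstep : ∀ F r, r ∈ step F ↔ r ∈ F ∨ (∃ p ∈ F, 0 < p.natDegree ∧ (p.derivative = r ∨
      p.eraseLead = r ∨ Polynomial.C p.leadingCoeff = r ∨
      ∃ q ∈ F, 0 < q.natDegree ∧ q.natDegree ≤ p.natDegree ∧ pseudoRem p q = r)) := by
    intro F r
    simp only [step, N, Finset.mem_union, Finset.mem_image, Finset.mem_filter, Finset.mem_product,
      Prod.exists]
    constructor
    · rintro (h | ((⟨p, ⟨h, h'⟩, e⟩ | ⟨p, ⟨h, h'⟩, e⟩) | ⟨p, ⟨h, h'⟩, e⟩) |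
        ⟨p, q, ⟨⟨⟨h1, h2⟩, h3, h4⟩, h5⟩, e⟩)
      · exact Or.inl h
      · exact Or.inr ⟨p, h, h', Or.inl e⟩
      · exact Or.inr ⟨p, h, h', Or.inr (Or.inl e)⟩
      · exact Or.inr ⟨p, h, h', Or.inr (Or.inr (Or.inl e))⟩
      · exact Or.inr ⟨p, h1, h2, Or.inr (Or.inr (Or.inr ⟨q, h3, h4, h5, e⟩))⟩
    · rintro (h | ⟨p, h, h', e | e | e | ⟨q, h3, h4, h5, e⟩⟩)
      · exact Or.inl h
      · exact Or.inr (Or.inl (Or.inl (Or.inl ⟨p, ⟨h, h'⟩, e⟩)))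
      · exact Or.inr (Or.inl (Or.inl (Or.inr ⟨p, ⟨h, h'⟩, e⟩)))
      · exact Or.inr (Or.inl (Or.inr ⟨p, ⟨h, h'⟩, e⟩))
      · exact Or.inr (Or.inr ⟨p, q, ⟨⟨⟨h, h'⟩, h3, h4⟩, h5⟩, e⟩)
  have herase : ∀ p : B[X], 0 < p.natDegree → p.eraseLead.natDegree < p.natDegree := fun p hp => by
    have := Polynomial.eraseLead_natDegree_le p
    omega
  let G : ℕ → Finset B[X] := fun j => step^[j] F
  have hG : ∀ j, G (j + 1) = step (G j) := fun j => Function.iterate_succ_apply' step j F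
  obtain ⟨d, hd⟩ : ∃ d, ∀ p ∈ step F, p.natDegree ≤ d :=
    ⟨(step F).sup Polynomial.natDegree, fun p hp => Finset.le_sup (f := Polynomial.natDegree) hp⟩
  have hnew : ∀ j, ∀ r ∈ G (j + 1), r ∉ G j → r.natDegree + j ≤ d := by
    intro j
    induction j with
    | zero => exact fun r hr _ => hd r hr
    | succ j ih =>
      intro r hr hr'
      rw [hG, hstep] at hr
      rcases hr with hr | ⟨p, hp, hp0, h⟩
      · exact absurd hr hr'
      by_cases hpj : p ∈ G j
      · rcases h with h | h | h | ⟨q, hq, hq0, hqp, h⟩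
        · exact absurd (by rw [hG, hstep]; exact Or.inr ⟨p, hpj, hp0, Or.inl h⟩) hr'
        · exact absurd (by rw [hG, hstep]; exact Or.inr ⟨p, hpj, hp0, Or.inr (Or.inl h)⟩) hr'
        · exact absurd
            (by rw [hG, hstep]; exact Or.inr ⟨p, hpj, hp0, Or.inr (Or.inr (Or.inl h))⟩) hr'
        · by_cases hqj : q ∈ G j
          · exact absurd (by
              rw [hG, hstep]
              exact Or.inr ⟨p, hpj, hp0, Or.inr (Or.inr (Or.inr ⟨q, hqj, hq0, hqp, h⟩))⟩) hr'
          · have h1 := ih q hq hqj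
            have h2 := (pseudoRem_spec p q hq0).2
            rw [h] at h2
            omega
      · have h1 := ih p hp hpj
        have h2 : r.natDegree < p.natDegree := by
          rcases h with h | h | h | ⟨q, hq, hq0, hqp, h⟩
          · rw [← h]; exact Polynomial.natDegree_derivative_lt hp0.ne'
          · rw [← h]; exact herase p hp0
          · rw [← h, Polynomial.natDegree_C]; exact hp0
          · rw [← h]; exact (pseudoRem_spec p q hq0).2.trans_le hqp
        omega
  have hsub : ∀ j, F ⊆ G j := by
    intro j
    induction j with
    | zero => exact fun _ h => h
    | succ j ih => exact fun r hr => by rw [hG, hstep]; exact Or.inl (ih hr)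
  refine ⟨G (d + 1), hsub _, fun p hp hp0 => ?_⟩
  have hcl : ∀ r ∈ G (d + 1 + 1), r ∈ G (d + 1) := fun r hr => by
    by_contra h
    have := hnew _ r hr h
    omega
  refine ⟨hcl _ ?_, hcl _ ?_, hcl _ ?_, fun q hq hq0 hqp => hcl _ ?_⟩ <;> rw [hG, hstep]
  · exact Or.inr ⟨p, hp, hp0, Or.inl rfl⟩
  · exact Or.inr ⟨p, hp, hp0, Or.inr (Or.inl rfl)⟩
  · exact Or.inr ⟨p, hp, hp0, Or.inr (Or.inr (Or.inl rfl))⟩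
  · exact Or.inr ⟨p, hp, hp0, Or.inr (Or.inr (Or.inr ⟨q, hq, hq0, hqp, rfl⟩))⟩

end Closure

/-! ### Quantifier elimination -/

section Elimination

variable {B : Type*} [CommRing B]

theorem map_eraseLead_of_leadingCoeff_eq_zero (y : B →+* ℝ) {p : B[X]} (h : y p.leadingCoeff = 0) :
    p.eraseLead.map y = p.map y := by
  conv_rhs => rw [← p.eraseLead_add_C_mul_X_pow, Polynomial.map_add, Polynomial.map_mul,
    Polynomial.map_C, h, Polynomial.C_0, zero_mul, add_zero]

theorem exists_orderIso_sign_eval_of_subset {P : Finset B[X]} (hP : IsEliminationClosed P)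
    (y y' : B →+* ℝ)
    (hy : ∀ p ∈ P, SignType.sign (y (p.coeff 0)) = SignType.sign (y' (p.coeff 0)))
    (Q : Finset B[X]) (hQP : Q ⊆ P)
    (hQ : ∀ p ∈ Q, ∀ q ∈ P, q.natDegree < p.natDegree → q ∈ Q) :
    ∃ φ : ℝ ≃o ℝ, ∀ p ∈ Q, ∀ x,
      SignType.sign ((p.map y).eval x) = SignType.sign ((p.map y').eval (φ x)) := by
  classical
  induction Q using Finset.induction_on_max_value (Polynomial.natDegree (R := B)) with
  | empty => exact ⟨OrderIso.refl ℝ, by simp⟩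
  | insert a s has hmax ih =>
  obtain ⟨φ, hφ⟩ := ih (fun p hp => hQP (Finset.mem_insert_of_mem hp)) fun p hp q hq hqp => by
    refine (Finset.mem_insert.1 (hQ p (Finset.mem_insert_of_mem hp) q hq hqp)).resolve_left ?_
    rintro rfl
    exact absurd (hmax p hp) (by omega)
  have haP : a ∈ P := hQP (Finset.mem_insert_self _ _)
  have hlow : ∀ q ∈ P, q.natDegree < a.natDegree → q ∈ s := fun q hq hqa =>
    (Finset.mem_insert.1 (hQ a (Finset.mem_insert_self _ _) q hq hqa)).resolve_left fun h => by
      simp [h] at hqa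
  have hlow' : ∀ p ∈ s, ∀ q ∈ P, q.natDegree < p.natDegree → q ∈ s := fun p hp q hq hqp =>
    hlow q hq (hqp.trans_le (hmax p hp))
  rcases Nat.eq_zero_or_pos a.natDegree with ha0 | ha0
  · refine ⟨φ, fun p hp x => ?_⟩
    rcases Finset.mem_insert.1 hp with rfl | hp
    · have := hy p haP
      rw [Polynomial.eq_C_of_natDegree_eq_zero ha0]
      simpa using this
    · exact hφ p hp x
  have hlcsign : ∀ p ∈ P, 0 < p.natDegree →
      SignType.sign (y p.leadingCoeff) = SignType.sign (y' p.leadingCoeff) := fun p hp hp0 => by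
    simpa using hy _ (hP p hp hp0).2.2.1
  have hlc0 : ∀ p ∈ P, 0 < p.natDegree → (y p.leadingCoeff = 0 ↔ y' p.leadingCoeff = 0) :=
    fun p hp hp0 => by rw [← sign_eq_zero_iff, hlcsign p hp hp0, sign_eq_zero_iff]
  have herase : ∀ p : B[X], 0 < p.natDegree → p.eraseLead.natDegree < p.natDegree := fun p hp => by
    have := Polynomial.eraseLead_natDegree_le p
    omega
  by_cases hlc : y a.leadingCoeff = 0
  · refine ⟨φ, fun p hp x => ?_⟩
    rcases Finset.mem_insert.1 hp with rfl | hp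
    · rw [← map_eraseLead_of_leadingCoeff_eq_zero y hlc,
        ← map_eraseLead_of_leadingCoeff_eq_zero y' ((hlc0 _ haP ha0).1 hlc)]
      exact hφ _ (hlow _ (hP _ haP ha0).2.1 (herase _ ha0)) x
    · exact hφ p hp x
  have hlc' : y' a.leadingCoeff ≠ 0 := fun h => hlc ((hlc0 _ haP ha0).2 h)
  set S : Finset ℝ := s.biUnion fun q => (q.map y).roots.toFinset with hS
  have hSroot : ∀ q ∈ s, q.map y ≠ 0 → ∀ x, (q.map y).eval x = 0 → x ∈ S := fun q hq hq0 x hx => by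
    rw [hS, Finset.mem_biUnion]
    exact ⟨q, hq, by simp [hq0, hx]⟩
  have hda := hlow _ (hP _ haP ha0).1 (Polynomial.natDegree_derivative_lt ha0.ne')
  have hua : (a.map y).natDegree = a.natDegree := Polynomial.natDegree_map_of_leadingCoeff_ne_zero _ hlc
  have hva : (a.map y').natDegree = a.natDegree :=
    Polynomial.natDegree_map_of_leadingCoeff_ne_zero _ hlc'
  have hu0 : a.map y ≠ 0 := fun h => by rw [h] at hua; simp at hua; omega
  have hdu0 : a.derivative.map y ≠ 0 := fun h => by
    rw [← Polynomial.derivative_map] at h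
    have := Polynomial.derivative_eq_zero.1 h
    omega
  obtain ⟨ψ, hψS, hψ⟩ := exists_orderIso_sign_eval (S := S) (φ := φ) (u := a.map y) (v := a.map y')
    (by rw [Polynomial.leadingCoeff_map_of_leadingCoeff_ne_zero _ hlc,
          Polynomial.leadingCoeff_map_of_leadingCoeff_ne_zero _ hlc', hlcsign a haP ha0])
    (by rw [hua, hva]) hu0
    (by simpa only [Polynomial.derivative_map] using hφ _ hda)
    (by simpa only [Polynomial.derivative_map] using hSroot _ hda hdu0) (by
      intro x hx
      obtain ⟨q, hq, hmin⟩ := Finset.exists_min_image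
        (s.filter fun q => q.map y ≠ 0 ∧ (q.map y).eval x = 0) Polynomial.natDegree (by
          obtain ⟨q, hq, h⟩ := Finset.mem_biUnion.1 hx
          exact ⟨q, by simpa [hq] using h⟩)
      rw [Finset.mem_filter] at hq
      obtain ⟨hqs, hq0, hqx⟩ := hq
      have hqP : q ∈ P := hQP (Finset.mem_insert_of_mem hqs)
      have hqd : 0 < q.natDegree := by
        by_contra h
        have h' : q.natDegree = 0 := by omega
        rw [Polynomial.eq_C_of_natDegree_eq_zero h'] at hqx hq0
        simp at hqx hq0
        exact hq0 hqx
      have hqlc : y q.leadingCoeff ≠ 0 := fun h => by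
        have h1 := map_eraseLead_of_leadingCoeff_eq_zero y h
        have h2 := herase q hqd
        have := hmin q.eraseLead (by
          rw [Finset.mem_filter, h1]
          exact ⟨hlow' q hqs _ (hP q hqP hqd).2.1 h2, hq0, hqx⟩)
        omega
      have hqx' : (q.map y').eval (φ x) = 0 := by
        have := hφ q hqs x
        rwa [hqx, sign_zero, eq_comm, sign_eq_zero_iff] at this
      obtain ⟨⟨k, t, hk⟩, hr⟩ := pseudoRem_spec a q hqd
      have hrs := hφ _ (hlow' q hqs _ ((hP a haP ha0).2.2.2 q hqP hqd (hmax q hqs)) hr) x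
      have e1 := congrArg (fun p => (p.map y).eval x) hk
      have e2 := congrArg (fun p => (p.map y').eval (φ x)) hk
      simp only [Polynomial.map_mul, Polynomial.map_add, Polynomial.map_C, Polynomial.eval_mul,
        Polynomial.eval_add, Polynomial.eval_C, hqx, hqx', zero_mul, zero_add] at e1 e2
      rw [← e1, ← e2, sign_mul, sign_mul, map_pow y, map_pow y', sign_pow, sign_pow, ← hlcsign q hqP hqd] at hrs
      refine mul_left_cancel₀ (pow_ne_zero k ?_) hrs
      rwa [Ne, sign_eq_zero_iff])
  refine ⟨ψ, fun p hp x => ?_⟩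
  rcases Finset.mem_insert.1 hp with rfl | hp
  · exact hψ x
  by_cases hp0 : p.map y = 0
  · have : ((p.map y').eval (ψ x)) = 0 := by
      have := hφ p hp (φ.symm (ψ x))
      rwa [hp0, Polynomial.eval_zero, sign_zero, φ.apply_symm_apply, eq_comm,
        sign_eq_zero_iff] at this
    rw [hp0, this, Polynomial.eval_zero]
  · exact sign_eval_comp_of_eqOn hψS (hφ p hp) (hSroot p hp hp0) x

/-- Parameters which agree on the signs of finitely many elements give the same configuration of
signs on the line. -/
theorem exists_finset_orderIso_sign_eval (F : Finset B[X]) :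
    ∃ C : Finset B, ∀ y y' : B →+* ℝ, (∀ c ∈ C, SignType.sign (y c) = SignType.sign (y' c)) →
      ∃ φ : ℝ ≃o ℝ, ∀ p ∈ F, ∀ x,
        SignType.sign ((p.map y).eval x) = SignType.sign ((p.map y').eval (φ x)) := by
  classical
  obtain ⟨P, hFP, hP⟩ := exists_isEliminationClosed F
  refine ⟨P.image (·.coeff 0), fun y y' h => ?_⟩
  obtain ⟨φ, hφ⟩ := exists_orderIso_sign_eval_of_subset hP y y'
    (fun p hp => h _ (Finset.mem_image_of_mem _ hp)) P subset_rfl fun _ _ q hq _ => hq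
  exact ⟨φ, fun p hp => hφ p (hFP hp)⟩

end Elimination

end SchwartzAction
end

noncomputable section
namespace SchwartzAction

/-! ### Sets determined by finitely many signs, and their images -/

/-- Sets of ring homomorphisms to `ℝ` which are determined by the signs of finitely many elements. -/
def IsSignDetermined {R : Type*} [CommRing R] (T : Set (R →+* ℝ)) : Prop :=
  ∃ F : Finset R, ∀ y y' : R →+* ℝ, (∀ b ∈ F, SignType.sign (y b) = SignType.sign (y' b)) →
    y ∈ T → y' ∈ T

/-- The Tarski–Seidenberg theorem, for ring homomorphisms of finite presentation. -/
theorem IsSignDetermined.image {R : Type*} {S : Type*} [CommRing R] [CommRing S] (f : R →+* S)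
    (hf : f.FinitePresentation) {T : Set (S →+* ℝ)} (hT : IsSignDetermined T) :
    IsSignDetermined ((fun z => z.comp f) '' T) := by
  classical
  refine RingHom.FinitePresentation.polynomial_induction
    (P := fun R _ S _ f => ∀ T : Set (S →+* ℝ), IsSignDetermined T →
      IsSignDetermined ((fun z => z.comp f) '' T))
    (Q := fun R _ S _ f => ∀ T : Set (S →+* ℝ), IsSignDetermined T →
      IsSignDetermined ((fun z => z.comp f) '' T)) ?_ ?_ ?_ f hf T hT
  · rintro R _ T ⟨F, hF⟩
    obtain ⟨C, hC⟩ := exists_finset_orderIso_sign_eval F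
    refine ⟨C, ?_⟩
    rintro _ y' h ⟨z, hz, rfl⟩
    obtain ⟨φ, hφ⟩ := hC _ _ h
    refine ⟨Polynomial.eval₂RingHom y' (φ (z Polynomial.X)), hF z _ (fun p hp => ?_) hz, ?_⟩
    · have h1 := hφ p hp (z Polynomial.X)
      have h2 : z = Polynomial.eval₂RingHom (z.comp Polynomial.C) (z Polynomial.X) :=
        Polynomial.ringHom_ext (by simp) (by simp)
      rw [Polynomial.eval_map, Polynomial.eval_map] at h1
      rw [Polynomial.coe_eval₂RingHom, ← h1]
      conv_lhs => rw [h2]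
      rw [Polynomial.coe_eval₂RingHom]
    · ext a
      simp
  · rintro R _ S _ f hf ⟨t, ht⟩ T ⟨F, hF⟩
    refine ⟨F.image (Function.surjInv hf) ∪ t, ?_⟩
    rintro _ y' h ⟨z, hz, rfl⟩
    have hker : RingHom.ker f ≤ RingHom.ker y' := by
      rw [← ht, Submodule.span_le]
      intro a ha
      have h1 := h a (Finset.mem_union_right _ ha)
      have h2 : f a = 0 := by
        have : a ∈ RingHom.ker f := ht ▸ Submodule.subset_span ha
        exact this
      rw [RingHom.comp_apply, h2, map_zero, sign_zero, eq_comm, sign_eq_zero_iff] at h1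
      exact h1
    have hz' := f.liftOfRightInverse_comp _ (Function.rightInverse_surjInv hf) ⟨y', hker⟩
    refine ⟨_, hF z _ (fun b hb => ?_) hz, hz'⟩
    have h1 := h _ (Finset.mem_union_left _ (Finset.mem_image_of_mem _ hb))
    rw [RingHom.comp_apply, Function.surjInv_eq hf b] at h1
    rw [h1]
    have h2 := congrArg (fun g => g (Function.surjInv hf b)) hz'
    simp only [RingHom.comp_apply, Function.surjInv_eq hf b] at h2
    rw [h2]
  · intro R _ S _ S' _ f g hf hg T hT
    have := hf _ (hg T hT)
    rwa [Set.image_image] at this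

namespace RealPoints

variable {B C : Type*} [CommRing B] [Algebra ℝ B] [CommRing C] [Algebra ℝ C]

def comap (φ : B →ₐ[ℝ] C) (z : RealPoints C) : RealPoints B := ⟨z.toAlgHom.comp φ⟩

@[simp] theorem comap_apply (φ : B →ₐ[ℝ] C) (z : RealPoints C) (b : B) : comap φ z b = z (φ b) := rfl

theorem ext_apply {x y : RealPoints B} (h : ∀ b, x b = y b) : x = y :=
  RealPoints.ext (AlgHom.ext h)

/-- The projections and the pairing of the product of two affine varieties. -/
def fst (z : RealPoints (B ⊗[ℝ] C)) : RealPoints B := comap Algebra.TensorProduct.includeLeft z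

def snd (z : RealPoints (B ⊗[ℝ] C)) : RealPoints C := comap Algebra.TensorProduct.includeRight z

def pair (x : RealPoints B) (y : RealPoints C) : RealPoints (B ⊗[ℝ] C) :=
  ⟨Algebra.TensorProduct.productMap x.toAlgHom y.toAlgHom⟩

@[simp] theorem fst_pair (x : RealPoints B) (y : RealPoints C) : fst (pair x y) = x :=
  ext_apply fun b => by simp [fst, pair]

@[simp] theorem snd_pair (x : RealPoints B) (y : RealPoints C) : snd (pair x y) = y :=
  ext_apply fun b => by simp [snd, pair]

/-- The point `(x, t)` of `X × 𝔸¹`. -/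
def cons (x : RealPoints B) (t : ℝ) : RealPoints B[X] :=
  ⟨Polynomial.eval₂AlgHom x.toAlgHom t fun _ => Commute.all _ _⟩

def base (z : RealPoints B[X]) : RealPoints B := comap Polynomial.CAlgHom z

@[simp] theorem cons_C (x : RealPoints B) (t : ℝ) (b : B) : cons x t (Polynomial.C b) = x b := by
  simp [cons]

@[simp] theorem cons_X (x : RealPoints B) (t : ℝ) : cons x t Polynomial.X = t := by
  simp [cons]

@[simp] theorem base_cons (x : RealPoints B) (t : ℝ) : base (cons x t) = x :=
  ext_apply fun b => cons_C x t b

theorem base_apply (z : RealPoints B[X]) (b : B) : base z b = z (Polynomial.C b) := rfl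

theorem cons_base (z : RealPoints B[X]) : cons (base z) (z Polynomial.X) = z := by
  refine RealPoints.ext (Polynomial.algHom_ext' (AlgHom.ext fun b => ?_) ?_)
  · exact cons_C (base z) _ b
  · exact cons_X (base z) _

theorem mem_graph_iff (r : RealPoints B → ℝ) (z : RealPoints B[X]) :
    z ∈ graph r ↔ z Polynomial.X = r (base z) := Iff.rfl

end RealPoints

open RealPoints

/-! ### Semialgebraic sets and functions -/

section Semialgebraic

variable {B C : Type*} [CommRing B] [Algebra ℝ B] [CommRing C] [Algebra ℝ C]

theorem setOf_pos_mem_semialgebraicSets (b : B) : {x : RealPoints B | 0 < x b} ∈ semialgebraicSets B :=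
  BooleanSubalgebra.subset_closure ⟨b, rfl⟩

theorem compl_mem_semialgebraicSets {S : Set (RealPoints B)} (h : S ∈ semialgebraicSets B) :
    Sᶜ ∈ semialgebraicSets B := BooleanSubalgebra.compl_mem h

theorem inter_mem_semialgebraicSets {S T : Set (RealPoints B)} (h : S ∈ semialgebraicSets B)
    (h' : T ∈ semialgebraicSets B) : S ∩ T ∈ semialgebraicSets B := BooleanSubalgebra.inf_mem h h'

theorem setOf_sign_eq_mem_semialgebraicSets (b : B) (σ : SignType) :
    {x : RealPoints B | SignType.sign (x b) = σ} ∈ semialgebraicSets B := by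
  have hpos := setOf_pos_mem_semialgebraicSets b
  have hneg := setOf_pos_mem_semialgebraicSets (-b)
  rcases σ with _ | _ | _
  · convert inter_mem_semialgebraicSets (compl_mem_semialgebraicSets hpos)
      (compl_mem_semialgebraicSets hneg) using 1
    ext x
    simp [le_antisymm_iff]
  · convert hneg using 1
    ext x
    simp [sign_eq_neg_one_iff]
  · convert hpos using 1
    ext x
    simp [sign_eq_one_iff]

theorem mem_semialgebraicSets_iff {S : Set (RealPoints B)} :
    S ∈ semialgebraicSets B ↔ ∃ F : Finset B, ∀ x y : RealPoints B,
      (∀ b ∈ F, SignType.sign (x b) = SignType.sign (y b)) → x ∈ S → y ∈ S := by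
  classical
  constructor
  · intro h
    induction h using BooleanSubalgebra.closure_bot_sup_induction with
    | mem S h =>
      obtain ⟨b, rfl⟩ := h
      refine ⟨{b}, fun x y h hx => ?_⟩
      have := h b (by simp)
      rw [Set.mem_ofPred_eq, ← sign_eq_one_iff] at hx ⊢
      rw [← this, hx]
    | bot => exact ⟨∅, fun x y _ hx => hx⟩
    | sup S hS T hT ihS ihT =>
      obtain ⟨F, hF⟩ := ihS
      obtain ⟨G, hG⟩ := ihT
      refine ⟨F ∪ G, fun x y h hx => ?_⟩
      rcases hx with hx | hx
      · exact Or.inl (hF x y (fun b hb => h b (Finset.mem_union_left _ hb)) hx)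
      · exact Or.inr (hG x y (fun b hb => h b (Finset.mem_union_right _ hb)) hx)
    | compl S hS ih =>
      obtain ⟨F, hF⟩ := ih
      exact ⟨F, fun x y h hx hy => hx (hF y x (fun b hb => (h b hb).symm) hy)⟩
  · rintro ⟨F, hF⟩
    have : S = ⨆ σ : {σ : F → SignType // ∃ x ∈ S, ∀ b : F, SignType.sign (x b.1) = σ b},
        ⨅ b : F, {x : RealPoints B | SignType.sign (x b.1) = σ.1 b} := by
      ext y
      simp only [Set.iSup_eq_iUnion, Set.iInf_eq_iInter, Set.mem_iUnion, Set.mem_iInter,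
        Set.mem_ofPred_eq]
      constructor
      · exact fun hy => ⟨⟨fun b => SignType.sign (y b.1), y, hy, fun _ => rfl⟩, fun _ => rfl⟩
      · rintro ⟨⟨σ, x, hx, hxσ⟩, hyσ⟩
        exact hF x y (fun b hb => (hxσ ⟨b, hb⟩).trans (hyσ ⟨b, hb⟩).symm) hx
    rw [this]
    exact BooleanSubalgebra.iSup_mem fun σ => BooleanSubalgebra.iInf_mem fun b =>
      setOf_sign_eq_mem_semialgebraicSets _ _

theorem comap_preimage_mem_semialgebraicSets (φ : B →ₐ[ℝ] C) {S : Set (RealPoints B)}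
    (hS : S ∈ semialgebraicSets B) : comap φ ⁻¹' S ∈ semialgebraicSets C := by
  classical
  rw [mem_semialgebraicSets_iff] at hS ⊢
  obtain ⟨F, hF⟩ := hS
  exact ⟨F.image φ, fun x y h hx =>
    hF (comap φ x) (comap φ y) (fun b hb => h _ (Finset.mem_image_of_mem _ hb)) hx⟩

def algHomOfRingHomReal (y : B →+* ℝ) : B →ₐ[ℝ] ℝ where
  toRingHom := y
  commutes' t := congrArg (fun f : ℝ →+* ℝ => f t)
    (Subsingleton.elim (y.comp (algebraMap ℝ B)) (RingHom.id ℝ))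

theorem comap_image_mem_semialgebraicSets (φ : B →ₐ[ℝ] C) (hφ : φ.toRingHom.FinitePresentation)
    {S : Set (RealPoints C)} (hS : S ∈ semialgebraicSets C) :
    comap φ '' S ∈ semialgebraicSets B := by
  rw [mem_semialgebraicSets_iff] at hS ⊢
  obtain ⟨F, hF⟩ := hS
  obtain ⟨G, hG⟩ := IsSignDetermined.image φ.toRingHom hφ
    (T := {z | (⟨algHomOfRingHomReal z⟩ : RealPoints C) ∈ S}) ⟨F, fun y y' h hy => hF _ _ h hy⟩
  refine ⟨G, ?_⟩
  rintro _ y' h ⟨z, hz, rfl⟩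
  obtain ⟨z', hz', hzy⟩ := hG (z.toAlgHom.toRingHom.comp φ.toRingHom) y'.toAlgHom.toRingHom h
    ⟨z.toAlgHom.toRingHom, hz, rfl⟩
  exact ⟨_, hz', RealPoints.ext_apply fun b => congrArg (fun f : B →+* ℝ => f b) hzy⟩

theorem setOf_exists_point_mem_semialgebraicSets [Algebra.FinitePresentation ℝ C]
    {P : RealPoints B → RealPoints C → Prop}
    (h : {w : RealPoints (B ⊗[ℝ] C) | P (fst w) (snd w)} ∈ semialgebraicSets (B ⊗[ℝ] C)) :
    {x | ∃ y, P x y} ∈ semialgebraicSets B := by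
  have hfp : (Algebra.TensorProduct.includeLeft (R := ℝ) (S := ℝ) (A := B)
      (B := C)).toRingHom.FinitePresentation := by
    have : (algebraMap B (B ⊗[ℝ] C)).FinitePresentation :=
      RingHom.finitePresentation_algebraMap.2 inferInstance
    exact this
  convert comap_image_mem_semialgebraicSets _ hfp h using 1
  ext x
  constructor
  · rintro ⟨y, hy⟩
    exact ⟨pair x y, by simpa using hy, fst_pair x y⟩
  · rintro ⟨w, hw, rfl⟩
    exact ⟨snd w, hw⟩

theorem setOf_forall_point_mem_semialgebraicSets [Algebra.FinitePresentation ℝ C]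
    {P : RealPoints B → RealPoints C → Prop}
    (h : {w : RealPoints (B ⊗[ℝ] C) | P (fst w) (snd w)} ∈ semialgebraicSets (B ⊗[ℝ] C)) :
    {x | ∀ y, P x y} ∈ semialgebraicSets B := by
  convert compl_mem_semialgebraicSets (setOf_exists_point_mem_semialgebraicSets
    (P := fun x y => ¬ P x y) (compl_mem_semialgebraicSets h)) using 1
  ext x
  simp

theorem setOf_and_mem_semialgebraicSets {P Q : RealPoints B → Prop}
    (hP : {x | P x} ∈ semialgebraicSets B) (hQ : {x | Q x} ∈ semialgebraicSets B) :
    {x | P x ∧ Q x} ∈ semialgebraicSets B := inter_mem_semialgebraicSets hP hQ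

theorem setOf_imp_mem_semialgebraicSets {P Q : RealPoints B → Prop}
    (hP : {x | P x} ∈ semialgebraicSets B) (hQ : {x | Q x} ∈ semialgebraicSets B) :
    {x | P x → Q x} ∈ semialgebraicSets B := by
  convert compl_mem_semialgebraicSets (inter_mem_semialgebraicSets hP
    (compl_mem_semialgebraicSets hQ)) using 1
  ext x
  simp

/-- Functions with semialgebraic graph. -/
def IsSemialgebraicFun (h : RealPoints B → ℝ) : Prop := graph h ∈ semialgebraicSets B[X]

theorem IsSemialgebraicFun.setOf_cons_mem {h : RealPoints B → ℝ} (hh : IsSemialgebraicFun h)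
    {T : Set (RealPoints B[X])} (hT : T ∈ semialgebraicSets B[X]) :
    {x | cons x (h x) ∈ T} ∈ semialgebraicSets B := by
  have hfp : (Polynomial.CAlgHom (R := ℝ) (A := B)).toRingHom.FinitePresentation := by
    have : (algebraMap B B[X]).FinitePresentation :=
      RingHom.finitePresentation_algebraMap.2 inferInstance
    exact this
  convert comap_image_mem_semialgebraicSets _ hfp (inter_mem_semialgebraicSets hh hT) using 1
  ext x
  constructor
  · exact fun hx => ⟨_, ⟨by simp [mem_graph_iff], hx⟩, base_cons _ _⟩
  · rintro ⟨z, ⟨hz, hzT⟩, rfl⟩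
    rw [mem_graph_iff] at hz
    change cons (base z) (h (base z)) ∈ T
    rwa [← hz, cons_base]

theorem setOf_eq_mem_semialgebraicSets (b c : B) :
    {x : RealPoints B | x b = x c} ∈ semialgebraicSets B := by
  convert setOf_sign_eq_mem_semialgebraicSets (b - c) 0 using 1
  ext x
  simp [sign_eq_zero_iff, sub_eq_zero]

theorem isSemialgebraicFun_regular (b : B) : IsSemialgebraicFun (fun x : RealPoints B => x b) :=
  setOf_eq_mem_semialgebraicSets (B := B[X]) Polynomial.X (Polynomial.C b)

theorem IsSemialgebraicFun.comap {h : RealPoints B → ℝ} (hh : IsSemialgebraicFun h)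
    (φ : B →ₐ[ℝ] C) : IsSemialgebraicFun (fun z => h (comap φ z)) := by
  rw [IsSemialgebraicFun]
  convert comap_preimage_mem_semialgebraicSets (Polynomial.mapAlgHom φ) hh using 1
  ext z
  rw [Set.mem_preimage, mem_graph_iff, mem_graph_iff]
  have h1 : base (RealPoints.comap (Polynomial.mapAlgHom φ) z) = RealPoints.comap φ (base z) :=
    RealPoints.ext_apply fun b => by simp [base_apply]
  rw [h1]
  simp

theorem IsSemialgebraicFun.fst {h : RealPoints B → ℝ} (hh : IsSemialgebraicFun h) :
    IsSemialgebraicFun (fun z : RealPoints (B ⊗[ℝ] C) => h (fst z)) := hh.comap _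

theorem IsSemialgebraicFun.snd {h : RealPoints C → ℝ} (hh : IsSemialgebraicFun h) :
    IsSemialgebraicFun (fun z : RealPoints (B ⊗[ℝ] C) => h (snd z)) := hh.comap _

theorem IsSemialgebraicFun.setOf_cons_cons_mem {h h' : RealPoints B → ℝ}
    (hh : IsSemialgebraicFun h) (hh' : IsSemialgebraicFun h')
    {T : Set (RealPoints B[X][X])} (hT : T ∈ semialgebraicSets B[X][X]) :
    {x | cons (cons x (h x)) (h' x) ∈ T} ∈ semialgebraicSets B := by
  have := hh.setOf_cons_mem ((hh'.comap (Polynomial.CAlgHom (R := ℝ) (A := B))).setOf_cons_mem hT)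
  convert this using 1
  ext x
  change _ ↔ cons (cons x (h x)) (h' (base (cons x (h x)))) ∈ T
  rw [base_cons]
  rfl

theorem IsSemialgebraicFun.add {h h' : RealPoints B → ℝ}
    (hh : IsSemialgebraicFun h) (hh' : IsSemialgebraicFun h') :
    IsSemialgebraicFun (fun x => h x + h' x) := by
  have := (hh.comap (Polynomial.CAlgHom (R := ℝ) (A := B))).setOf_cons_cons_mem
    (hh'.comap (Polynomial.CAlgHom (R := ℝ) (A := B)))
    (setOf_eq_mem_semialgebraicSets (Polynomial.C (Polynomial.C Polynomial.X))
      (Polynomial.C Polynomial.X + Polynomial.X))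
  rw [IsSemialgebraicFun]
  convert this using 1
  ext z
  simp only [mem_graph_iff, Set.mem_ofPred_eq, map_add, cons_C, cons_X]
  rfl

theorem IsSemialgebraicFun.mul {h h' : RealPoints B → ℝ}
    (hh : IsSemialgebraicFun h) (hh' : IsSemialgebraicFun h') :
    IsSemialgebraicFun (fun x => h x * h' x) := by
  have := (hh.comap (Polynomial.CAlgHom (R := ℝ) (A := B))).setOf_cons_cons_mem
    (hh'.comap (Polynomial.CAlgHom (R := ℝ) (A := B)))
    (setOf_eq_mem_semialgebraicSets (Polynomial.C (Polynomial.C Polynomial.X))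
      (Polynomial.C Polynomial.X * Polynomial.X))
  rw [IsSemialgebraicFun]
  convert this using 1
  ext z
  simp only [mem_graph_iff, Set.mem_ofPred_eq, map_mul, cons_C, cons_X]
  rfl

theorem isSemialgebraicFun_const (t : ℝ) : IsSemialgebraicFun (fun _ : RealPoints B => t) := by
  have := isSemialgebraicFun_regular (algebraMap ℝ B t)
  simpa using this

theorem IsSemialgebraicFun.sub {h h' : RealPoints B → ℝ}
    (hh : IsSemialgebraicFun h) (hh' : IsSemialgebraicFun h') :
    IsSemialgebraicFun (fun x => h x - h' x) := by
  have := hh.add ((isSemialgebraicFun_const (-1)).mul hh')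
  simpa [← sub_eq_add_neg] using this

theorem IsSemialgebraicFun.sum {ι : Type*} (s : Finset ι) {h : ι → RealPoints B → ℝ}
    (hh : ∀ i, IsSemialgebraicFun (h i)) : IsSemialgebraicFun (fun x => ∑ i ∈ s, h i x) := by
  classical
  induction s using Finset.induction_on with
  | empty => simpa using isSemialgebraicFun_const (B := B) 0
  | insert a s ha ih => simpa [Finset.sum_insert ha] using (hh a).add ih

theorem IsSemialgebraicFun.setOf_lt {h h' : RealPoints B → ℝ}
    (hh : IsSemialgebraicFun h) (hh' : IsSemialgebraicFun h') :
    {x | h x < h' x} ∈ semialgebraicSets B := by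
  convert (hh'.sub hh).setOf_cons_mem (setOf_pos_mem_semialgebraicSets Polynomial.X) using 1
  ext x
  simp

theorem IsSemialgebraicFun.setOf_le {h h' : RealPoints B → ℝ}
    (hh : IsSemialgebraicFun h) (hh' : IsSemialgebraicFun h') :
    {x | h x ≤ h' x} ∈ semialgebraicSets B := by
  convert compl_mem_semialgebraicSets (hh'.setOf_lt hh) using 1
  ext x
  simp

theorem IsSemialgebraicFun.setOf_eq {h h' : RealPoints B → ℝ}
    (hh : IsSemialgebraicFun h) (hh' : IsSemialgebraicFun h') :
    {x | h x = h' x} ∈ semialgebraicSets B := by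
  convert setOf_and_mem_semialgebraicSets (hh.setOf_le hh') (hh'.setOf_le hh) using 1
  ext x
  simp [le_antisymm_iff]

end Semialgebraic

end SchwartzAction
end

noncomputable section
namespace SchwartzAction
open RealPoints

/-! ### Coordinates -/

section Polynomial

variable {n : ℕ}

theorem contDiff_mvPolynomial_eval (p : MvPolynomial (Fin n) ℝ) :
    ContDiff ℝ ω (fun u : Fin n → ℝ => MvPolynomial.eval u p) := by
  induction p using MvPolynomial.induction_on with
  | C a => simpa using contDiff_const
  | add p q hp hq => simpa using hp.add hq
  | mul_X p i hp => simpa using hp.mul (contDiff_apply ℝ ℝ i)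

theorem differentiable_mvPolynomial_eval (p : MvPolynomial (Fin n) ℝ) :
    Differentiable ℝ (fun u : Fin n → ℝ => MvPolynomial.eval u p) :=
  (contDiff_mvPolynomial_eval p).differentiable (by simp)

end Polynomial

section Coordinates

variable {B : Type*} [CommRing B] [Algebra ℝ B] {n : ℕ} (π : MvPolynomial (Fin n) ℝ →ₐ[ℝ] B)

/-- The embedding of `X(ℝ)` into `ℝⁿ` given by generators of the algebra of regular functions. -/
def coord (x : RealPoints B) : Fin n → ℝ := fun i => x (π (MvPolynomial.X i))

theorem apply_eq_eval_coord (x : RealPoints B) (p : MvPolynomial (Fin n) ℝ) :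
    x (π p) = MvPolynomial.eval (coord π x) p := by
  have : x.toAlgHom.comp π = MvPolynomial.aeval (coord π x) :=
    MvPolynomial.algHom_ext fun i => by simp [coord]
  exact congrArg (fun f => f p) this

theorem continuous_apply (b : B) : Continuous (fun x : RealPoints B => x b) :=
  (_root_.continuous_apply b).comp continuous_induced_dom

theorem continuous_realPoints_iff {Y : Type*} [TopologicalSpace Y] {γ : Y → RealPoints B} :
    Continuous γ ↔ ∀ b, Continuous (fun t => γ t b) := by
  rw [continuous_induced_rng, continuous_pi_iff]
  rfl

theorem continuous_coord : Continuous (coord π) := continuous_pi fun _ => continuous_apply _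

variable {π} (hπ : Function.Surjective π)
include hπ

theorem coord_injective : Function.Injective (coord π) := fun x y h => ext_apply fun b => by
  obtain ⟨p, rfl⟩ := hπ b
  rw [apply_eq_eval_coord, apply_eq_eval_coord, h]

theorem isEmbedding_coord : Topology.IsEmbedding (coord π) := by
  refine ⟨⟨le_antisymm (continuous_iff_le_induced.1 (continuous_coord π)) ?_⟩, coord_injective hπ⟩
  rw [← continuous_id_iff_le]
  let := TopologicalSpace.induced (coord π) inferInstance
  refine continuous_realPoints_iff.2 fun b => ?_
  obtain ⟨p, rfl⟩ := hπ b
  simp only [id, apply_eq_eval_coord]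
  exact (contDiff_mvPolynomial_eval p).continuous.comp continuous_induced_dom

theorem exists_coord_eq (u : Fin n → ℝ) (hu : ∀ p, π p = 0 → MvPolynomial.eval u p = 0) :
    ∃ x, coord π x = u := by
  refine ⟨⟨AlgHom.liftOfSurjective π hπ (MvPolynomial.aeval u) fun p hp => ?_⟩, ?_⟩
  · simpa [MvPolynomial.aeval_eq_eval] using hu p hp
  · ext i
    change AlgHom.liftOfSurjective π hπ (MvPolynomial.aeval u) _ (π (MvPolynomial.X i)) = u i
    rw [AlgHom.liftOfSurjective_apply, MvPolynomial.aeval_X]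

theorem isClosedEmbedding_coord : Topology.IsClosedEmbedding (coord π) := by
  refine ⟨isEmbedding_coord hπ, ?_⟩
  have : Set.range (coord π) = ⋂ p : {p // π p = 0}, {u | MvPolynomial.eval u p.1 = 0} := by
    ext u
    simp only [Set.mem_range, Set.mem_iInter, Subtype.forall]
    refine ⟨?_, exists_coord_eq hπ u⟩
    rintro ⟨x, rfl⟩ p hp
    change MvPolynomial.eval _ p = 0
    rw [← apply_eq_eval_coord, hp, map_zero]
  rw [this]
  exact isClosed_iInter fun p =>
    isClosed_eq (contDiff_mvPolynomial_eval p.1).continuous continuous_const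

theorem isSmoothFunction_iff {φ : RealPoints B → ℂ} :
    IsSmoothFunction φ ↔ ∀ x, ∃ F : (Fin n → ℝ) → ℂ, ContDiff ℝ ∞ F ∧
      ∀ᶠ y in 𝓝 x, φ y = F (coord π y) := by
  constructor
  · intro h x
    obtain ⟨m, b, F, hF, hφ⟩ := h x
    choose p hp using fun i => hπ (b i)
    refine ⟨fun u => F (fun i => MvPolynomial.eval u (p i)), hF.comp (contDiff_pi.2 fun i =>
      (contDiff_mvPolynomial_eval (p i)).of_le le_top), hφ.mono fun y hy => ?_⟩
    rw [hy]
    simp only [← hp, apply_eq_eval_coord]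
  · intro h x
    obtain ⟨F, hF, hφ⟩ := h x
    exact ⟨n, _, F, hF, hφ⟩

omit hπ
variable (π)

/-- Tangent vectors of `X` at a real point. -/
def IsTangent (x : RealPoints B) (t : Fin n → ℝ) : Prop :=
  ∀ p, π p = 0 → fderiv ℝ (fun u => MvPolynomial.eval u p) (coord π x) t = 0

/-- A polynomial self-map of the ambient space which is a retraction to first order. -/
theorem exists_first_order_retraction (hπ : Function.Surjective π) [Algebra.FormallySmooth ℝ B] :
    ∃ r : Fin n → MvPolynomial (Fin n) ℝ, (∀ i, π (r i) = π (MvPolynomial.X i)) ∧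
      ∀ p, π p = 0 → MvPolynomial.aeval r p ∈ RingHom.ker π ^ 2 := by
  set I := RingHom.ker π with hI
  let g : MvPolynomial (Fin n) ℝ ⧸ I ^ 2 →ₐ[ℝ] B := Ideal.Quotient.liftₐ (I ^ 2) π fun a ha =>
    Ideal.pow_le_self two_ne_zero ha
  have hg : Function.Surjective g := fun b => by
    obtain ⟨p, rfl⟩ := hπ b
    exact ⟨Ideal.Quotient.mk _ p, rfl⟩
  have hker : IsNilpotent (RingHom.ker (g : MvPolynomial (Fin n) ℝ ⧸ I ^ 2 →+* B)) := by
    refine ⟨2, ?_⟩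
    have hle : RingHom.ker (g : MvPolynomial (Fin n) ℝ ⧸ I ^ 2 →+* B) ≤
        I.map (Ideal.Quotient.mk (I ^ 2)) := fun z hz => by
      obtain ⟨p, rfl⟩ := Ideal.Quotient.mk_surjective z
      exact Ideal.mem_map_of_mem _ hz
    rw [Ideal.zero_eq_bot, eq_bot_iff]
    refine (Ideal.pow_right_mono hle 2).trans ?_
    rw [← Ideal.map_pow, Ideal.map_quotient_self]
  let s := Algebra.FormallySmooth.liftOfSurjective (AlgHom.id ℝ B) g hg hker
  have hs : ∀ b, g (s b) = b := fun b =>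
    Algebra.FormallySmooth.liftOfSurjective_apply (AlgHom.id ℝ B) g hg hker b
  choose r hr using fun i => Ideal.Quotient.mk_surjective (s (π (MvPolynomial.X i)))
  refine ⟨r, fun i => ?_, fun p hp => ?_⟩
  · have := hs (π (MvPolynomial.X i))
    rwa [← hr] at this
  · have h1 : (Ideal.Quotient.mkₐ ℝ (I ^ 2)).comp (MvPolynomial.aeval r) = s.comp π :=
      MvPolynomial.algHom_ext fun i => by simpa using hr i
    have h2 := congrArg (fun f => f p) h1
    simp only [AlgHom.comp_apply, hp, map_zero] at h2
    exact Ideal.Quotient.eq_zero_iff_mem.1 h2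

variable {π}

theorem eval_isBigO_of_mem_span {t : Finset (MvPolynomial (Fin n) ℝ)} (a : Fin n → ℝ)
    {p : MvPolynomial (Fin n) ℝ} (hp : p ∈ Ideal.span (t : Set (MvPolynomial (Fin n) ℝ))) :
    (fun u => MvPolynomial.eval u p) =O[𝓝 a] (fun u (q : t) => MvPolynomial.eval u q.1) := by
  induction hp using Submodule.span_induction with
  | mem q hq =>
    exact Asymptotics.isBigO_pi.1 (Asymptotics.isBigO_refl
      (fun (u : Fin n → ℝ) (q : t) => MvPolynomial.eval u q.1) _) ⟨q, hq⟩
  | zero => simpa using Asymptotics.isBigO_zero _ _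
  | add p q _ _ hp hq => simpa using hp.add hq
  | smul q p _ hp =>
    have hq : (fun u => MvPolynomial.eval u q) =O[𝓝 a] (fun _ => (1 : ℝ)) :=
      (contDiff_mvPolynomial_eval q).continuous.continuousAt.isBigO_one ℝ
    simpa using hq.smul hp

theorem eval_isBigO_of_mem_span_sq {t : Finset (MvPolynomial (Fin n) ℝ)} (a : Fin n → ℝ)
    {p : MvPolynomial (Fin n) ℝ} (hp : p ∈ Ideal.span (t : Set (MvPolynomial (Fin n) ℝ)) ^ 2) :
    (fun u => MvPolynomial.eval u p) =O[𝓝 a]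
      (fun u => ‖(fun q : t => MvPolynomial.eval u q.1)‖ ^ 2) := by
  rw [pow_two] at hp
  induction hp using Submodule.mul_induction_on' with
  | mem_mul_mem p hp q hq =>
    have := (eval_isBigO_of_mem_span a hp).norm_right.mul (eval_isBigO_of_mem_span a hq).norm_right
    simpa [pow_two] using this
  | add p _ q _ hp hq => simpa using hp.add hq

theorem exists_local_retraction (hπ : Function.Surjective π) [Algebra.FormallySmooth ℝ B]
    (x₀ : RealPoints B) :
    ∃ (ρ : (Fin n → ℝ) → RealPoints B) (U : Set (Fin n → ℝ)), IsOpen U ∧ coord π x₀ ∈ U ∧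
      ContDiffOn ℝ ∞ (fun u => coord π (ρ u)) U ∧ (∀ᶠ y in 𝓝 x₀, ρ (coord π y) = y) ∧
      ∀ t, IsTangent π x₀ t → fderiv ℝ (fun u => coord π (ρ u)) (coord π x₀) t = t := by
  classical
  obtain ⟨r, hr, hrI⟩ := exists_first_order_retraction π hπ
  set I := RingHom.ker π with hI
  obtain ⟨t, ht⟩ : I.FG := IsNoetherian.noetherian I
  have ht' : Ideal.span (t : Set (MvPolynomial (Fin n) ℝ)) = I := ht
  set a := coord π x₀ with ha
  set F : (Fin n → ℝ) → (t → ℝ) := fun u q => MvPolynomial.eval u q.1 with hF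
  set R : (Fin n → ℝ) → (Fin n → ℝ) := fun u i => MvPolynomial.eval u (r i) with hR
  have hFs : ContDiff ℝ ω F := contDiff_pi.2 fun q => contDiff_mvPolynomial_eval q.1
  have hRs : ContDiff ℝ ω R := contDiff_pi.2 fun i => contDiff_mvPolynomial_eval (r i)
  have hbigO : ∀ p ∈ I, (fun u => MvPolynomial.eval u p) =O[𝓝 a] F := fun p hp =>
    eval_isBigO_of_mem_span a (ht' ▸ hp)
  have hbigO2 : ∀ p ∈ I ^ 2, (fun u => MvPolynomial.eval u p) =O[𝓝 a] (fun u => ‖F u‖ ^ 2) :=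
    fun p hp => eval_isBigO_of_mem_span_sq a (ht' ▸ hp)
  have hZ : ∀ (y : RealPoints B), ∀ p ∈ I, MvPolynomial.eval (coord π y) p = 0 := fun y p hp => by
    rw [← apply_eq_eval_coord, show π p = 0 from hp, map_zero]
  have htI : ∀ q : t, q.1 ∈ I := fun q => ht' ▸ Ideal.subset_span q.2
  have hRI : ∀ i, MvPolynomial.X i - r i ∈ I := fun i => by
    rw [hI, RingHom.mem_ker, map_sub, hr, sub_self]
  have hRZ : ∀ y, R (coord π y) = coord π y := fun y => by
    ext i
    have := hZ y _ (hRI i)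
    rw [map_sub, MvPolynomial.eval_X, sub_eq_zero] at this
    exact this.symm
  have hFa : F a = 0 := funext fun q => hZ x₀ _ (htI q)
  have hcompR : ∀ (p : MvPolynomial (Fin n) ℝ) u,
      MvPolynomial.eval (R u) p = MvPolynomial.eval u (MvPolynomial.aeval r p) := fun p u => by
    have : (MvPolynomial.aeval (R u) : MvPolynomial (Fin n) ℝ →ₐ[ℝ] ℝ) =
        (MvPolynomial.aeval u).comp (MvPolynomial.aeval r) :=
      MvPolynomial.algHom_ext fun i => by simp [hR, MvPolynomial.aeval_eq_eval]
    simpa [MvPolynomial.aeval_eq_eval] using congrArg (fun f => f p) this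
  have hFR : (fun u => F (R u)) =O[𝓝 a] (fun u => ‖F u‖ ^ 2) := by
    refine Asymptotics.isBigO_pi.2 fun q => ?_
    simp only [hF, hcompR]
    exact hbigO2 _ (hrI _ (htI q))
  have hsub : (fun u => u - R u) =O[𝓝 a] F := by
    refine Asymptotics.isBigO_pi.2 fun i => ?_
    simpa using hbigO _ (hRI i)
  have hRd : HasFDerivAt R (fderiv ℝ R a) a := (hRs.differentiable (by simp) a).hasFDerivAt
  set P := fderiv ℝ R a with hP
  have hRa : R a = a := hRZ x₀
  have hFO : F =O[𝓝 a] (fun u => u - a) := by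
    have := (hFs.differentiable (by simp) a).isBigO_sub
    simpa [hFa] using this
  have hnormF : Filter.Tendsto (fun u => ‖F u‖) (𝓝 a) (𝓝 0) := by
    have := hFs.continuous.norm.tendsto a
    rwa [hFa, norm_zero] at this
  have hPtan : ∀ v, IsTangent π x₀ (P v) := by
    intro v p hp
    have h1 : HasFDerivAt (fun u => MvPolynomial.eval (R u) p)
        ((fderiv ℝ (fun u => MvPolynomial.eval u p) a).comp P) a := by
      have := (differentiable_mvPolynomial_eval p (R a)).hasFDerivAt.comp a hRd
      rwa [hRa] at this
    have h2 : HasFDerivAt (fun u => MvPolynomial.eval (R u) p) (0 : (Fin n → ℝ) →L[ℝ] ℝ) a := by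
      rw [hasFDerivAt_iff_isLittleO]
      have hz : MvPolynomial.eval (R a) p = 0 := by rw [hRa]; exact hZ x₀ p hp
      simp only [hz, sub_zero, zero_apply]
      simp only [hcompR]
      refine (hbigO2 _ (hrI p hp)).trans_isLittleO ?_
      have h3 : (fun u => ‖F u‖) =o[𝓝 a] (fun _ => (1 : ℝ)) :=
        (Asymptotics.isLittleO_one_iff ℝ).2 hnormF
      have := h3.mul_isBigO hFO.norm_left.norm_right
      simp only [one_mul, ← pow_two] at this
      exact this.of_norm_right
    have := congrArg (fun L : (Fin n → ℝ) →L[ℝ] ℝ => L v) (h1.unique h2)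
    simpa using this
  have hPt : ∀ v, IsTangent π x₀ v → P v = v := by
    intro v hv
    ext i
    have h1 := hv (MvPolynomial.X i - r i) (hRI i)
    have h2 : HasFDerivAt (fun u : Fin n → ℝ => MvPolynomial.eval u (MvPolynomial.X i - r i))
        (ContinuousLinearMap.proj i - (ContinuousLinearMap.proj i).comp P) a := by
      simp only [map_sub, MvPolynomial.eval_X]
      exact (hasFDerivAt_apply (𝕜 := ℝ) (F' := fun _ : Fin n => ℝ) i a).sub
        (hasFDerivAt_pi'.1 hRd i)
    rw [← ha, h2.fderiv] at h1
    simp [sub_eq_zero] at h1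
    exact h1.symm
  have hPP : ∀ v, P (P v) = P v := fun v => hPt _ (hPtan v)
  set Ψ : (Fin n → ℝ) → (Fin n → ℝ) := fun u => P (u - a) + ((u - R u) - P (u - R u)) with hΨ
  have hΨs : ContDiff ℝ ω Ψ := by
    have h1 : ContDiff ℝ ω (fun u : Fin n → ℝ => u - R u) := contDiff_id.sub hRs
    exact (P.contDiff.comp (contDiff_id.sub contDiff_const)).add (h1.sub (P.contDiff.comp h1))
  have hΨd : HasFDerivAt Ψ ((ContinuousLinearEquiv.refl ℝ (Fin n → ℝ) :
      (Fin n → ℝ) ≃L[ℝ] (Fin n → ℝ)) : (Fin n → ℝ) →L[ℝ] (Fin n → ℝ)) a := by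
    have h1 := (hasFDerivAt_id (𝕜 := ℝ) a).sub hRd
    refine ((P.hasFDerivAt.comp a ((hasFDerivAt_id (𝕜 := ℝ) a).sub_const a)).add
      (h1.sub (P.hasFDerivAt.comp a h1))).congr_fderiv ?_
    ext1 v
    simp [hPP]
  have hΨa : Ψ a = 0 := by simp [hΨ, hRa]
  have hstrict := hΨs.contDiffAt.hasStrictFDerivAt' hΨd (by simp)
  have hΘs := hΨs.contDiffAt.to_localInverse hΨd (by simp)
  have hΘd := hstrict.to_localInverse.hasFDerivAt
  have hleft := hstrict.eventually_left_inverse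
  have hright := hstrict.eventually_right_inverse
  have hΘa := hstrict.localInverse_apply_image
  change ContDiffAt ℝ ω (hstrict.localInverse) _ at hΘs
  set Θ := hstrict.localInverse with hΘ
  rw [hΨa] at hΘs hΘd hright hΘa
  set G : (Fin n → ℝ) → (Fin n → ℝ) := fun u => Θ (P (u - a)) with hG
  have hlin : ContDiff ℝ ω (fun u : Fin n → ℝ => P (u - a)) :=
    P.contDiff.comp (contDiff_id.sub contDiff_const)
  have hGs : ContDiffAt ℝ ω G a := by
    have h0 : P (a - a) = 0 := by simp
    exact ContDiffAt.comp a (by rw [h0]; exact hΘs) hlin.contDiffAt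
  have hGd : HasFDerivAt G P a := by
    have h0 : P (a - a) = 0 := by simp
    have h2 : HasFDerivAt (fun u : Fin n → ℝ => P (u - a)) P a := by
      simpa using P.hasFDerivAt.comp a ((hasFDerivAt_id (𝕜 := ℝ) a).sub_const a)
    refine (HasFDerivAt.comp a (by rw [h0]; exact hΘd) h2).congr_fderiv ?_
    ext1 v
    simp
  have hGa : G a = a := by simp [hG, hΘa]
  have hGc : Filter.Tendsto G (𝓝 a) (𝓝 a) := by simpa [hGa] using hGs.continuousAt.tendsto
  -- points fixed by the first-order retraction to first order lie on `X`
  have hfix : ∀ᶠ y in 𝓝 a, P (y - R y) = y - R y → F y = 0 := by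
    obtain ⟨C, hC, hsubC⟩ := hsub.exists_pos
    obtain ⟨C', hC', hFRC⟩ := hFR.exists_pos
    have hFst := hFs.contDiffAt (x := a).hasStrictFDerivAt (by simp)
    have hpair : Filter.Tendsto (fun y => (R y, y)) (𝓝 a) (𝓝 (a, a)) := by
      have := (hRs.continuous.prodMk continuous_id).tendsto a
      rwa [hRa] at this
    have hlo := (hFst.isLittleO.comp_tendsto hpair).def (show (0 : ℝ) < 1 / (4 * C) by positivity)
    filter_upwards [hlo, hsubC.bound, hFRC.bound,
      hnormF.eventually (gt_mem_nhds (show (0 : ℝ) < 1 / (4 * C') by positivity))] with y h1 h2 h3 h4 hy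
    have h5 : fderiv ℝ F a (R y - y) = 0 := by
      have hcl : R y - y = P (R y - y) := by
        rw [← neg_sub, map_neg, hy]
      rw [hcl]
      ext q
      have hq := hPtan (R y - y) _ (htI q)
      have hd := hasFDerivAt_pi'.1 (hFs.differentiable (by simp) a).hasFDerivAt q
      rw [← ha, hd.fderiv] at hq
      exact hq
    simp only [Function.comp_apply, h5, sub_zero] at h1
    rw [norm_sub_rev (R y) y] at h1
    have h6 : ‖F (R y)‖ ≤ 1 / 4 * ‖F y‖ := by
      refine h3.trans ?_
      rw [Real.norm_of_nonneg (by positivity), pow_two, ← mul_assoc]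
      refine mul_le_mul_of_nonneg_right ?_ (norm_nonneg _)
      calc C' * ‖F y‖ ≤ C' * (1 / (4 * C')) := mul_le_mul_of_nonneg_left h4.le hC'.le
        _ = 1 / 4 := by field_simp
    have h7 : ‖F (R y) - F y‖ ≤ 1 / 4 * ‖F y‖ := by
      refine h1.trans ?_
      calc 1 / (4 * C) * ‖y - R y‖ ≤ 1 / (4 * C) * (C * ‖F y‖) :=
            mul_le_mul_of_nonneg_left h2 (by positivity)
        _ = 1 / 4 * ‖F y‖ := by field_simp
    have h8 : ‖F y‖ ≤ ‖F (R y)‖ + ‖F (R y) - F y‖ := by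
      have := norm_sub_le (F (R y)) (F (R y) - F y)
      simpa using this
    have h9 := norm_nonneg (F y)
    exact norm_eq_zero.1 (by linarith)
  have hGZ : ∀ᶠ u in 𝓝 a, ∃ y, coord π y = G u := by
    have hr0 : Filter.Tendsto (fun u : Fin n → ℝ => P (u - a)) (𝓝 a) (𝓝 0) := by
      simpa using hlin.continuous.tendsto a
    filter_upwards [hGc.eventually hfix, hr0.eventually hright] with u h1 h2
    have h3 : P (G u - R (G u)) = G u - R (G u) := by
      have h4 : Ψ (G u) = P (u - a) := h2
      have h5 := congrArg P h4
      simp only [hΨ, map_add, map_sub, hPP] at h4 h5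
      simp only [map_sub]
      have h6 : P (G u) - P a = P u - P a := by rw [← h5]; abel
      have h7 : G u - R (G u) - (P (G u) - P (R (G u))) = 0 := by
        rw [← sub_eq_zero] at h4
        rw [← h4, ← h6]; abel
      exact (sub_eq_zero.1 h7).symm
    have h8 := h1 h3
    refine exists_coord_eq hπ _ fun p hp => ?_
    have hp' : p ∈ Ideal.span (t : Set (MvPolynomial (Fin n) ℝ)) := ht' ▸ hp
    clear hp
    induction hp' using Submodule.span_induction with
    | mem q hq => exact congrFun h8 ⟨q, hq⟩
    | zero => simp
    | add p q _ _ hp hq => rw [map_add, hp, hq, add_zero]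
    | smul q p _ hp => rw [smul_eq_mul, map_mul, hp, mul_zero]
  have hex : ∀ u, ∃ y, (∃ y, coord π y = G u) → coord π y = G u := fun u => by
    by_cases h : ∃ y, coord π y = G u
    · exact ⟨h.choose, fun _ => h.choose_spec⟩
    · exact ⟨x₀, fun h' => absurd h' h⟩
  choose ρ hρ using hex
  have hρG : (fun u => coord π (ρ u)) =ᶠ[𝓝 a] G := hGZ.mono fun u hu => hρ u hu
  obtain ⟨U, hU, hUo, haU⟩ := eventually_nhds_iff.1
    (((hGs.congr_of_eventuallyEq hρG).eventually (by simp)))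
  refine ⟨ρ, U, hUo, haU, fun u hu => ((hU u hu).of_le le_top).contDiffWithinAt, ?_, ?_⟩
  · have h1 := (continuous_coord π).tendsto x₀
    filter_upwards [h1.eventually hρG, h1.eventually hleft] with y hy1 hy2
    refine coord_injective hπ ?_
    have hy3 : Ψ (coord π y) = P (coord π y - a) := by simp [hΨ, hRZ]
    rw [hy1, hG]
    change Θ (P (coord π y - a)) = _
    rw [← hy3]
    exact hy2
  · intro v hv
    rw [hρG.fderiv_eq, hGd.fderiv, hPt v hv]

end Coordinates

end SchwartzAction
end

noncomputable section
namespace SchwartzAction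
open RealPoints

/-! ### Hadamard's lemma -/

section Hadamard

variable {E : Type} [NormedAddCommGroup E] [NormedSpace ℝ E] [FiniteDimensional ℝ E]

theorem contDiff_integral_segment (a : E) (k : ℕ) : ∀ {F : Type} [NormedAddCommGroup F]
    [NormedSpace ℝ F] [CompleteSpace F] {K : E → F} (_ : ContDiff ℝ ∞ K) {w : ℝ → ℝ}
    (_ : Continuous w), ContDiff ℝ k (fun u => ∫ s in Set.Icc (0 : ℝ) 1, w s • K (a + s • (u - a))) := by
  induction k with
  | zero =>
    intro F _ _ _ K hK w hw
    rw [Nat.cast_zero, contDiff_zero]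
    refine continuous_parametric_integral_of_continuous ?_ isCompact_Icc
    exact (hw.comp continuous_snd).smul (hK.continuous.comp (by fun_prop))
  | succ k ih =>
    intro F _ _ _ K hK w hw
    have hdK : ContDiff ℝ ∞ (fderiv ℝ K) := hK.fderiv_right (by simp)
    rw [Nat.cast_succ, contDiff_succ_iff_hasFDerivAt]
    refine ⟨_, ih hdK (w := fun s => w s * s) (by fun_prop), fun u => ?_⟩
    have hc : Continuous (fun p : E × ℝ => (w p.2 * p.2) • fderiv ℝ K (a + p.2 • (p.1 - a))) :=
      ((hw.comp continuous_snd).mul continuous_snd).smul (hdK.continuous.comp (by fun_prop))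
    have hc0 : ∀ u, Continuous (fun s => w s • K (a + s • (u - a))) := fun u =>
      hw.smul (hK.continuous.comp (by fun_prop))
    obtain ⟨C, hC⟩ := ((isCompact_closedBall u 1).prod isCompact_Icc).exists_bound_of_continuousOn
      (f := fun p : E × ℝ => (w p.2 * p.2) • fderiv ℝ K (a + p.2 • (p.1 - a))) hc.continuousOn
    refine hasFDerivAt_integral_of_dominated_of_fderiv_le (bound := fun _ => C)
      (s := Metric.closedBall u 1)
      (F' := fun u s => (w s * s) • fderiv ℝ K (a + s • (u - a)))
      (Metric.closedBall_mem_nhds _ one_pos)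
      (Filter.Eventually.of_forall fun u => (hc0 u).aestronglyMeasurable)
      ((hc0 u).continuousOn.integrableOn_compact isCompact_Icc)
      (Continuous.aestronglyMeasurable (by fun_prop)) ?_ (by simp) ?_
    · filter_upwards [MeasureTheory.ae_restrict_mem measurableSet_Icc] with s hs x hx
      exact hC (x, s) ⟨hx, hs⟩
    · refine Filter.Eventually.of_forall fun s x _ => ?_
      have h1 : HasFDerivAt (fun x : E => a + s • (x - a)) (s • ContinuousLinearMap.id ℝ E) x :=
        (((hasFDerivAt_id x).sub_const a).const_smul s).const_add a
      have h2 := ((hK.differentiable (by simp) (a + s • (x - a))).hasFDerivAt.comp x h1).const_smul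
        (w s)
      refine h2.congr_fderiv ?_
      ext1 v
      simp [mul_smul]

theorem exists_hadamard {n : ℕ} {F : (Fin n → ℝ) → ℂ} (hF : ContDiff ℝ ∞ F) (a : Fin n → ℝ) :
    ∃ H : Fin n → (Fin n → ℝ) → ℂ, (∀ i, ContDiff ℝ ∞ (H i)) ∧
      ∀ u, F u = F a + ∑ i, (((u i - a i : ℝ)) : ℂ) * H i u := by
  have hdF : ContDiff ℝ ∞ (fderiv ℝ F) := hF.fderiv_right (by simp)
  set K : (Fin n → ℝ) → ((Fin n → ℝ) →L[ℝ] ℂ) :=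
    fun u => ∫ s in Set.Icc (0 : ℝ) 1, (1 : ℝ) • fderiv ℝ F (a + s • (u - a)) with hK
  have hKs : ContDiff ℝ ∞ K := contDiff_infty.2 fun k =>
    contDiff_integral_segment a k hdF (w := fun _ => 1) continuous_const
  refine ⟨fun i u => K u (Pi.single i 1), fun i => hKs.clm_apply contDiff_const, fun u => ?_⟩
  have hc : Continuous (fun s : ℝ => fderiv ℝ F (a + s • (u - a))) :=
    hdF.continuous.comp (by fun_prop)
  have h1 : K u (u - a) = ∑ i, (((u i - a i : ℝ)) : ℂ) * K u (Pi.single i 1) := by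
    have : u - a = ∑ i, (u i - a i) • (Pi.single i (1 : ℝ) : Fin n → ℝ) := by
      ext j
      simp [Finset.sum_apply, Pi.single_apply]
    conv_lhs => rw [this]
    rw [map_sum]
    simp only [map_smul, Complex.real_smul]
  have h2 : K u (u - a) = F u - F a := by
    have h3 : K u (u - a) = ∫ s in (0 : ℝ)..1, fderiv ℝ F (a + s • (u - a)) (u - a) := by
      rw [intervalIntegral.integral_of_le zero_le_one, ← MeasureTheory.integral_Icc_eq_integral_Ioc,
        hK]
      simp only [one_smul]
      exact (ContinuousLinearMap.integral_apply
        (hc.continuousOn.integrableOn_compact isCompact_Icc) _)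
    rw [h3]
    have := intervalIntegral.integral_eq_sub_of_hasDerivAt (a := (0 : ℝ)) (b := 1)
      (f := fun s => F (a + s • (u - a))) (f' := fun s => fderiv ℝ F (a + s • (u - a)) (u - a))
      (fun s _ => ?_) ((hc.clm_apply continuous_const).intervalIntegrable _ _)
    · simpa using this
    · have h4 : HasDerivAt (fun s : ℝ => a + s • (u - a)) (u - a) s := by
        simpa using ((hasDerivAt_id s).smul_const (u - a)).const_add a
      exact (hF.differentiable (by simp) _).hasFDerivAt.comp_hasDerivAt s h4
  rw [← h1, h2]
  ring

end Hadamard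

/-! ### Coordinate systems -/

section Coordinates

variable {B : Type*} [CommRing B] [Algebra ℝ B]

theorem fderiv_mvPolynomial_eval {n : ℕ} (p : MvPolynomial (Fin n) ℝ) (u t : Fin n → ℝ) :
    fderiv ℝ (fun u : Fin n → ℝ => MvPolynomial.eval u p) u t =
      ∑ j, MvPolynomial.eval u (MvPolynomial.pderiv j p) * t j := by
  induction p using MvPolynomial.induction_on with
  | C a => simp
  | add p q hp hq =>
    have := ((differentiable_mvPolynomial_eval p u).hasFDerivAt.add
      (differentiable_mvPolynomial_eval q u).hasFDerivAt).fderiv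
    simp only [map_add]
    change fderiv ℝ ((fun u => MvPolynomial.eval u p) + fun u => MvPolynomial.eval u q) u t = _
    rw [this]
    simp [hp, hq, add_mul, Finset.sum_add_distrib]
  | mul_X p i hp =>
    have := ((differentiable_mvPolynomial_eval p u).hasFDerivAt.mul
      (hasFDerivAt_apply (𝕜 := ℝ) (F' := fun _ : Fin n => ℝ) i u)).fderiv
    simp only [map_mul, MvPolynomial.eval_X]
    change fderiv ℝ ((fun u => MvPolynomial.eval u p) * fun u => u i) u t = _
    rw [this]
    simp only [add_apply, smul_apply, ContinuousLinearMap.proj_apply, smul_eq_mul, hp,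
      Derivation.leibniz, map_add, map_mul, MvPolynomial.eval_X, add_mul, Finset.sum_add_distrib,
      MvPolynomial.pderiv_X, Finset.mul_sum, mul_assoc]
    congr 1
    rw [Finset.sum_eq_single i] <;> simp +contextual [eq_comm]

variable (B) in
/-- Generators of the algebra of regular functions on a smooth affine variety, together with
vector fields `d j` which express a tangent vector through its coordinates, and with local smooth
retractions of the ambient space onto the real points. -/
structure CoordinateSystem where
  n : ℕ
  π : MvPolynomial (Fin n) ℝ →ₐ[ℝ] B
  surjective : Function.Surjective π
  d : Fin n → Derivation ℝ B B
  tangent : ∀ (x : RealPoints B) (t : Fin n → ℝ), IsTangent π x t → ∀ i,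
    t i = ∑ j, x (d j (π (MvPolynomial.X i))) * t j
  retraction : ∀ x₀ : RealPoints B,
    ∃ (ρ : (Fin n → ℝ) → RealPoints B) (U : Set (Fin n → ℝ)), IsOpen U ∧ coord π x₀ ∈ U ∧
      ContDiffOn ℝ ∞ (fun u => coord π (ρ u)) U ∧ (∀ᶠ y in 𝓝 x₀, ρ (coord π y) = y) ∧
      ∀ t, IsTangent π x₀ t → fderiv ℝ (fun u => coord π (ρ u)) (coord π x₀) t = t

theorem exists_derivation_of_surjective {n : ℕ} {π : MvPolynomial (Fin n) ℝ →ₐ[ℝ] B}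
    (hπ : Function.Surjective π) (r : Fin n → MvPolynomial (Fin n) ℝ)
    (hr : ∀ i, π (r i) = π (MvPolynomial.X i))
    (hrI : ∀ p, π p = 0 → MvPolynomial.aeval r p ∈ RingHom.ker π ^ 2) (j : Fin n) :
    ∃ d : Derivation ℝ B B, ∀ p, d (π p) = π (MvPolynomial.pderiv j (MvPolynomial.aeval r p)) := by
  have hπr : ∀ p, π (MvPolynomial.aeval r p) = π p := fun p => by
    have : π.comp (MvPolynomial.aeval r) = π := MvPolynomial.algHom_ext fun i => by simp [hr]
    exact congrArg (fun f => f p) this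
  have h0 : ∀ p, π p = 0 → π (MvPolynomial.pderiv j (MvPolynomial.aeval r p)) = 0 := by
    intro p hp
    have h1 := hrI p hp
    rw [pow_two] at h1
    generalize MvPolynomial.aeval r p = q at h1 ⊢
    clear hp
    induction h1 using Submodule.mul_induction_on' with
    | mem_mul_mem p hp q hq =>
      rw [Derivation.leibniz, map_add, smul_eq_mul, smul_eq_mul, map_mul, map_mul,
        show π p = 0 from hp, show π q = 0 from hq, zero_mul, zero_mul, add_zero]
    | add p _ q _ hp hq => rw [map_add, map_add, hp, hq, add_zero]
  have hwd : ∀ p q, π p = π q → π (MvPolynomial.pderiv j (MvPolynomial.aeval r p)) =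
      π (MvPolynomial.pderiv j (MvPolynomial.aeval r q)) := fun p q h => by
    have := h0 (p - q) (by rw [map_sub, h, sub_self])
    rwa [map_sub, map_sub, map_sub, sub_eq_zero] at this
  have hs := Function.surjInv_eq hπ
  have hd : ∀ p, π (MvPolynomial.pderiv j (MvPolynomial.aeval r (Function.surjInv hπ (π p)))) =
      π (MvPolynomial.pderiv j (MvPolynomial.aeval r p)) := fun p => hwd _ _ (hs _)
  let l : B →ₗ[ℝ] B :=
    { toFun := fun b => π (MvPolynomial.pderiv j (MvPolynomial.aeval r (Function.surjInv hπ b)))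
      map_add' := fun b c => by
        rw [← map_add, ← map_add, ← map_add]
        exact hwd _ _ (by rw [hs, map_add, hs, hs])
      map_smul' := fun a b => by
        rw [RingHom.id_apply, ← map_smul π, ← Derivation.map_smul, ← map_smul (MvPolynomial.aeval r)]
        exact hwd _ _ (by rw [hs, map_smul, hs]) }
  refine ⟨Derivation.mk' l fun b c => ?_, hd⟩
  obtain ⟨p, rfl⟩ := hπ b
  obtain ⟨q, rfl⟩ := hπ c
  change π _ = π p • π _ + π q • π _
  rw [← map_mul, hd, hd, hd, map_mul, Derivation.leibniz, map_add, smul_eq_mul, smul_eq_mul, map_mul,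
    map_mul, hπr, hπr, smul_eq_mul, smul_eq_mul]

theorem nonempty_coordinateSystem [Algebra.FormallySmooth ℝ B] [Algebra.FiniteType ℝ B] :
    Nonempty (CoordinateSystem B) := by
  obtain ⟨n, π, hπ⟩ := Algebra.FiniteType.iff_quotient_mvPolynomial''.1 ‹Algebra.FiniteType ℝ B›
  obtain ⟨r, hr, hrI⟩ := exists_first_order_retraction π hπ
  choose d hd using exists_derivation_of_surjective hπ r hr hrI
  refine ⟨⟨n, π, hπ, d, fun x t ht i => ?_, exists_local_retraction hπ⟩⟩
  have h1 := ht (MvPolynomial.X i - r i) (by rw [map_sub, hr, sub_self])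
  rw [fderiv_mvPolynomial_eval] at h1
  simp only [map_sub, sub_mul, Finset.sum_sub_distrib, sub_eq_zero, MvPolynomial.pderiv_X,
    Pi.single_apply] at h1
  simp only [hd, MvPolynomial.aeval_X, apply_eq_eval_coord]
  rw [← h1, Finset.sum_eq_single i] <;> simp +contextual [eq_comm]

namespace CoordinateSystem

variable (c : CoordinateSystem B)

def gen (i : Fin c.n) : B := c.π (MvPolynomial.X i)

abbrev emb (x : RealPoints B) : Fin c.n → ℝ := coord c.π x

theorem emb_apply (x : RealPoints B) (i : Fin c.n) : c.emb x i = x (c.gen i) := rfl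

/-- The coordinates of the vector field `d j` at `x`. -/
def vec (j : Fin c.n) (x : RealPoints B) : Fin c.n → ℝ := fun i => x (c.d j (c.gen i))

theorem fderiv_eval_of_leibniz (x : RealPoints B) (δ : B →ₗ[ℝ] ℝ)
    (hδ : ∀ a b, δ (a * b) = x a * δ b + x b * δ a) (p : MvPolynomial (Fin c.n) ℝ) :
    fderiv ℝ (fun u => MvPolynomial.eval u p) (c.emb x) (fun i => δ (c.gen i)) = δ (c.π p) := by
  rw [fderiv_mvPolynomial_eval]
  have h1 : δ 1 = 0 := by
    have := hδ 1 1
    rw [mul_one, map_one x.toAlgHom, one_mul] at this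
    linarith
  induction p using MvPolynomial.induction_on with
  | C a =>
    have : c.π (MvPolynomial.C a) = a • 1 := by
      rw [← MvPolynomial.algebraMap_eq, AlgHom.commutes, Algebra.algebraMap_eq_smul_one]
    simp [this, h1]
  | add p q hp hq => simp [add_mul, Finset.sum_add_distrib, hp, hq]
  | mul_X p i hp =>
    rw [map_mul, hδ, ← hp, apply_eq_eval_coord, apply_eq_eval_coord, MvPolynomial.eval_X]
    simp only [Derivation.leibniz, smul_eq_mul, map_add, map_mul, MvPolynomial.eval_X, add_mul,
      Finset.sum_add_distrib, MvPolynomial.pderiv_X, Finset.mul_sum, mul_assoc]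
    congr 1
    rw [Finset.sum_eq_single i] <;> simp +contextual [gen, eq_comm]

theorem isTangent_of_leibniz (x : RealPoints B) (δ : B →ₗ[ℝ] ℝ)
    (hδ : ∀ a b, δ (a * b) = x a * δ b + x b * δ a) :
    IsTangent c.π x (fun i => δ (c.gen i)) := fun p hp => by
  rw [c.fderiv_eval_of_leibniz x δ hδ, hp, map_zero]

def pointDerivation (j : Fin c.n) (x : RealPoints B) : B →ₗ[ℝ] ℝ :=
  x.toAlgHom.toLinearMap ∘ₗ (c.d j).toLinearMap

theorem pointDerivation_mul (j : Fin c.n) (x : RealPoints B) (a b : B) :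
    c.pointDerivation j x (a * b) =
      x a * c.pointDerivation j x b + x b * c.pointDerivation j x a := by
  simp [pointDerivation]

theorem isTangent_vec (j : Fin c.n) (x : RealPoints B) : IsTangent c.π x (c.vec j x) :=
  c.isTangent_of_leibniz x (c.pointDerivation j x) (c.pointDerivation_mul j x)

theorem fderiv_eval_vec (j : Fin c.n) (x : RealPoints B) (p : MvPolynomial (Fin c.n) ℝ) :
    fderiv ℝ (fun u => MvPolynomial.eval u p) (c.emb x) (c.vec j x) = x (c.d j (c.π p)) :=
  c.fderiv_eval_of_leibniz x (c.pointDerivation j x) (c.pointDerivation_mul j x) p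

theorem eq_sum_vec {x : RealPoints B} {t : Fin c.n → ℝ} (ht : IsTangent c.π x t) :
    t = ∑ j, t j • c.vec j x := by
  ext i
  rw [Finset.sum_apply, c.tangent x t ht i]
  exact Finset.sum_congr rfl fun j _ => by simp [vec, gen, mul_comm]

theorem tendsto_of_tendsto_emb {Y : Type*} {l : Filter Y} {γ : Y → RealPoints B} {x : RealPoints B}
    (h : Filter.Tendsto (fun u => c.emb (γ u)) l (𝓝 (c.emb x))) : Filter.Tendsto γ l (𝓝 x) :=
  (isEmbedding_coord c.surjective).tendsto_nhds_iff.2 h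

theorem fderiv_eq_of_eventuallyEq {x : RealPoints B} {F G : (Fin c.n → ℝ) → ℂ}
    (hF : DifferentiableAt ℝ F (c.emb x)) (hG : DifferentiableAt ℝ G (c.emb x))
    (h : ∀ᶠ y in 𝓝 x, F (c.emb y) = G (c.emb y)) {t : Fin c.n → ℝ} (ht : IsTangent c.π x t) :
    fderiv ℝ F (c.emb x) t = fderiv ℝ G (c.emb x) t := by
  obtain ⟨ρ, U, hU, hxU, hρ, hρx, hρt⟩ := c.retraction x
  have h0 : ρ (c.emb x) = x := hρx.self_of_nhds
  have hdiff : DifferentiableAt ℝ (fun u => c.emb (ρ u)) (c.emb x) :=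
    ((hρ.contDiffAt (hU.mem_nhds hxU)).differentiableAt (by simp))
  have hρc : Filter.Tendsto ρ (𝓝 (c.emb x)) (𝓝 x) := by
    refine c.tendsto_of_tendsto_emb ?_
    have := hdiff.continuousAt.tendsto
    rwa [h0] at this
  have key : ∀ {F : (Fin c.n → ℝ) → ℂ}, DifferentiableAt ℝ F (c.emb x) →
      fderiv ℝ (fun u => F (c.emb (ρ u))) (c.emb x) t = fderiv ℝ F (c.emb x) t := by
    intro F hF
    have h1 : HasFDerivAt F (fderiv ℝ F (c.emb x)) (c.emb (ρ (c.emb x))) := by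
      rw [h0]; exact hF.hasFDerivAt
    have h2 := h1.comp (c.emb x) hdiff.hasFDerivAt
    change fderiv ℝ (F ∘ fun u => c.emb (ρ u)) _ _ = _
    rw [h2.fderiv, ContinuousLinearMap.comp_apply, hρt t ht]
  rw [← key hF, ← key hG]
  have h3 : (fun u => F (c.emb (ρ u))) =ᶠ[𝓝 (c.emb x)] (fun u => G (c.emb (ρ u))) :=
    hρc.eventually h
  rw [h3.fderiv_eq]

/-! ### The extension of the vector fields `d j` to smooth functions -/

theorem exists_extension (φ : smoothFunctions B) (x : RealPoints B) :
    ∃ F : (Fin c.n → ℝ) → ℂ, ContDiff ℝ ∞ F ∧ ∀ᶠ y in 𝓝 x, φ.1 y = F (c.emb y) :=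
  (isSmoothFunction_iff c.surjective).1 φ.2 x

def derivAt (j : Fin c.n) (φ : smoothFunctions B) (x : RealPoints B) : ℂ :=
  fderiv ℝ (c.exists_extension φ x).choose (c.emb x) (c.vec j x)

theorem derivAt_eq (j : Fin c.n) {φ : smoothFunctions B} {x : RealPoints B}
    {F : (Fin c.n → ℝ) → ℂ} (hF : DifferentiableAt ℝ F (c.emb x))
    (h : ∀ᶠ y in 𝓝 x, φ.1 y = F (c.emb y)) : c.derivAt j φ x = fderiv ℝ F (c.emb x) (c.vec j x) := by
  have hs := (c.exists_extension φ x).choose_spec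
  refine c.fderiv_eq_of_eventuallyEq (hs.1.differentiable (by simp) _) hF ?_ (c.isTangent_vec j x)
  filter_upwards [hs.2, h] with y h1 h2
  rw [← h1, h2]

theorem isSmoothFunction_derivAt (j : Fin c.n) (φ : smoothFunctions B) :
    IsSmoothFunction (c.derivAt j φ) := by
  refine (isSmoothFunction_iff c.surjective).2 fun x => ?_
  obtain ⟨F, hF, h⟩ := c.exists_extension φ x
  choose p hp using fun i => c.surjective (c.d j (c.gen i))
  refine ⟨fun u => fderiv ℝ F u (fun i => MvPolynomial.eval u (p i)),
    (hF.fderiv_right (by simp)).clm_apply (contDiff_pi.2 fun i =>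
      (contDiff_mvPolynomial_eval (p i)).of_le le_top), ?_⟩
  filter_upwards [h.eventually_nhds] with y hy
  rw [c.derivAt_eq j (hF.differentiable (by simp) _) hy]
  congr 1
  ext i
  rw [vec, ← hp, apply_eq_eval_coord]

def D (j : Fin c.n) : Derivation ℂ (smoothFunctions B) (smoothFunctions B) :=
  Derivation.mk'
    { toFun := fun φ => ⟨c.derivAt j φ, c.isSmoothFunction_derivAt j φ⟩
      map_add' := fun φ ψ => by
        ext x
        obtain ⟨F, hF, h⟩ := c.exists_extension φ x
        obtain ⟨G, hG, h'⟩ := c.exists_extension ψ x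
        have hF' := hF.differentiable (by simp) (c.emb x)
        have hG' := hG.differentiable (by simp) (c.emb x)
        change c.derivAt j (φ + ψ) x = c.derivAt j φ x + c.derivAt j ψ x
        rw [c.derivAt_eq j hF' h, c.derivAt_eq j hG' h', c.derivAt_eq j (hF'.add hG')
          (by filter_upwards [h, h'] with y h1 h2 using congrArg₂ (· + ·) h1 h2),
          fderiv_add hF' hG', add_apply]
      map_smul' := fun z φ => by
        ext x
        obtain ⟨F, hF, h⟩ := c.exists_extension φ x
        have hF' := hF.differentiable (by simp) (c.emb x)
        change c.derivAt j (z • φ) x = z * c.derivAt j φ x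
        rw [c.derivAt_eq j hF' h, c.derivAt_eq j (hF'.const_smul z)
          (by filter_upwards [h] with y h1 using congrArg (z • ·) h1),
          fderiv_const_smul hF' z]
        rfl }
    fun φ ψ => by
      ext x
      obtain ⟨F, hF, h⟩ := c.exists_extension φ x
      obtain ⟨G, hG, h'⟩ := c.exists_extension ψ x
      have hF' := hF.differentiable (by simp) (c.emb x)
      have hG' := hG.differentiable (by simp) (c.emb x)
      change c.derivAt j (φ * ψ) x = φ.1 x * c.derivAt j ψ x + ψ.1 x * c.derivAt j φ x
      rw [c.derivAt_eq j hF' h, c.derivAt_eq j hG' h', c.derivAt_eq j (hF'.mul hG')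
        (by filter_upwards [h, h'] with y h1 h2 using congrArg₂ (· * ·) h1 h2),
        fderiv_mul hF' hG', h.self_of_nhds, h'.self_of_nhds]
      rfl

theorem D_eq (j : Fin c.n) {φ : smoothFunctions B} {x : RealPoints B}
    {F : (Fin c.n → ℝ) → ℂ} (hF : DifferentiableAt ℝ F (c.emb x))
    (h : ∀ᶠ y in 𝓝 x, φ.1 y = F (c.emb y)) : (c.D j φ).1 x = fderiv ℝ F (c.emb x) (c.vec j x) :=
  c.derivAt_eq j hF h

theorem D_regularFunction (j : Fin c.n) (b : B) :
    c.D j (regularFunction b) = regularFunction (c.d j b) := by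
  obtain ⟨p, rfl⟩ := c.surjective b
  ext x
  have h1 := Complex.ofRealCLM.hasFDerivAt.comp (c.emb x)
    (differentiable_mvPolynomial_eval p (c.emb x)).hasFDerivAt
  rw [c.D_eq j h1.differentiableAt (Filter.Eventually.of_forall fun y => ?_), h1.fderiv,
    ContinuousLinearMap.comp_apply, c.fderiv_eval_vec]
  · rfl
  · exact congrArg Complex.ofReal (apply_eq_eval_coord c.π y p)

/-- The chain rule for maps to the real points. -/
theorem hasFDerivAt_comp {E : Type*} [NormedAddCommGroup E] [NormedSpace ℝ E]
    (φ : smoothFunctions B) {γ : E → RealPoints B} {u₀ : E} {L : E →L[ℝ] (Fin c.n → ℝ)}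
    (hγ : HasFDerivAt (fun u => c.emb (γ u)) L u₀) :
    HasFDerivAt (fun u => φ.1 (γ u))
      (∑ j, ((ContinuousLinearMap.proj j).comp L).smulRight ((c.D j φ).1 (γ u₀))) u₀ := by
  obtain ⟨F, hF, h⟩ := c.exists_extension φ (γ u₀)
  have hγc : Filter.Tendsto γ (𝓝 u₀) (𝓝 (γ u₀)) := c.tendsto_of_tendsto_emb hγ.continuousAt
  have hF' := hF.differentiable (by simp) (c.emb (γ u₀))
  have h1 := hF'.hasFDerivAt.comp u₀ hγ
  refine (h1.congr_of_eventuallyEq (hγc.eventually h)).congr_fderiv ?_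
  ext v
  have hLv : IsTangent c.π (γ u₀) (L v) := fun p hp => by
    have h2 := (differentiable_mvPolynomial_eval p (c.emb (γ u₀))).hasFDerivAt.comp u₀ hγ
    have h3 : ((fun u => MvPolynomial.eval u p) ∘ fun u => c.emb (γ u)) = fun _ => 0 := by
      ext u
      rw [Function.comp_apply, ← apply_eq_eval_coord, hp, map_zero]
    rw [h3] at h2
    exact congrArg (fun L : E →L[ℝ] ℝ => L v) (h2.unique (hasFDerivAt_const 0 u₀))
  rw [ContinuousLinearMap.comp_apply, sum_apply]
  conv_lhs => rw [c.eq_sum_vec hLv, map_sum]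
  refine Finset.sum_congr rfl fun j _ => ?_
  rw [map_smul, c.D_eq j hF' h]
  rfl

/-! ### Arbitrary derivations of the algebra of smooth functions -/

variable {c} in
def ofContDiff (F : (Fin c.n → ℝ) → ℂ) (hF : ContDiff ℝ ∞ F) : smoothFunctions B :=
  ⟨fun x => F (c.emb x), (isSmoothFunction_iff c.surjective).2 fun _ =>
    ⟨F, hF, Filter.Eventually.of_forall fun _ => rfl⟩⟩

theorem derivation_apply_eq_of_eventuallyEq (c : CoordinateSystem B)
    (V : Derivation ℂ (smoothFunctions B) (smoothFunctions B)) {φ ψ : smoothFunctions B}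
    {x : RealPoints B} (h : ∀ᶠ y in 𝓝 x, φ.1 y = ψ.1 y) : (V φ).1 x = (V ψ).1 x := by
  rw [(isEmbedding_coord c.surjective).nhds_eq_comap, Filter.eventually_comap] at h
  obtain ⟨ε, hε, hb⟩ := Metric.eventually_nhds_iff_ball.1 h
  let f : ContDiffBump (c.emb x) := ⟨ε / 2, ε, by positivity, by linarith⟩
  let χ : smoothFunctions B := ofContDiff (c := c) (fun u => (f u : ℂ))
    (Complex.ofRealCLM.contDiff.comp f.contDiff)
  have hχx : χ.1 x = 1 := by
    change ((f (c.emb x) : ℝ) : ℂ) = 1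
    rw [f.one_of_mem_closedBall (Metric.mem_closedBall_self (by change 0 ≤ ε / 2; positivity)),
      Complex.ofReal_one]
  have hχ : χ * (φ - ψ) = 0 := by
    ext y
    change χ.1 y * (φ.1 y - ψ.1 y) = 0
    by_cases hy : c.emb y ∈ Metric.ball (c.emb x) ε
    · rw [hb _ hy y rfl, sub_self, mul_zero]
    · have : f (c.emb y) = 0 := f.zero_of_le_dist (by simpa using hy)
      change ((f (c.emb y) : ℝ) : ℂ) * _ = 0
      rw [this, Complex.ofReal_zero, zero_mul]
  have h1 := congrArg (fun ξ => (V ξ).1 x) hχ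
  simp only [Derivation.leibniz, map_zero, map_sub] at h1
  change χ.1 x * ((V φ).1 x - (V ψ).1 x) + (φ.1 x - ψ.1 x) * (V χ).1 x = 0 at h1
  have h2 : φ.1 x = ψ.1 x := hb _ (Metric.mem_ball_self hε) x rfl
  rw [hχx, h2, sub_self, zero_mul, one_mul, add_zero, sub_eq_zero] at h1
  exact h1

theorem exists_derivation_apply_eq (φ : smoothFunctions B) (x : RealPoints B) :
    ∃ a : Fin c.n → ℂ, ∀ V : Derivation ℂ (smoothFunctions B) (smoothFunctions B),
      (V φ).1 x = ∑ i, (V (regularFunction (c.gen i))).1 x * a i := by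
  obtain ⟨F, hF, h⟩ := c.exists_extension φ x
  obtain ⟨H, hH, hFH⟩ := exists_hadamard hF (c.emb x)
  refine ⟨fun i => H i (c.emb x), fun V => ?_⟩
  have h1 : (V φ).1 x = (V (algebraMap ℂ _ (F (c.emb x)) +
      ∑ i, (regularFunction (c.gen i) - algebraMap ℂ _ ((c.emb x i : ℝ) : ℂ)) *
        ofContDiff (c := c) (H i) (hH i))).1 x := by
    refine c.derivation_apply_eq_of_eventuallyEq V (h.mono fun y hy => ?_)
    rw [hy, hFH]
    have : ∀ (s : Finset (Fin c.n)) (f : Fin c.n → smoothFunctions B),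
        (∑ i ∈ s, f i).1 y = ∑ i ∈ s, (f i).1 y := fun s f => by
      induction s using Finset.induction_on with
      | empty => rfl
      | insert a s ha ih =>
        rw [Finset.sum_insert ha, Finset.sum_insert ha, ← ih]; rfl
    change _ = F (c.emb x) + (∑ i, _ : smoothFunctions B).1 y
    rw [this]
    refine congrArg _ (Finset.sum_congr rfl fun i _ => ?_)
    rw [Complex.ofReal_sub]
    rfl
  have hsum : ∀ (s : Finset (Fin c.n)) (f : Fin c.n → smoothFunctions B),
      (∑ i ∈ s, f i).1 x = ∑ i ∈ s, (f i).1 x := fun s f => by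
    induction s using Finset.induction_on with
    | empty => rfl
    | insert a s ha ih =>
      rw [Finset.sum_insert ha, Finset.sum_insert ha, ← ih]; rfl
  rw [h1, map_add, Derivation.map_algebraMap, zero_add, map_sum, hsum]
  refine Finset.sum_congr rfl fun i _ => ?_
  rw [Derivation.leibniz, map_sub, Derivation.map_algebraMap, sub_zero]
  change (((x (c.gen i) : ℝ) : ℂ) - ((c.emb x i : ℝ) : ℂ)) * _ +
    H i (c.emb x) * (V (regularFunction (c.gen i))).1 x = _
  rw [← emb_apply, sub_self, zero_mul, zero_add, mul_comm]

theorem derivation_apply (V : Derivation ℂ (smoothFunctions B) (smoothFunctions B))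
    (φ : smoothFunctions B) (x : RealPoints B) :
    (V φ).1 x = ∑ j, (V (regularFunction (c.gen j))).1 x * (c.D j φ).1 x := by
  obtain ⟨a, ha⟩ := c.exists_derivation_apply_eq φ x
  have hreg : ∀ b b' : B, (V (regularFunction (b * b'))).1 x =
      x b * (V (regularFunction b')).1 x + x b' * (V (regularFunction b)).1 x := fun b b' => by
    have : regularFunction (b * b') = regularFunction b * regularFunction b' := by
      ext y
      change (((y (b * b') : ℝ)) : ℂ) = (y b : ℂ) * (y b' : ℂ)
      rw [map_mul, Complex.ofReal_mul]
    rw [this, Derivation.leibniz]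
    rfl
  have hlin : ∀ L : ℂ →L[ℝ] ℝ, ∀ i, L ((V (regularFunction (c.gen i))).1 x) =
      ∑ j, x (c.d j (c.gen i)) * L ((V (regularFunction (c.gen j))).1 x) := by
    intro L
    let δ : B →ₗ[ℝ] ℝ :=
      { toFun := fun b => L ((V (regularFunction b)).1 x)
        map_add' := fun b b' => by
          have : regularFunction (b + b') = regularFunction b + regularFunction b' := by
            ext y
            change (((y (b + b') : ℝ)) : ℂ) = (y b : ℂ) + (y b' : ℂ)
            rw [map_add, Complex.ofReal_add]
          rw [this, map_add V]
          exact map_add L _ _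
        map_smul' := fun a b => by
          have : regularFunction (a • b) = (a : ℂ) • regularFunction b := by
            ext y
            change (((y (a • b) : ℝ)) : ℂ) = (a : ℂ) * (y b : ℂ)
            rw [map_smul, smul_eq_mul, Complex.ofReal_mul]
          rw [this, V.map_smul]
          change L ((a : ℂ) * _) = a • L _
          rw [← map_smul, Complex.real_smul] }
    have hδ : ∀ a b, δ (a * b) = x a * δ b + x b * δ a := fun b b' => by
      change L ((V (regularFunction (b * b'))).1 x) = _
      rw [hreg, map_add, ← Complex.real_smul, ← Complex.real_smul, map_smul, map_smul]
      rfl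
    exact c.tangent x _ (c.isTangent_of_leibniz x δ hδ)
  have hV : ∀ i, (V (regularFunction (c.gen i))).1 x =
      ∑ j, (x (c.d j (c.gen i)) : ℂ) * (V (regularFunction (c.gen j))).1 x := fun i => by
    apply Complex.ext
    · have := hlin Complex.reCLM i
      simpa using this
    · have := hlin Complex.imCLM i
      simpa using this
  rw [ha V]
  simp only [ha (c.D _), D_regularFunction]
  simp_rw [Finset.mul_sum]
  rw [Finset.sum_comm]
  refine Finset.sum_congr rfl fun i _ => ?_
  rw [hV i, Finset.sum_mul]
  refine Finset.sum_congr rfl fun j _ => ?_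
  change _ = _ * (((x (c.d j (c.gen i)) : ℝ) : ℂ) * a i)
  ring

end CoordinateSystem

end Coordinates

end SchwartzAction
end

noncomputable section
namespace SchwartzAction
open RealPoints

/-! ### Polynomial growth of semialgebraic functions -/

theorem exists_pow_forall_eval_ne_zero (p : ℝ[X][X]) (hp : p ≠ 0) :
    ∃ (N : ℕ) (R₀ : ℝ), ∀ R ≥ R₀, ∀ T ≥ R ^ N, (p.map (Polynomial.evalRingHom R)).eval T ≠ 0 := by
  have hlc : p.leadingCoeff ≠ 0 := Polynomial.leadingCoeff_ne_zero.2 hp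
  have hlc0 : ∀ᶠ R in Filter.atTop, p.leadingCoeff.eval R ≠ 0 :=
    (Polynomial.eventually_atTop_not_isRoot _ hlc).mono fun R h => h
  have hco : ∀ i, ∃ M : ℕ, ∀ᶠ R : ℝ in Filter.atTop,
      |(p.coeff i).eval R| ≤ R ^ M * |p.leadingCoeff.eval R| := by
    intro i
    have hO := Polynomial.isBigO_atTop_of_degree_le (p.coeff i)
      (p.leadingCoeff * Polynomial.X ^ (p.coeff i).natDegree) (by
        rw [Polynomial.degree_mul, Polynomial.degree_X_pow]
        calc (p.coeff i).degree ≤ 0 + ((p.coeff i).natDegree : WithBot ℕ) := by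
              rw [zero_add]; exact Polynomial.degree_le_natDegree
          _ ≤ _ := by gcongr; exact Polynomial.zero_le_degree_iff.2 hlc)
    obtain ⟨K, hK⟩ := hO.bound
    refine ⟨(p.coeff i).natDegree + 1, ?_⟩
    filter_upwards [hK, Filter.eventually_ge_atTop K, Filter.eventually_ge_atTop 0] with R h1 h2 h3
    refine h1.trans ?_
    rw [Polynomial.eval_mul, Polynomial.eval_pow, Polynomial.eval_X, Real.norm_eq_abs, abs_mul,
      abs_of_nonneg (pow_nonneg h3 _), pow_succ]
    calc K * (|p.leadingCoeff.eval R| * R ^ (p.coeff i).natDegree)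
        ≤ R * (|p.leadingCoeff.eval R| * R ^ (p.coeff i).natDegree) := by gcongr
      _ = _ := by ring
  choose M hM using hco
  set N := (Finset.range p.natDegree).sup M with hN
  have hall : ∀ᶠ R : ℝ in Filter.atTop, ∀ i ∈ Finset.range p.natDegree,
      |(p.coeff i).eval R| ≤ R ^ M i * |p.leadingCoeff.eval R| :=
    (Filter.eventually_all_finset _).2 fun i _ => hM i
  obtain ⟨R₀, hR₀⟩ := Filter.eventually_atTop.1
    ((hall.and hlc0).and (Filter.eventually_ge_atTop (2 : ℝ)))
  refine ⟨N + 1, R₀, fun R hR T hT h0 => ?_⟩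
  obtain ⟨⟨h1, h2⟩, h3⟩ := hR₀ R hR
  have hlc' : (Polynomial.evalRingHom R) p.leadingCoeff ≠ 0 := h2
  set q := p.map (Polynomial.evalRingHom R) with hq
  have hq0 : q ≠ 0 := fun h => by
    have := Polynomial.leadingCoeff_map_of_leadingCoeff_ne_zero _ hlc'
    rw [← hq, h, Polynomial.leadingCoeff_zero] at this
    exact hlc' this.symm
  have hb := Polynomial.IsRoot.norm_lt_cauchyBound hq0 h0
  have hR1 : (1 : ℝ) ≤ R := by linarith
  have hc : (q.cauchyBound : ℝ) ≤ R ^ N + 1 := by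
    rw [Polynomial.cauchyBound, NNReal.coe_add, NNReal.coe_one, NNReal.coe_div]
    gcongr
    rw [div_le_iff₀ (by
      rw [hq, Polynomial.leadingCoeff_map_of_leadingCoeff_ne_zero _ hlc', coe_nnnorm]
      exact norm_pos_iff.2 hlc')]
    have : ((Finset.range q.natDegree).sup fun i => ‖q.coeff i‖₊) ≤
        (R ^ N).toNNReal * ‖q.leadingCoeff‖₊ := by
      refine Finset.sup_le fun i hi => ?_
      rw [← NNReal.coe_le_coe, NNReal.coe_mul, coe_nnnorm, coe_nnnorm,
        Real.coe_toNNReal _ (by positivity), hq,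
        Polynomial.leadingCoeff_map_of_leadingCoeff_ne_zero _ hlc', Polynomial.coeff_map]
      have hi' : i ∈ Finset.range p.natDegree := by
        rwa [hq, Polynomial.natDegree_map_of_leadingCoeff_ne_zero _ hlc'] at hi
      refine (h1 i hi').trans (mul_le_mul_of_nonneg_right ?_ (abs_nonneg _))
      exact pow_le_pow_right₀ hR1 (Finset.le_sup hi')
    rw [← Real.coe_toNNReal (R ^ N) (by positivity)]
    exact_mod_cast this
  have h4 : R ^ N + 1 ≤ R ^ (N + 1) := by
    have : 1 ≤ R ^ N := one_le_pow₀ hR1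
    rw [pow_succ]
    nlinarith
  have h5 : T ≤ ‖T‖ := le_abs_self T
  exact absurd (h5.trans_lt hb) (not_lt.2 (hc.trans (h4.trans hT)))

theorem exists_pow_forall_finset_eval_ne_zero (F : Finset ℝ[X][X]) :
    ∃ (N : ℕ) (R₀ : ℝ), 1 ≤ R₀ ∧ ∀ p ∈ F, p ≠ 0 → ∀ R ≥ R₀, ∀ T ≥ R ^ N,
      (p.map (Polynomial.evalRingHom R)).eval T ≠ 0 := by
  classical
  induction F using Finset.induction_on with
  | empty => exact ⟨0, 1, le_rfl, by simp⟩
  | insert a s ha ih =>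
    obtain ⟨N, R₀, hR₀, h⟩ := ih
    by_cases ha0 : a = 0
    · refine ⟨N, R₀, hR₀, fun p hp hp0 => ?_⟩
      rcases Finset.mem_insert.1 hp with rfl | hp
      · exact absurd ha0 hp0
      · exact h p hp hp0
    obtain ⟨N', R', h'⟩ := exists_pow_forall_eval_ne_zero a ha0
    refine ⟨max N N', max R₀ R', hR₀.trans (le_max_left _ _), fun p hp hp0 R hR T hT => ?_⟩
    have hR1 : 1 ≤ R := hR₀.trans ((le_max_left _ _).trans hR)
    rcases Finset.mem_insert.1 hp with rfl | hp
    · exact h' R ((le_max_right _ _).trans hR) T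
        ((pow_le_pow_right₀ hR1 (le_max_right _ _)).trans hT)
    · exact h p hp hp0 R ((le_max_left _ _).trans hR) T
        ((pow_le_pow_right₀ hR1 (le_max_left _ _)).trans hT)

/-- The point `(R, T)` of the plane. -/
def planePoint (R T : ℝ) : RealPoints ℝ[X][X] := cons (cons ⟨AlgHom.id ℝ ℝ⟩ R) T

theorem planePoint_apply (R T : ℝ) (p : ℝ[X][X]) :
    planePoint R T p = (p.map (Polynomial.evalRingHom R)).eval T := by
  rw [Polynomial.eval_map]
  change Polynomial.eval₂ _ T p = _
  congr 1

/-- If `S` contains `(R, T)` for all large `T`, then it contains `(R, R ^ N)` for all large `R`. -/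
theorem exists_pow_mem_of_semialgebraic {S : Set (RealPoints ℝ[X][X])}
    (hS : S ∈ semialgebraicSets ℝ[X][X]) (h : ∀ R, ∃ T₀, ∀ T ≥ T₀, planePoint R T ∈ S) :
    ∃ (N : ℕ) (R₀ : ℝ), 1 ≤ R₀ ∧ ∀ R ≥ R₀, planePoint R (R ^ N) ∈ S := by
  obtain ⟨F, hF⟩ := mem_semialgebraicSets_iff.1 hS
  obtain ⟨N, R₀, hR₀, hN⟩ := exists_pow_forall_finset_eval_ne_zero F
  refine ⟨N, R₀, hR₀, fun R hR => ?_⟩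
  obtain ⟨T₀, hT₀⟩ := h R
  refine hF (planePoint R (max T₀ (R ^ N))) _ (fun p hp => ?_) (hT₀ _ (le_max_left _ _))
  rw [planePoint_apply, planePoint_apply]
  by_cases hp0 : p = 0
  · simp [hp0]
  · exact (sign_eval_eq_of_forall_ne_zero _ (le_max_right _ _) fun z hz =>
      hN p hp hp0 R hR z hz.1).symm

namespace CoordinateSystem

variable {B : Type*} [CommRing B] [Algebra ℝ B] (c : CoordinateSystem B)

/-- The squared distance to the origin of the ambient space. -/
def rho : B := ∑ i, c.gen i ^ 2

theorem rho_apply (x : RealPoints B) : x c.rho = ∑ i, x (c.gen i) ^ 2 := by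
  simp [rho, map_sum]

theorem rho_nonneg (x : RealPoints B) : 0 ≤ x c.rho := by
  rw [rho_apply]; positivity

/-- The regular function measuring growth at infinity. -/
def wt : B := 1 + c.rho

theorem wt_apply (x : RealPoints B) : x c.wt = 1 + x c.rho := by simp [wt]

theorem one_le_wt (x : RealPoints B) : 1 ≤ x c.wt := by
  rw [wt_apply]; linarith [c.rho_nonneg x]

theorem isCompact_setOf_rho_le (R : ℝ) : IsCompact {x : RealPoints B | x c.rho ≤ R} := by
  have h1 := (isClosedEmbedding_coord c.surjective).isCompact_preimage
    (isCompact_closedBall (0 : Fin c.n → ℝ) (1 + |R|))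
  refine h1.of_isClosed_subset (isClosed_le (continuous_apply _) continuous_const) fun x hx => ?_
  rw [Set.mem_preimage, mem_closedBall_zero_iff, pi_norm_le_iff_of_nonneg (by positivity)]
  intro i
  have h2 : x (c.gen i) ^ 2 ≤ x c.rho := by
    rw [rho_apply]
    exact Finset.single_le_sum (f := fun i => x (c.gen i) ^ 2) (fun i _ => sq_nonneg _)
      (Finset.mem_univ i)
  have h3 : x c.rho ≤ |R| := le_trans hx (le_abs_self R)
  change |x (c.gen i)| ≤ _
  nlinarith [sq_abs (x (c.gen i)), sq_nonneg (|x (c.gen i)| - 1), abs_nonneg (x (c.gen i))]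

theorem exists_growth_bound [Algebra.FinitePresentation ℝ B] {r : RealPoints B → ℝ}
    (hc : Continuous r) (hr : IsSemialgebraicFun r) :
    ∃ (C : ℝ) (N : ℕ), ∀ x, |r x| ≤ C * x c.wt ^ N := by
  let S : Set (RealPoints ℝ[X][X]) := {z | ∀ y : RealPoints B,
    y c.rho ≤ z (Polynomial.C Polynomial.X) → r y * r y ≤ z Polynomial.X}
  have hS : S ∈ semialgebraicSets ℝ[X][X] := by
    refine setOf_forall_point_mem_semialgebraicSets (setOf_imp_mem_semialgebraicSets ?_ ?_)
    · exact (isSemialgebraicFun_regular c.rho).snd.setOf_le (isSemialgebraicFun_regular _).fst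
    · exact (hr.snd.mul hr.snd).setOf_le (isSemialgebraicFun_regular _).fst
  have hmem : ∀ R T, planePoint R T ∈ S ↔ ∀ y : RealPoints B, y c.rho ≤ R → r y * r y ≤ T := by
    intro R T
    simp [S, planePoint]
  obtain ⟨N, R₀, hR₀, hN⟩ := exists_pow_mem_of_semialgebraic hS fun R => by
    obtain ⟨K, hK⟩ := (c.isCompact_setOf_rho_le R).exists_bound_of_continuousOn
      (hc.mul hc).continuousOn
    refine ⟨K, fun T hT => (hmem R T).2 fun y hy => ?_⟩
    exact (le_abs_self _).trans ((hK y hy).trans hT)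
  refine ⟨1 + R₀ ^ N, N, fun x => ?_⟩
  have hw := c.one_le_wt x
  have hrho : x c.rho ≤ R₀ * x c.wt := by
    have := c.wt_apply x
    nlinarith
  have h1 := (hmem _ _).1 (hN (R₀ * x c.wt) (by nlinarith)) x hrho
  rw [mul_pow] at h1
  have h2 : 1 ≤ x c.wt ^ N := one_le_pow₀ hw
  rw [← abs_mul_abs_self] at h1
  nlinarith [sq_nonneg (|r x| - 1), abs_nonneg (r x)]

/-! ### Derivatives of Nash functions -/

theorem fderiv_eq_zero_of_isLittleO {x : RealPoints B} {h : (Fin c.n → ℝ) → ℝ}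
    (hd : DifferentiableAt ℝ h (c.emb x))
    (ho : (fun y => h (c.emb y) - h (c.emb x)) =o[𝓝 x] (fun y => c.emb y - c.emb x))
    {t : Fin c.n → ℝ} (ht : IsTangent c.π x t) : fderiv ℝ h (c.emb x) t = 0 := by
  obtain ⟨ρ, U, hU, hxU, hρ, hρx, hρt⟩ := c.retraction x
  have h0 : ρ (c.emb x) = x := hρx.self_of_nhds
  have hdiff : DifferentiableAt ℝ (fun u => c.emb (ρ u)) (c.emb x) :=
    ((hρ.contDiffAt (hU.mem_nhds hxU)).differentiableAt (by simp))
  have hρc : Filter.Tendsto ρ (𝓝 (c.emb x)) (𝓝 x) := by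
    refine c.tendsto_of_tendsto_emb ?_
    have := hdiff.continuousAt.tendsto
    rwa [h0] at this
  have h1 : HasFDerivAt (fun u => h (c.emb (ρ u)))
      ((fderiv ℝ h (c.emb x)).comp (fderiv ℝ (fun u => c.emb (ρ u)) (c.emb x))) (c.emb x) := by
    have h2 : HasFDerivAt h (fderiv ℝ h (c.emb x)) (c.emb (ρ (c.emb x))) := by
      rw [h0]; exact hd.hasFDerivAt
    exact h2.comp (c.emb x) hdiff.hasFDerivAt
  have h2 : HasFDerivAt (fun u => h (c.emb (ρ u))) (0 : (Fin c.n → ℝ) →L[ℝ] ℝ) (c.emb x) := by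
    rw [hasFDerivAt_iff_isLittleO]
    simp only [h0, zero_apply, sub_zero]
    refine (ho.comp_tendsto hρc).trans_isBigO ?_
    have := hdiff.isBigO_sub
    rw [h0] at this
    exact this
  have h3 := congrArg (fun L : (Fin c.n → ℝ) →L[ℝ] ℝ => L t) (h1.unique h2)
  simpa [hρt t ht] using h3

/-- A first-order description of the values of the derivative along `d j`. -/
theorem hasValue_iff {φ : smoothFunctions B} {r : RealPoints B → ℝ} (hr : ∀ x, φ.1 x = (r x : ℂ))
    (j : Fin c.n) (x : RealPoints B) (s : ℝ) :
    (c.D j φ).1 x = (s : ℂ) ↔ ∃ l : Fin c.n → ℝ, ∑ i, l i * c.vec j x i = s ∧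
      ∀ ε : ℝ, 0 < ε → ∃ δ : ℝ, 0 < δ ∧ ∀ y : RealPoints B,
        ∑ i, (y (c.gen i) - x (c.gen i)) ^ 2 < δ →
          (r y - r x - ∑ i, l i * (y (c.gen i) - x (c.gen i))) ^ 2 ≤
            ε * ∑ i, (y (c.gen i) - x (c.gen i)) ^ 2 := by
  obtain ⟨F, hF, hφ⟩ := c.exists_extension φ x
  set f : (Fin c.n → ℝ) → ℝ := fun u => (F u).re with hf
  have hfd : DifferentiableAt ℝ f (c.emb x) :=
    Complex.reCLM.differentiableAt.comp _ (hF.differentiable (by simp) _)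
  have hrf : ∀ᶠ y in 𝓝 x, r y = f (c.emb y) := hφ.mono fun y hy => by
    rw [hf]
    change _ = (F (c.emb y)).re
    rw [← hy, hr, Complex.ofReal_re]
  have hDf : (c.D j φ).1 x = ((fderiv ℝ f (c.emb x) (c.vec j x) : ℝ) : ℂ) := by
    have h1 := Complex.ofRealCLM.hasFDerivAt.comp (c.emb x) hfd.hasFDerivAt
    rw [c.D_eq j h1.differentiableAt (hrf.mono fun y hy => by rw [hr, hy]; rfl), h1.fderiv]
    rfl
  have hnorm : ∀ y : RealPoints B, ‖c.emb y - c.emb x‖ ^ 2 ≤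
      ∑ i, (y (c.gen i) - x (c.gen i)) ^ 2 := fun y => by
    have h0 : 0 ≤ ∑ i, (y (c.gen i) - x (c.gen i)) ^ 2 := by positivity
    refine (Real.le_sqrt (norm_nonneg _) h0).1 ?_
    refine (pi_norm_le_iff_of_nonneg (Real.sqrt_nonneg _)).2 fun i => ?_
    refine Real.abs_le_sqrt ?_
    exact Finset.single_le_sum (f := fun i => (y (c.gen i) - x (c.gen i)) ^ 2)
      (fun i _ => sq_nonneg _) (Finset.mem_univ i)
  have hnorm' : ∀ y : RealPoints B, ∑ i, (y (c.gen i) - x (c.gen i)) ^ 2 ≤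
      c.n * ‖c.emb y - c.emb x‖ ^ 2 := fun y => by
    calc ∑ i, (y (c.gen i) - x (c.gen i)) ^ 2 ≤ ∑ i : Fin c.n, ‖c.emb y - c.emb x‖ ^ 2 := by
          refine Finset.sum_le_sum fun i _ => ?_
          rw [← sq_abs]
          exact pow_le_pow_left₀ (abs_nonneg _) (norm_le_pi_norm (c.emb y - c.emb x) i) 2
      _ = _ := by simp
  rw [hDf, Complex.ofReal_inj]
  have hL : ∀ (l : (Fin c.n → ℝ) →L[ℝ] ℝ) (v : Fin c.n → ℝ), l v = ∑ i, l (Pi.single i 1) * v i := by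
    intro l v
    have : v = ∑ i, v i • (Pi.single i (1 : ℝ) : Fin c.n → ℝ) := by
      ext k
      simp [Finset.sum_apply, Pi.single_apply]
    conv_lhs => rw [this]
    simp [map_sum, mul_comm]
  constructor
  · rintro rfl
    refine ⟨fun i => fderiv ℝ f (c.emb x) (Pi.single i 1), (hL _ _).symm, fun ε hε => ?_⟩
    have ho := hfd.hasFDerivAt.isLittleO.def (Real.sqrt_pos.2 hε)
    have ho' := ((continuous_coord c.π).tendsto x).eventually ho
    have hall := hrf.and ho'
    rw [(isEmbedding_coord c.surjective).nhds_eq_comap, Filter.eventually_comap] at hall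
    obtain ⟨δ, hδ, hb⟩ := Metric.eventually_nhds_iff_ball.1 hall
    refine ⟨δ ^ 2, by positivity, fun y hy => ?_⟩
    have hyb : c.emb y ∈ Metric.ball (c.emb x) δ := by
      rw [mem_ball_iff_norm]
      exact lt_of_pow_lt_pow_left₀ 2 hδ.le ((hnorm y).trans_lt hy)
    obtain ⟨h1, h2⟩ := hb _ hyb y rfl
    rw [hL] at h2
    rw [h1, hrf.self_of_nhds, ← sq_abs]
    refine (pow_le_pow_left₀ (abs_nonneg _) h2 2).trans ?_
    rw [mul_pow, Real.sq_sqrt hε.le]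
    exact mul_le_mul_of_nonneg_left (hnorm y) hε.le
  · rintro ⟨l, rfl, hl⟩
    let l' : (Fin c.n → ℝ) →L[ℝ] ℝ := ∑ i, l i • ContinuousLinearMap.proj i
    have hl' : ∀ v, l' v = ∑ i, l i * v i := fun v => by simp [l']
    have h1 : fderiv ℝ (f - ⇑l') (c.emb x) (c.vec j x) = 0 := by
      refine c.fderiv_eq_zero_of_isLittleO (hfd.sub l'.differentiableAt) ?_ (c.isTangent_vec j x)
      refine Asymptotics.isLittleO_iff.2 fun ε hε => ?_
      obtain ⟨δ, hδ, hb⟩ := hl (ε ^ 2 / (c.n + 1)) (by positivity)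
      have hcont : ∀ᶠ y in 𝓝 x, ∑ i, (y (c.gen i) - x (c.gen i)) ^ 2 < δ := by
        have : Continuous fun y : RealPoints B => ∑ i, (y (c.gen i) - x (c.gen i)) ^ 2 :=
          continuous_finsetSum _ fun i _ => ((continuous_apply _).sub continuous_const).pow 2
        refine this.tendsto x |>.eventually (gt_mem_nhds ?_)
        simpa using hδ
      filter_upwards [hcont, hrf] with y hy hry
      have h2 := (hb y hy).trans (mul_le_mul_of_nonneg_left (hnorm' y) (by positivity))
      have h3 : (f - ⇑l') (c.emb y) - (f - ⇑l') (c.emb x) =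
          r y - r x - ∑ i, l i * (y (c.gen i) - x (c.gen i)) := by
        rw [Pi.sub_apply, Pi.sub_apply, hry, hrf.self_of_nhds, hl', hl']
        simp only [mul_sub, Finset.sum_sub_distrib, emb_apply]
        ring
      rw [h3, Real.norm_eq_abs]
      refine abs_le_of_sq_le_sq (h2.trans ?_) (by positivity)
      rw [mul_pow, ← mul_assoc]
      refine mul_le_mul_of_nonneg_right ?_ (by positivity)
      rw [div_mul_eq_mul_div, div_le_iff₀ (by positivity)]
      nlinarith [sq_nonneg ε]
    rw [fderiv_sub hfd l'.differentiableAt, sub_apply, sub_eq_zero] at h1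
    rw [h1, l'.fderiv, hl']

theorem isSemialgebraicFun_sum_sq_sub {W : Type*} [CommRing W] [Algebra ℝ W]
    {p : RealPoints W → RealPoints B} (hp : ∀ b, IsSemialgebraicFun (fun w => p w b)) :
    IsSemialgebraicFun (fun w : RealPoints (W ⊗[ℝ] B) => ∑ i,
      (snd w (c.gen i) - p (fst w) (c.gen i)) * (snd w (c.gen i) - p (fst w) (c.gen i))) :=
  IsSemialgebraicFun.sum _ fun _ =>
    ((isSemialgebraicFun_regular _).snd.sub (hp _).fst).mul
      ((isSemialgebraicFun_regular _).snd.sub (hp _).fst)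

theorem isSemialgebraicFun_remainder {W : Type*} [CommRing W] [Algebra ℝ W]
    {p : RealPoints W → RealPoints B} (hp : ∀ b, IsSemialgebraicFun (fun w => p w b))
    {r : RealPoints B → ℝ} (hr : IsSemialgebraicFun r) (hrp : IsSemialgebraicFun fun w => r (p w))
    {l : RealPoints W → Fin c.n → ℝ} (hl : ∀ i, IsSemialgebraicFun (fun w => l w i)) :
    IsSemialgebraicFun (fun w : RealPoints (W ⊗[ℝ] B) => r (snd w) - r (p (fst w)) -
      ∑ i, l (fst w) i * (snd w (c.gen i) - p (fst w) (c.gen i))) :=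
  (hr.snd.sub hrp.fst).sub (IsSemialgebraicFun.sum _ fun i =>
    (hl i).fst.mul ((isSemialgebraicFun_regular _).snd.sub (hp _).fst))

theorem setOf_forall_remainder_le_mem_semialgebraicSets [Algebra.FinitePresentation ℝ B]
    {W : Type*} [CommRing W] [Algebra ℝ W]
    {p : RealPoints W → RealPoints B} (hp : ∀ b, IsSemialgebraicFun (fun w => p w b))
    {r : RealPoints B → ℝ} (hr : IsSemialgebraicFun r) (hrp : IsSemialgebraicFun fun w => r (p w))
    {l : RealPoints W → Fin c.n → ℝ} (hl : ∀ i, IsSemialgebraicFun (fun w => l w i))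
    {e d : RealPoints W → ℝ} (he : IsSemialgebraicFun e) (hd : IsSemialgebraicFun d) :
    {w : RealPoints W | ∀ y : RealPoints B,
      ∑ i, (y (c.gen i) - p w (c.gen i)) * (y (c.gen i) - p w (c.gen i)) < d w →
        (r y - r (p w) - ∑ i, l w i * (y (c.gen i) - p w (c.gen i))) *
          (r y - r (p w) - ∑ i, l w i * (y (c.gen i) - p w (c.gen i))) ≤
          e w * ∑ i, (y (c.gen i) - p w (c.gen i)) * (y (c.gen i) - p w (c.gen i))} ∈
      semialgebraicSets W :=
  setOf_forall_point_mem_semialgebraicSets (P := fun w y =>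
      ∑ i, (y (c.gen i) - p w (c.gen i)) * (y (c.gen i) - p w (c.gen i)) < d w →
        (r y - r (p w) - ∑ i, l w i * (y (c.gen i) - p w (c.gen i))) *
          (r y - r (p w) - ∑ i, l w i * (y (c.gen i) - p w (c.gen i))) ≤
          e w * ∑ i, (y (c.gen i) - p w (c.gen i)) * (y (c.gen i) - p w (c.gen i)))
    (setOf_imp_mem_semialgebraicSets ((c.isSemialgebraicFun_sum_sq_sub hp).setOf_lt hd.fst)
      (((c.isSemialgebraicFun_remainder hp hr hrp hl).mul
        (c.isSemialgebraicFun_remainder hp hr hrp hl)).setOf_le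
          (he.fst.mul (c.isSemialgebraicFun_sum_sq_sub hp))))

theorem setOf_isLittleO_remainder_mem_semialgebraicSets [Algebra.FinitePresentation ℝ B]
    {W : Type*} [CommRing W] [Algebra ℝ W]
    {p : RealPoints W → RealPoints B} (hp : ∀ b, IsSemialgebraicFun (fun w => p w b))
    {r : RealPoints B → ℝ} (hr : IsSemialgebraicFun r) (hrp : IsSemialgebraicFun fun w => r (p w))
    {l : RealPoints W → Fin c.n → ℝ} (hl : ∀ i, IsSemialgebraicFun (fun w => l w i)) :
    {w : RealPoints W | ∀ e : RealPoints ℝ[X], 0 < e Polynomial.X →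
      ∃ d : RealPoints ℝ[X], 0 < d Polynomial.X ∧ ∀ y : RealPoints B,
        ∑ i, (y (c.gen i) - p w (c.gen i)) * (y (c.gen i) - p w (c.gen i)) < d Polynomial.X →
        (r y - r (p w) - ∑ i, l w i * (y (c.gen i) - p w (c.gen i))) *
          (r y - r (p w) - ∑ i, l w i * (y (c.gen i) - p w (c.gen i))) ≤
          e Polynomial.X * ∑ i, (y (c.gen i) - p w (c.gen i)) * (y (c.gen i) - p w (c.gen i))} ∈
      semialgebraicSets W := by
  have he : IsSemialgebraicFun (fun e : RealPoints ℝ[X] => e Polynomial.X) :=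
    isSemialgebraicFun_regular _
  exact setOf_forall_point_mem_semialgebraicSets (setOf_imp_mem_semialgebraicSets
    ((isSemialgebraicFun_const 0).setOf_lt he.snd)
    (setOf_exists_point_mem_semialgebraicSets (setOf_and_mem_semialgebraicSets
      ((isSemialgebraicFun_const 0).setOf_lt he.snd)
      (c.setOf_forall_remainder_le_mem_semialgebraicSets (fun b => (hp b).fst.fst) hr hrp.fst.fst
        (l := fun w => l (fst (fst w))) (fun i => (hl i).fst.fst) he.snd.fst he.snd))))

theorem isNash_D [Algebra.FinitePresentation ℝ B] {φ : smoothFunctions B} (hφ : IsNash φ)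
    (j : Fin c.n) : IsNash (c.D j φ) := by
  obtain ⟨r, hr, hgr⟩ := hφ
  have hreal : ∀ x, (c.D j φ).1 x = (((c.D j φ).1 x).re : ℂ) := fun x => by
    obtain ⟨F, hF, h⟩ := c.exists_extension φ x
    have h1 := (Complex.ofRealCLM.comp Complex.reCLM).hasFDerivAt.comp (c.emb x)
      (hF.differentiable (by simp) (c.emb x)).hasFDerivAt
    rw [c.D_eq j h1.differentiableAt (h.mono fun y hy => ?_), h1.fderiv]
    · simp
    · rw [Function.comp_apply, ← hy, hr]
      simp
  refine ⟨fun x => ((c.D j φ).1 x).re, hreal, ?_⟩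
  have hr' : IsSemialgebraicFun r := hgr
  have hset : graph (fun x => ((c.D j φ).1 x).re) = {z : RealPoints B[X] |
      ∃ l : RealPoints (MvPolynomial (Fin c.n) ℝ),
        ∑ i, l (MvPolynomial.X i) * (base z) (c.d j (c.gen i)) = z Polynomial.X ∧
        ∀ e : RealPoints ℝ[X], 0 < e Polynomial.X → ∃ d : RealPoints ℝ[X], 0 < d Polynomial.X ∧
          ∀ y : RealPoints B, ∑ i, (y (c.gen i) - (base z) (c.gen i)) *
              (y (c.gen i) - (base z) (c.gen i)) < d Polynomial.X →
            (r y - r (base z) - ∑ i, l (MvPolynomial.X i) * (y (c.gen i) - (base z) (c.gen i))) *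
              (r y - r (base z) - ∑ i, l (MvPolynomial.X i) * (y (c.gen i) - (base z) (c.gen i))) ≤
              e Polynomial.X * ∑ i, (y (c.gen i) - (base z) (c.gen i)) *
              (y (c.gen i) - (base z) (c.gen i))} := by
    ext z
    rw [mem_graph_iff, ← Complex.ofReal_inj, ← hreal, eq_comm, c.hasValue_iff hr j]
    simp only [← pow_two]
    constructor
    · rintro ⟨l, hl, h⟩
      refine ⟨⟨MvPolynomial.aeval l⟩, by simpa [vec] using hl, fun e he => ?_⟩
      obtain ⟨δ, hδ, h'⟩ := h _ he
      exact ⟨⟨Polynomial.aeval δ⟩, by simpa using hδ, by simpa using h'⟩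
    · rintro ⟨l, hl, h⟩
      refine ⟨fun i => l (MvPolynomial.X i), hl, fun ε hε => ?_⟩
      obtain ⟨d, hd, h'⟩ := h ⟨Polynomial.aeval ε⟩ (by simpa using hε)
      exact ⟨_, hd, by simpa using h'⟩
  rw [hset]
  have hb : ∀ b : B, IsSemialgebraicFun (fun z : RealPoints B[X] => base z b) := fun b =>
    isSemialgebraicFun_regular (Polynomial.C b)
  have hl : ∀ i : Fin c.n, IsSemialgebraicFun
      (fun l : RealPoints (MvPolynomial (Fin c.n) ℝ) => l (MvPolynomial.X i)) := fun i =>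
    isSemialgebraicFun_regular _
  exact setOf_exists_point_mem_semialgebraicSets (setOf_and_mem_semialgebraicSets
    (IsSemialgebraicFun.setOf_eq (IsSemialgebraicFun.sum _ fun i => (hl i).snd.mul (hb _).fst)
      (isSemialgebraicFun_regular Polynomial.X).fst)
    (c.setOf_isLittleO_remainder_mem_semialgebraicSets (p := fun w => base (fst w))
      (fun b => (hb b).fst) hr' (hr'.comap Polynomial.CAlgHom).fst
      (l := fun w i => snd w (MvPolynomial.X i)) (fun i => (hl i).snd)))

end CoordinateSystem

end SchwartzAction
end

noncomputable section
namespace SchwartzAction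
open RealPoints

/-! ### Bounds for Nash differential operators by operators with regular coefficients -/

section

variable {B : Type*} [CommRing B] [Algebra ℝ B]

@[simp] theorem smoothFunctions_add_apply (φ ψ : smoothFunctions B) (x : RealPoints B) :
    (φ + ψ).1 x = φ.1 x + ψ.1 x := rfl

@[simp] theorem smoothFunctions_mul_apply (φ ψ : smoothFunctions B) (x : RealPoints B) :
    (φ * ψ).1 x = φ.1 x * ψ.1 x := rfl

@[simp] theorem smoothFunctions_smul_apply (z : ℂ) (φ : smoothFunctions B) (x : RealPoints B) :
    (z • φ).1 x = z * φ.1 x := rfl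

@[simp] theorem smoothFunctions_zero_apply (x : RealPoints B) :
    (0 : smoothFunctions B).1 x = 0 := rfl

@[simp] theorem regularFunction_apply (b : B) (x : RealPoints B) :
    (regularFunction b).1 x = (x b : ℂ) := rfl

@[simp] theorem smoothFunctions_sum_apply {ι : Type*} (s : Finset ι) (f : ι → smoothFunctions B)
    (x : RealPoints B) : (∑ i ∈ s, f i).1 x = ∑ i ∈ s, (f i).1 x := by
  classical
  induction s using Finset.induction_on with
  | empty => simp
  | insert a s ha ih => simp [Finset.sum_insert ha, ih]

theorem isNash_regularFunction (b : B) : IsNash (regularFunction b) :=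
  ⟨fun x => x b, fun _ => rfl, isSemialgebraicFun_regular b⟩

theorem IsNash.mul {f g : smoothFunctions B} (hf : IsNash f) (hg : IsNash g) : IsNash (f * g) := by
  obtain ⟨r, hr, hr'⟩ := hf
  obtain ⟨s, hs, hs'⟩ := hg
  exact ⟨fun x => r x * s x, fun x => by simp [hr, hs], IsSemialgebraicFun.mul hr' hs'⟩

/-- Multiplication by a regular function. -/
def mulRegular (b : B) : Module.End ℂ (smoothFunctions B) := LinearMap.mulLeft ℂ (regularFunction b)

@[simp] theorem mulRegular_apply (b : B) (φ : smoothFunctions B) (x : RealPoints B) :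
    (mulRegular b φ).1 x = x b * φ.1 x := rfl

theorem mulRegular_mem (b : B) : mulRegular b ∈ nashDiffOps B :=
  Algebra.subset_adjoin (Or.inl ⟨_, isNash_regularFunction b, rfl⟩)

namespace CoordinateSystem

variable (c : CoordinateSystem B)

theorem continuous_smoothFunction (c : CoordinateSystem B) (φ : smoothFunctions B) : Continuous φ.1 := by
  refine continuous_iff_continuousAt.2 fun x => ?_
  obtain ⟨F, hF, h⟩ := c.exists_extension φ x
  exact ((hF.continuous.comp (continuous_coord c.π)).continuousAt (x := x)).congr
    (h.mono fun y hy => hy.symm)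

/-- The derivative along `d j`, as a linear operator. -/
def opD (j : Fin c.n) : Module.End ℂ (smoothFunctions B) :=
  (c.D j : smoothFunctions B →ₗ[ℂ] smoothFunctions B)

@[simp] theorem opD_apply (j : Fin c.n) (φ : smoothFunctions B) : c.opD j φ = c.D j φ := rfl

theorem opD_mem (j : Fin c.n) : c.opD j ∈ nashDiffOps B :=
  Algebra.subset_adjoin (Or.inr ⟨c.D j, fun b => by
    rw [D_regularFunction]; exact isNash_regularFunction _, rfl⟩)

/-- The operators generated by the regular functions and the vector fields `d j`. -/
def regularOps : Subalgebra ℂ (Module.End ℂ (smoothFunctions B)) :=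
  Algebra.adjoin ℂ (Set.range mulRegular ∪ Set.range c.opD)

theorem mulRegular_mem_regularOps (b : B) : mulRegular b ∈ c.regularOps :=
  Algebra.subset_adjoin (Or.inl ⟨b, rfl⟩)

theorem opD_mem_regularOps (j : Fin c.n) : c.opD j ∈ c.regularOps :=
  Algebra.subset_adjoin (Or.inr ⟨j, rfl⟩)

/-- The operators with Nash coefficients. -/
def nashSpan : Submodule ℂ (Module.End ℂ (smoothFunctions B)) :=
  Submodule.span ℂ {E | ∃ f : smoothFunctions B, IsNash f ∧
    ∃ T : Module.End ℂ (smoothFunctions B), T ∈ c.regularOps ∧ E = LinearMap.mulLeft ℂ f * T}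

theorem nashDiffOps_le_nashSpan [Algebra.FinitePresentation ℝ B]
    {E : Module.End ℂ (smoothFunctions B)} (hE : E ∈ nashDiffOps B) : E ∈ c.nashSpan := by
  have key : ∀ E' ∈ c.nashSpan, E * E' ∈ c.nashSpan := by
    refine Algebra.adjoin_induction (p := fun E _ => ∀ E' ∈ c.nashSpan, E * E' ∈ c.nashSpan)
      ?_ ?_ ?_ ?_ hE
    · rintro D hD E' hE'
      refine Submodule.span_induction (p := fun E' _ => D * E' ∈ c.nashSpan) ?_ ?_ ?_ ?_ hE'
      · rintro _ ⟨f, hf, T, hT, rfl⟩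
        rcases hD with ⟨g, hg, rfl⟩ | ⟨V, hV, rfl⟩
        · refine Submodule.subset_span ⟨g * f, hg.mul hf, T, hT, ?_⟩
          rw [LinearMap.mulLeft_mul, ← mul_assoc]
          rfl
        · have : (V : smoothFunctions B →ₗ[ℂ] smoothFunctions B) * (LinearMap.mulLeft ℂ f * T) =
              ∑ j, (LinearMap.mulLeft ℂ (V (regularFunction (c.gen j)) * c.D j f) * T +
                LinearMap.mulLeft ℂ (V (regularFunction (c.gen j)) * f) * (c.opD j * T)) := by
            ext φ x
            change (V (f * T φ)).1 x = _
            rw [c.derivation_apply]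
            simp only [LinearMap.sum_apply, smoothFunctions_sum_apply, Derivation.leibniz]
            refine Finset.sum_congr rfl fun j _ => ?_
            simp
            ring
          erw [this]
          refine Submodule.sum_mem _ fun j _ => Submodule.add_mem _ ?_ ?_
          · exact Submodule.subset_span ⟨_, (hV _).mul (c.isNash_D hf j), T, hT, rfl⟩
          · exact Submodule.subset_span ⟨_, (hV _).mul hf, _,
              mul_mem (c.opD_mem_regularOps j) hT, rfl⟩
      · rw [mul_zero]; exact zero_mem _
      · intro S T _ _ hS hT
        rw [mul_add]; exact add_mem hS hT
      · intro z S _ hS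
        rw [mul_smul_comm]; exact Submodule.smul_mem _ _ hS
    · intro z E' hE'
      rw [Algebra.algebraMap_eq_smul_one, smul_mul_assoc, one_mul]
      exact Submodule.smul_mem _ _ hE'
    · intro S T _ _ hS hT E' hE'
      rw [add_mul]; exact add_mem (hS _ hE') (hT _ hE')
    · intro S T _ _ hS hT E' hE'
      rw [mul_assoc]; exact hS _ (hT _ hE')
  have h1 : (1 : Module.End ℂ (smoothFunctions B)) ∈ c.nashSpan := by
    refine Submodule.subset_span ⟨regularFunction 1, isNash_regularFunction 1, 1, one_mem _, ?_⟩
    ext φ x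
    simp
  simpa using key 1 h1

theorem exists_growth_bound_of_isNash [Algebra.FinitePresentation ℝ B] {f : smoothFunctions B}
    (hf : IsNash f) : ∃ (C : ℝ) (N : ℕ), ∀ x, ‖f.1 x‖ ≤ C * x c.wt ^ N := by
  obtain ⟨r, hr, hgr⟩ := hf
  have hc : Continuous r := by
    have := Complex.continuous_re.comp (c.continuous_smoothFunction f)
    refine this.congr fun x => ?_
    simp [hr]
  obtain ⟨C, N, h⟩ := c.exists_growth_bound hc hgr
  exact ⟨C, N, fun x => by rw [hr, Complex.norm_real]; exact h x⟩

theorem exists_list_regularOps_bound [Algebra.FinitePresentation ℝ B]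
    {E : Module.End ℂ (smoothFunctions B)} (hE : E ∈ nashDiffOps B) :
    ∃ L : List (Module.End ℂ (smoothFunctions B)), (∀ T ∈ L, T ∈ c.regularOps) ∧
      ∀ φ x, ‖(E φ).1 x‖ ≤ (L.map fun T => ‖(T φ).1 x‖).sum := by
  refine Submodule.span_induction (p := fun E _ =>
    ∃ L : List (Module.End ℂ (smoothFunctions B)), (∀ T ∈ L, T ∈ c.regularOps) ∧
      ∀ φ x, ‖(E φ).1 x‖ ≤ (L.map fun T => ‖(T φ).1 x‖).sum) ?_ ?_ ?_ ?_
    (c.nashDiffOps_le_nashSpan hE)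
  · rintro _ ⟨f, hf, T, hT, rfl⟩
    obtain ⟨C, N, hC⟩ := c.exists_growth_bound_of_isNash hf
    refine ⟨[(C : ℂ) • (mulRegular (c.wt ^ N) * T)], ?_, fun φ x => ?_⟩
    · intro S hS
      rw [List.mem_singleton.1 hS]
      exact Subalgebra.smul_mem _ (mul_mem (c.mulRegular_mem_regularOps _) hT) _
    · have h1 := hC x
      have h2 : 0 ≤ x c.wt ^ N := pow_nonneg (zero_le_one.trans (c.one_le_wt x)) _
      have h3 : ‖f.1 x‖ ≤ |C| * x c.wt ^ N :=
        h1.trans (mul_le_mul_of_nonneg_right (le_abs_self C) h2)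
      have := mul_le_mul_of_nonneg_right h3 (norm_nonneg ((T φ).1 x))
      simpa [abs_of_nonneg h2, abs_of_nonneg (zero_le_one.trans (c.one_le_wt x)), mul_assoc]
        using this
  · exact ⟨[], by simp, fun φ x => by simp⟩
  · rintro S T _ _ ⟨L, hL, hS⟩ ⟨L', hL', hT⟩
    refine ⟨L ++ L', fun U hU => (List.mem_append.1 hU).elim (hL U) (hL' U), fun φ x => ?_⟩
    rw [List.map_append, List.sum_append]
    exact (norm_add_le _ _).trans (add_le_add (hS φ x) (hT φ x))
  · rintro z S _ ⟨L, hL, hS⟩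
    refine ⟨L.map (z • ·), ?_, fun φ x => ?_⟩
    · intro U hU
      obtain ⟨T, hT, rfl⟩ := List.mem_map.1 hU
      exact Subalgebra.smul_mem _ (hL T hT) _
    · have h1 := mul_le_mul_of_nonneg_left (hS φ x) (norm_nonneg z)
      rw [← List.sum_map_mul_left] at h1
      simpa [List.map_map, Function.comp_def] using h1

end CoordinateSystem

end

end SchwartzAction
end

noncomputable section
namespace SchwartzAction
open RealPoints MeasureTheory
open scoped ENNReal

/-! ### The topological group of real points -/

namespace RealPoints

section

variable {B C : Type*} [CommRing B] [Algebra ℝ B] [CommRing C] [Algebra ℝ C]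

@[simp] theorem pair_tmul (x : RealPoints B) (y : RealPoints C) (b : B) (a : C) :
    pair x y (b ⊗ₜ[ℝ] a) = x b * y a := by
  simp [pair]

theorem continuous_pair : Continuous (fun p : RealPoints B × RealPoints C => pair p.1 p.2) := by
  refine continuous_realPoints_iff.2 fun t => ?_
  induction t using TensorProduct.induction_on with
  | zero => simpa using continuous_const
  | tmul b a =>
    simp only [pair_tmul]
    exact ((continuous_apply b).comp continuous_fst).mul ((continuous_apply a).comp continuous_snd)
  | add s t hs ht => simp only [map_add]; exact hs.add ht

theorem continuous_comap (φ : B →ₐ[ℝ] C) : Continuous (comap φ) :=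
  continuous_realPoints_iff.2 fun b => continuous_apply (φ b)

end

variable {A : Type*} [CommRing A] [HopfAlgebra ℝ A]

theorem inv_apply (g : RealPoints A) (a : A) : g⁻¹ a = g (HopfAlgebra.antipode ℝ a) := rfl

theorem mul_eq (g h : RealPoints A) : g * h = comap (Bialgebra.comulAlgHom ℝ A) (pair g h) :=
  ext_apply fun a => mul_apply g h a

instance : IsTopologicalGroup (RealPoints A) where
  continuous_mul := by
    simp only [mul_eq]
    exact (continuous_comap _).comp continuous_pair
  continuous_inv := continuous_realPoints_iff.2 fun _ => continuous_apply _

end RealPoints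

namespace CoordinateSystem

section

variable {B : Type*} [CommRing B] [Algebra ℝ B] (c : CoordinateSystem B)

theorem secondCountableTopology (c : CoordinateSystem B) :
    SecondCountableTopology (RealPoints B) :=
  (isEmbedding_coord c.surjective).secondCountableTopology

theorem sigmaCompactSpace (c : CoordinateSystem B) : SigmaCompactSpace (RealPoints B) :=
  (isClosedEmbedding_coord c.surjective).sigmaCompactSpace

theorem abs_gen_le_wt (x : RealPoints B) (i : Fin c.n) : |x (c.gen i)| ≤ x c.wt := by
  have h2 : x (c.gen i) ^ 2 ≤ x c.rho := by
    rw [rho_apply]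
    exact Finset.single_le_sum (f := fun i => x (c.gen i) ^ 2) (fun i _ => sq_nonneg _)
      (Finset.mem_univ i)
  rw [wt_apply]
  nlinarith [sq_abs (x (c.gen i)), sq_nonneg (|x (c.gen i)| - 1), abs_nonneg (x (c.gen i))]

theorem exists_regular_bound [Algebra.FinitePresentation ℝ B] (b : B) :
    ∃ (C : ℝ) (N : ℕ), 0 ≤ C ∧ ∀ x : RealPoints B, |x b| ≤ C * x c.wt ^ N := by
  obtain ⟨C, N, h⟩ := c.exists_growth_bound (continuous_apply b) (isSemialgebraicFun_regular b)
  refine ⟨|C|, N, abs_nonneg C, fun x => (h x).trans ?_⟩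
  exact mul_le_mul_of_nonneg_right (le_abs_self C) (pow_nonneg (zero_le_one.trans (c.one_le_wt x)) _)

/-- Regular functions are Lipschitz on balls, with a constant of polynomial growth. -/
theorem exists_regular_lipschitz_bound [Algebra.FinitePresentation ℝ B] (b : B) :
    ∃ (C : ℝ) (N : ℕ), 0 ≤ C ∧ ∀ x y : RealPoints B,
      |x b - y b| ≤ C * (x c.wt * y c.wt) ^ N * ‖c.emb x - c.emb y‖ := by
  obtain ⟨p, rfl⟩ := c.surjective b
  induction p using MvPolynomial.induction_on with
  | C a =>
    refine ⟨0, 0, le_rfl, fun x y => ?_⟩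
    rw [← MvPolynomial.algebraMap_eq, AlgHom.commutes, AlgHom.commutes, AlgHom.commutes]
    simp
  | add p q hp hq =>
    obtain ⟨C, N, hC, h⟩ := hp
    obtain ⟨C', N', hC', h'⟩ := hq
    refine ⟨C + C', N + N', by positivity, fun x y => ?_⟩
    have hW : 1 ≤ x c.wt * y c.wt := one_le_mul_of_one_le_of_one_le (c.one_le_wt x) (c.one_le_wt y)
    rw [map_add, map_add, map_add]
    calc |x (c.π p) + x (c.π q) - (y (c.π p) + y (c.π q))|
        = |(x (c.π p) - y (c.π p)) + (x (c.π q) - y (c.π q))| := by ring_nf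
      _ ≤ |x (c.π p) - y (c.π p)| + |x (c.π q) - y (c.π q)| := abs_add_le _ _
      _ ≤ C * (x c.wt * y c.wt) ^ N * ‖c.emb x - c.emb y‖ +
          C' * (x c.wt * y c.wt) ^ N' * ‖c.emb x - c.emb y‖ := add_le_add (h x y) (h' x y)
      _ ≤ C * (x c.wt * y c.wt) ^ (N + N') * ‖c.emb x - c.emb y‖ +
          C' * (x c.wt * y c.wt) ^ (N + N') * ‖c.emb x - c.emb y‖ := by
          have h1 := pow_le_pow_right₀ hW (Nat.le_add_right N N')
          have h2 := pow_le_pow_right₀ hW (Nat.le_add_left N' N)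
          gcongr
      _ = _ := by ring
  | mul_X p i hp =>
    obtain ⟨C, N, hC, h⟩ := hp
    obtain ⟨C', N', hC', h'⟩ := c.exists_regular_bound (c.π p)
    refine ⟨C + C', N + N' + 1, by positivity, fun x y => ?_⟩
    have hx := c.one_le_wt x
    have hy := c.one_le_wt y
    have hW : 1 ≤ x c.wt * y c.wt := one_le_mul_of_one_le_of_one_le hx hy
    have hxW : x c.wt ≤ x c.wt * y c.wt := le_mul_of_one_le_right (by linarith) hy
    have hyW : y c.wt ≤ x c.wt * y c.wt := le_mul_of_one_le_left (by linarith) hx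
    rw [map_mul, map_mul, map_mul]
    change |x (c.π p) * x (c.gen i) - y (c.π p) * y (c.gen i)| ≤ _
    set W := x c.wt * y c.wt
    have hi : |x (c.gen i) - y (c.gen i)| ≤ ‖c.emb x - c.emb y‖ :=
      norm_le_pi_norm (c.emb x - c.emb y) i
    calc |x (c.π p) * x (c.gen i) - y (c.π p) * y (c.gen i)|
        = |(x (c.π p) - y (c.π p)) * x (c.gen i) + y (c.π p) * (x (c.gen i) - y (c.gen i))| := by
          ring_nf
      _ ≤ |x (c.π p) - y (c.π p)| * |x (c.gen i)| + |y (c.π p)| * |x (c.gen i) - y (c.gen i)| := by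
          rw [← abs_mul, ← abs_mul]; exact abs_add_le _ _
      _ ≤ (C * W ^ N * ‖c.emb x - c.emb y‖) * W + (C' * W ^ N') * ‖c.emb x - c.emb y‖ := by
          have h1 := h x y
          have h2 := (c.abs_gen_le_wt x i).trans hxW
          have h3 : |y (c.π p)| ≤ C' * W ^ N' := (h' y).trans (by gcongr)
          gcongr
      _ = C * W ^ (N + 1) * ‖c.emb x - c.emb y‖ + C' * W ^ N' * ‖c.emb x - c.emb y‖ := by ring
      _ ≤ C * W ^ (N + N' + 1) * ‖c.emb x - c.emb y‖ +
          C' * W ^ (N + N' + 1) * ‖c.emb x - c.emb y‖ := by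
          have h1 := pow_le_pow_right₀ hW (show N + 1 ≤ N + N' + 1 by omega)
          have h2 := pow_le_pow_right₀ hW (show N' ≤ N + N' + 1 by omega)
          gcongr
      _ = _ := by ring

end

section Group

variable {A : Type*} [CommRing A] [HopfAlgebra ℝ A] [Algebra.FinitePresentation ℝ A]
  (c : CoordinateSystem A)

theorem exists_tensor_lipschitz_bound (t : A ⊗[ℝ] A) :
    ∃ (C : ℝ) (N : ℕ), 0 ≤ C ∧ ∀ g h : RealPoints A,
      |pair g⁻¹ h t - pair g⁻¹ g t| ≤ C * (g c.wt * h c.wt) ^ N * ‖c.emb h - c.emb g‖ := by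
  induction t using TensorProduct.induction_on with
  | zero => exact ⟨0, 0, le_rfl, fun g h => by simp⟩
  | tmul u v =>
    obtain ⟨C, N, hC, h1⟩ := c.exists_regular_bound (HopfAlgebra.antipode ℝ u)
    obtain ⟨C', N', hC', h2⟩ := c.exists_regular_lipschitz_bound v
    refine ⟨C * C', N + N', by positivity, fun g h => ?_⟩
    have hg := c.one_le_wt g
    have hh := c.one_le_wt h
    have hgW : g c.wt ≤ g c.wt * h c.wt := le_mul_of_one_le_right (by linarith) hh
    rw [pair_tmul, pair_tmul, ← mul_sub, abs_mul, inv_apply]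
    have h3 := h2 h g
    rw [mul_comm (h c.wt)] at h3
    calc _ ≤ (C * (g c.wt * h c.wt) ^ N) *
          (C' * (g c.wt * h c.wt) ^ N' * ‖c.emb h - c.emb g‖) := by
          have h4 : |g (HopfAlgebra.antipode ℝ u)| ≤ C * (g c.wt * h c.wt) ^ N :=
            (h1 g).trans (by gcongr)
          gcongr
      _ = _ := by ring
  | add s t hs ht =>
    obtain ⟨C, N, hC, h⟩ := hs
    obtain ⟨C', N', hC', h'⟩ := ht
    refine ⟨C + C', N + N', by positivity, fun x y => ?_⟩
    have hW : 1 ≤ x c.wt * y c.wt := one_le_mul_of_one_le_of_one_le (c.one_le_wt x) (c.one_le_wt y)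
    rw [map_add, map_add]
    calc |pair x⁻¹ y s + pair x⁻¹ y t - (pair x⁻¹ x s + pair x⁻¹ x t)|
        = |(pair x⁻¹ y s - pair x⁻¹ x s) + (pair x⁻¹ y t - pair x⁻¹ x t)| := by ring_nf
      _ ≤ |pair x⁻¹ y s - pair x⁻¹ x s| + |pair x⁻¹ y t - pair x⁻¹ x t| := abs_add_le _ _
      _ ≤ C * (x c.wt * y c.wt) ^ N * ‖c.emb y - c.emb x‖ +
          C' * (x c.wt * y c.wt) ^ N' * ‖c.emb y - c.emb x‖ := add_le_add (h x y) (h' x y)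
      _ ≤ C * (x c.wt * y c.wt) ^ (N + N') * ‖c.emb y - c.emb x‖ +
          C' * (x c.wt * y c.wt) ^ (N + N') * ‖c.emb y - c.emb x‖ := by
          have h1 := pow_le_pow_right₀ hW (Nat.le_add_right N N')
          have h2 := pow_le_pow_right₀ hW (Nat.le_add_left N' N)
          gcongr
      _ = _ := by ring

theorem exists_inv_mul_bound : ∃ (C N : ℕ), 0 < C ∧ ∀ g h : RealPoints A, ∀ i,
    |(g⁻¹ * h) (c.gen i) - (1 : RealPoints A) (c.gen i)| ≤
      C * (g c.wt * h c.wt) ^ N * ‖c.emb h - c.emb g‖ := by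
  choose C N hC h using fun i => c.exists_tensor_lipschitz_bound (Coalgebra.comul (c.gen i))
  refine ⟨⌈∑ i, C i⌉₊ + 1, ∑ i, N i, by omega, fun x y i => ?_⟩
  have hW : 1 ≤ x c.wt * y c.wt := one_le_mul_of_one_le_of_one_le (c.one_le_wt x) (c.one_le_wt y)
  have h1 : (x⁻¹ * y) (c.gen i) = pair x⁻¹ y (Coalgebra.comul (c.gen i)) := mul_apply _ _ _
  have h2 : (1 : RealPoints A) (c.gen i) = pair x⁻¹ x (Coalgebra.comul (c.gen i)) := by
    rw [← inv_mul_cancel x]; exact mul_apply _ _ _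
  rw [h1, h2]
  refine (h i x y).trans ?_
  have h3 : C i ≤ ∑ i, C i := Finset.single_le_sum (fun i _ => hC i) (Finset.mem_univ i)
  have h4 : N i ≤ ∑ i, N i := Finset.single_le_sum (fun i _ => Nat.zero_le _) (Finset.mem_univ i)
  have h5 : C i ≤ ((⌈∑ i, C i⌉₊ + 1 : ℕ) : ℝ) := by
    push_cast
    linarith [Nat.le_ceil (∑ i, C i)]
  have h6 := pow_le_pow_right₀ hW h4
  gcongr

theorem exists_haar_growth_bound (μ : Measure (RealPoints A)) [μ.IsHaarMeasure] :
    ∃ (C : ℝ≥0∞) (N : ℕ), C ≠ ⊤ ∧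
      ∀ R : ℕ, 1 ≤ R → μ {g | g c.wt ≤ R} ≤ C * (R : ℝ≥0∞) ^ N := by
  classical
  obtain ⟨C, M, hC, hCM⟩ := c.exists_inv_mul_bound
  let K : Set (RealPoints A) := {y | ∀ i, |y (c.gen i) - (1 : RealPoints A) (c.gen i)| ≤ 1}
  have hK : IsCompact K := by
    have h1 := (isClosedEmbedding_coord c.surjective).isCompact_preimage
      (isCompact_closedBall (c.emb 1) 1)
    convert h1 using 1
    ext y
    rw [Set.mem_preimage, mem_closedBall_iff_norm, pi_norm_le_iff_of_nonneg zero_le_one]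
    rfl
  refine ⟨((3 * C : ℕ) : ℝ≥0∞) ^ c.n * μ K, (2 * M + 1) * c.n,
    ENNReal.mul_ne_top (ENNReal.pow_ne_top (ENNReal.natCast_ne_top _)) hK.measure_lt_top.ne, fun R hR => ?_⟩
  set m : ℕ := C * R ^ (2 * M) with hm
  have hm0 : 0 < m := by positivity
  have hmR : (0 : ℝ) < m := by exact_mod_cast hm0
  let Q : RealPoints A → Fin c.n → ℤ := fun g i => ⌊g (c.gen i) * m⌋
  let T : Finset (Fin c.n → ℤ) := Fintype.piFinset fun _ => Finset.Icc (-((R * m : ℕ) : ℤ)) (R * m : ℕ)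
  have hcover : {g : RealPoints A | g c.wt ≤ R} ⊆ ⋃ z ∈ T, {g | g c.wt ≤ R ∧ Q g = z} := by
    intro g hg
    refine Set.mem_biUnion (x := Q g) ?_ ⟨hg, rfl⟩
    rw [Finset.mem_coe, Fintype.mem_piFinset]
    intro i
    have h1 := abs_le.1 ((c.abs_gen_le_wt g i).trans hg)
    rw [Finset.mem_Icc]
    constructor
    · refine Int.le_floor.2 ?_
      push_cast
      nlinarith
    · refine Int.cast_le.1 ((Int.floor_le _).trans ?_ : ((⌊g (c.gen i) * m⌋ : ℤ) : ℝ) ≤ _)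
      push_cast
      nlinarith
  have hpiece : ∀ z, μ {g | g c.wt ≤ R ∧ Q g = z} ≤ μ K := by
    intro z
    rcases Set.eq_empty_or_nonempty {g : RealPoints A | g c.wt ≤ R ∧ Q g = z} with h0 | ⟨g, hg, hgz⟩
    · rw [h0]; simp
    rw [← measure_preimage_mul μ g⁻¹ K]
    refine measure_mono fun h ⟨hh, hhz⟩ i => ?_
    have h1 : ‖c.emb h - c.emb g‖ ≤ 1 / m := by
      refine (pi_norm_le_iff_of_nonneg (by positivity)).2 fun i => ?_
      change |h (c.gen i) - g (c.gen i)| ≤ _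
      have h2 : ⌊h (c.gen i) * m⌋ = ⌊g (c.gen i) * m⌋ := congrFun (hhz.trans hgz.symm) i
      have h3 := Int.abs_sub_lt_one_of_floor_eq_floor h2
      rw [← sub_mul, abs_mul, abs_of_pos hmR] at h3
      rw [le_div_iff₀ hmR]
      exact h3.le
    refine (hCM g h i).trans ?_
    have hg1 := c.one_le_wt g
    have hh1 := c.one_le_wt h
    have hg' : g c.wt ≤ R := hg
    calc (C : ℝ) * (g c.wt * h c.wt) ^ M * ‖c.emb h - c.emb g‖
        ≤ C * ((R : ℝ) * R) ^ M * (1 / m) := by gcongr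
      _ = 1 := by
          rw [hm]
          push_cast
          have : (0 : ℝ) < R := by exact_mod_cast hR
          have : (0 : ℝ) < C := by exact_mod_cast hC
          field_simp
          ring
  have hcard : T.card ≤ (3 * C) ^ c.n * R ^ ((2 * M + 1) * c.n) := by
    rw [Fintype.card_piFinset_const, Int.card_Icc, pow_mul, ← mul_pow]
    refine Nat.pow_le_pow_left ?_ _
    have h1 : 1 ≤ R * m := Nat.mul_pos hR hm0
    have h2 : 3 * C * R ^ (2 * M + 1) = 3 * (R * m) := by rw [hm]; ring
    rw [h2]
    omega
  calc μ {g | g c.wt ≤ R} ≤ μ (⋃ z ∈ T, {g | g c.wt ≤ R ∧ Q g = z}) := measure_mono hcover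
    _ ≤ ∑ z ∈ T, μ {g | g c.wt ≤ R ∧ Q g = z} := measure_biUnion_finset_le _ _
    _ ≤ ∑ z ∈ T, μ K := Finset.sum_le_sum fun z _ => hpiece z
    _ = T.card * μ K := by rw [Finset.sum_const, nsmul_eq_mul]
    _ ≤ (((3 * C) ^ c.n * R ^ ((2 * M + 1) * c.n) : ℕ) : ℝ≥0∞) * μ K := by gcongr
    _ = _ := by push_cast; ring

theorem exists_integrable_wt_inv_pow (μ : Measure (RealPoints A)) [μ.IsHaarMeasure] :
    ∃ M : ℕ, Integrable (fun g : RealPoints A => ((g c.wt) ^ M)⁻¹) μ := by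
  obtain ⟨C, N, hC, h⟩ := c.exists_haar_growth_bound μ
  refine ⟨N + 2, ?_, ?_⟩
  · have := c.secondCountableTopology
    refine Continuous.aestronglyMeasurable ?_
    exact ((continuous_apply c.wt).pow _).inv₀ fun g =>
      pow_ne_zero _ (zero_lt_one.trans_le (c.one_le_wt g)).ne'
  have hpt : ∀ k : ℕ, ∀ g : RealPoints A, (k : ℝ) ≤ g c.wt →
      ‖((g c.wt) ^ (N + 2))⁻¹‖ₑ ≤ ENNReal.ofReal ((2 / ((k : ℝ) + 1)) ^ (N + 2)) := by
    intro k g hk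
    have h1 := c.one_le_wt g
    rw [Real.enorm_of_nonneg (by positivity)]
    refine ENNReal.ofReal_le_ofReal ?_
    rw [← inv_pow]
    refine pow_le_pow_left₀ (by positivity) ?_ _
    rw [inv_eq_one_div, div_le_div_iff₀ (by positivity) (by positivity)]
    linarith
  have hun : (Set.univ : Set (RealPoints A)) ⊆ ⋃ k : ℕ, {g | (k : ℝ) ≤ g c.wt ∧ g c.wt ≤ (k + 1 : ℕ)} := by
    intro g _
    have h1 := c.one_le_wt g
    refine Set.mem_iUnion.2 ⟨⌊g c.wt⌋₊, Nat.floor_le (by linarith), ?_⟩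
    push_cast
    exact (Nat.lt_floor_add_one _).le
  have hterm : ∀ k : ℕ, ∫⁻ g in {g | (k : ℝ) ≤ g c.wt ∧ g c.wt ≤ (k + 1 : ℕ)},
      ‖((g c.wt) ^ (N + 2))⁻¹‖ₑ ∂μ ≤
      C * ENNReal.ofReal (2 ^ (N + 2) * (1 / (((k + 1 : ℕ) : ℝ)) ^ 2)) := by
    intro k
    have hmeas : MeasurableSet {g : RealPoints A | (k : ℝ) ≤ g c.wt ∧ g c.wt ≤ (k + 1 : ℕ)} :=
      ((isClosed_le continuous_const (continuous_apply _)).inter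
        (isClosed_le (continuous_apply _) continuous_const)).measurableSet
    calc _ ≤ ∫⁻ _ in {g : RealPoints A | (k : ℝ) ≤ g c.wt ∧ g c.wt ≤ (k + 1 : ℕ)},
          ENNReal.ofReal ((2 / ((k : ℝ) + 1)) ^ (N + 2)) ∂μ :=
          setLIntegral_mono' hmeas fun g hg => hpt k g hg.1
      _ = ENNReal.ofReal ((2 / ((k : ℝ) + 1)) ^ (N + 2)) *
          μ {g : RealPoints A | (k : ℝ) ≤ g c.wt ∧ g c.wt ≤ (k + 1 : ℕ)} := setLIntegral_const _ _
      _ ≤ ENNReal.ofReal ((2 / ((k : ℝ) + 1)) ^ (N + 2)) * (C * ((k + 1 : ℕ) : ℝ≥0∞) ^ N) := by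
          gcongr
          exact (measure_mono fun g hg => hg.2).trans (h (k + 1) (by omega))
      _ = C * (ENNReal.ofReal ((2 / ((k : ℝ) + 1)) ^ (N + 2)) * ENNReal.ofReal (((k + 1 : ℕ) : ℝ) ^ N)) := by
          rw [ENNReal.ofReal_pow (by positivity) N, ENNReal.ofReal_natCast]
          ring
      _ = _ := by
          rw [← ENNReal.ofReal_mul (by positivity)]
          congr 2
          have h0 : (k : ℝ) + 1 ≠ 0 := by positivity
          push_cast
          rw [div_pow, div_mul_eq_mul_div, mul_one_div, div_eq_div_iff (pow_ne_zero _ h0)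
            (pow_ne_zero _ h0)]
          ring
  have hsum : Summable fun k : ℕ => (2 : ℝ) ^ (N + 2) * (1 / (((k + 1 : ℕ) : ℝ)) ^ 2) :=
    ((summable_nat_add_iff 1).2 (Real.summable_one_div_nat_pow.2 one_lt_two)).mul_left _
  calc ∫⁻ g, ‖((g c.wt) ^ (N + 2))⁻¹‖ₑ ∂μ
      = ∫⁻ g in Set.univ, ‖((g c.wt) ^ (N + 2))⁻¹‖ₑ ∂μ := by rw [setLIntegral_univ]
    _ ≤ ∫⁻ g in ⋃ k : ℕ, {g | (k : ℝ) ≤ g c.wt ∧ g c.wt ≤ (k + 1 : ℕ)},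
        ‖((g c.wt) ^ (N + 2))⁻¹‖ₑ ∂μ := lintegral_mono_set hun
    _ ≤ ∑' k : ℕ, ∫⁻ g in {g | (k : ℝ) ≤ g c.wt ∧ g c.wt ≤ (k + 1 : ℕ)},
        ‖((g c.wt) ^ (N + 2))⁻¹‖ₑ ∂μ := lintegral_iUnion_le _ _
    _ ≤ ∑' k : ℕ, C * ENNReal.ofReal (2 ^ (N + 2) * (1 / (((k + 1 : ℕ) : ℝ)) ^ 2)) :=
        ENNReal.tsum_le_tsum hterm
    _ = C * ENNReal.ofReal (∑' k : ℕ, 2 ^ (N + 2) * (1 / (((k + 1 : ℕ) : ℝ)) ^ 2)) := by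
        rw [ENNReal.tsum_mul_left, ENNReal.ofReal_tsum_of_nonneg (fun k => by positivity) hsum]
    _ < (⊤ : ℝ≥0∞) := ENNReal.mul_lt_top hC.lt_top ENNReal.ofReal_lt_top

end Group

end CoordinateSystem

end SchwartzAction
end

noncomputable section
namespace SchwartzAction
open RealPoints MeasureTheory

/-! ### Operators on Schwartz spaces -/

namespace SchwartzSpace

variable {B : Type*} [CommRing B] [Algebra ℝ B]

/-- A smooth function which is Schwartz, as an element of the Schwartz space. -/
def mk (φ : smoothFunctions B) (h : φ ∈ schwartzSubmodule B) : SchwartzSpace B := ⟨φ, h⟩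

theorem toSmooth_injective : Function.Injective (toSmooth (B := B)) := Subtype.val_injective

theorem ext_apply {ξ η : SchwartzSpace B} (h : ∀ x, ξ x = η x) : ξ = η :=
  toSmooth_injective (Subtype.ext (funext h))

theorem norm_le_seminorm (D : nashDiffOps B) (ξ : SchwartzSpace B) (x : RealPoints B) :
    ‖(D.1 (toSmooth ξ)).1 x‖ ≤ seminorm D ξ := le_ciSup (bddAbove D ξ) x

theorem norm_apply_le (ξ : SchwartzSpace B) (x : RealPoints B) : ‖ξ x‖ ≤ seminorm (1 : nashDiffOps B) ξ :=
  norm_le_seminorm (1 : nashDiffOps B) ξ x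

theorem continuous_seminorm (D : nashDiffOps B) : Continuous (seminorm D) :=
  withSeminorms.continuous_seminorm D

/-- The action of a Nash differential operator on the Schwartz space. -/
def mapOp (D : nashDiffOps B) : SchwartzSpace B →ₗ[ℂ] SchwartzSpace B where
  toFun ξ := mk (D.1 (toSmooth ξ)) fun E hE =>
    Subtype.property (p := (· ∈ schwartzSubmodule B)) ξ (E * D.1) (mul_mem hE D.2)
  map_add' ξ η := toSmooth_injective (map_add D.1 (toSmooth ξ) (toSmooth η))
  map_smul' z ξ := toSmooth_injective (map_smul D.1 z (toSmooth ξ))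

theorem seminorm_mapOp (D E : nashDiffOps B) (ξ : SchwartzSpace B) :
    seminorm E (mapOp D ξ) = seminorm (E * D) ξ := rfl

end SchwartzSpace

/-- Multiplication by a regular function, as a Nash differential operator. -/
def nashMul {B : Type*} [CommRing B] [Algebra ℝ B] (b : B) : nashDiffOps B :=
  ⟨mulRegular b, mulRegular_mem b⟩

/-- The derivative along `d j`, as a Nash differential operator. -/
def CoordinateSystem.nashD {B : Type*} [CommRing B] [Algebra ℝ B] (c : CoordinateSystem B)
    (j : Fin c.n) : nashDiffOps B := ⟨c.opD j, c.opD_mem j⟩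

/-! ### Algebraic actions on real points -/

/-- An algebraic morphism `X × G → X` which is a right action on real points. -/
structure PointAction (A B : Type*) [CommRing A] [HopfAlgebra ℝ A] [CommRing B] [Algebra ℝ B] where
  coact : B →ₐ[ℝ] B ⊗[ℝ] A
  mul : ∀ (x : RealPoints B) (g h : RealPoints A),
    comap coact (pair (comap coact (pair x g)) h) = comap coact (pair x (g * h))
  one : ∀ x : RealPoints B, comap coact (pair x (1 : RealPoints A)) = x

section

variable {A B : Type*} [CommRing A] [HopfAlgebra ℝ A] [CommRing B] [Algebra ℝ B]

/-- The right action on real points of an action of group schemes. -/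
def RightAction.toPointAction (ρ : RightAction A B) : PointAction A B where
  coact := ρ.coact
  mul x g h := ext_apply fun b => by
    have key : ∀ t : B ⊗[ℝ] A, pair (comap ρ.coact (pair x g)) h t =
        pair x (pair g h) (Algebra.TensorProduct.assoc ℝ ℝ ℝ B A A
          (Algebra.TensorProduct.map ρ.coact (AlgHom.id ℝ A) t)) := fun t => by
      induction t using TensorProduct.induction_on with
      | zero => simp
      | tmul b a =>
        have h1 : ∀ s : B ⊗[ℝ] A, pair x g s * h a =
            pair x (pair g h) (Algebra.TensorProduct.assoc ℝ ℝ ℝ B A A (s ⊗ₜ a)) := fun s => by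
          induction s using TensorProduct.induction_on with
          | zero => simp
          | tmul b a' => simp [mul_assoc]
          | add s t hs ht => simp only [map_add, add_mul, TensorProduct.add_tmul, hs, ht]
        simpa using h1 (ρ.coact b)
      | add s t hs ht => simp only [map_add, hs, ht]
    have key2 : ∀ t : B ⊗[ℝ] A, pair x (g * h) t = pair x (pair g h)
        (Algebra.TensorProduct.map (AlgHom.id ℝ B) (Bialgebra.comulAlgHom ℝ A) t) := fun t => by
      induction t using TensorProduct.induction_on with
      | zero => simp
      | tmul b a => simp [mul_eq]
      | add s t hs ht => simp only [map_add, hs, ht]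
    rw [comap_apply, comap_apply, key, key2]
    exact congrArg (pair x (pair g h)) (DFunLike.congr_fun ρ.coassoc b)
  one x := ext_apply fun b => by
    have key : ∀ t : B ⊗[ℝ] A, pair x (1 : RealPoints A) t = x (Algebra.TensorProduct.rid ℝ ℝ B
        (Algebra.TensorProduct.map (AlgHom.id ℝ B) (Bialgebra.counitAlgHom ℝ A) t)) := fun t => by
      induction t using TensorProduct.induction_on with
      | zero => simp
      | tmul b a => simp [one_apply, mul_comm]
      | add s t hs ht => simp only [map_add, hs, ht]
    rw [comap_apply, key]
    exact congrArg x (DFunLike.congr_fun ρ.counit b)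

theorem pair_map_antipode (x : RealPoints B) (g : RealPoints A) (t : B ⊗[ℝ] A) :
    pair x g (Algebra.TensorProduct.map (AlgHom.id ℝ B) (HopfAlgebra.antipodeAlgHom ℝ A) t) =
      pair x g⁻¹ t := by
  induction t using TensorProduct.induction_on with
  | zero => simp
  | tmul b a => simp [inv_apply]
  | add s t hs ht => simp only [map_add, hs, ht]

variable (A) in
/-- The comorphism of `(x, g) ↦ g⁻¹ x`. -/
def invTranslationCoact : A →ₐ[ℝ] A ⊗[ℝ] A :=
  (Algebra.TensorProduct.map (AlgHom.id ℝ A) (HopfAlgebra.antipodeAlgHom ℝ A)).comp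
    ((Algebra.TensorProduct.comm ℝ A A).toAlgHom.comp (Bialgebra.comulAlgHom ℝ A))

theorem comap_invTranslationCoact (x g : RealPoints A) :
    comap (invTranslationCoact A) (pair x g) = g⁻¹ * x := by
  rw [mul_eq]
  refine ext_apply fun a => ?_
  have h1 : ∀ t : A ⊗[ℝ] A, pair x g⁻¹ (Algebra.TensorProduct.comm ℝ A A t) = pair g⁻¹ x t := by
    intro t
    induction t using TensorProduct.induction_on with
    | zero => simp
    | tmul b a => simp [mul_comm]
    | add s t hs ht => simp only [map_add, hs, ht]
  exact (pair_map_antipode _ _ _).trans (h1 _)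

variable (A) in
/-- The right action `(x, g) ↦ g⁻¹ x` of `G(ℝ)` on itself. -/
def invTranslation : PointAction A A where
  coact := invTranslationCoact A
  mul x g h := by
    rw [comap_invTranslationCoact, comap_invTranslationCoact, comap_invTranslationCoact]
    group
  one x := by rw [comap_invTranslationCoact]; simp

namespace PointAction

variable (P : PointAction A B)

/-- The point `x g`. -/
def act (x : RealPoints B) (g : RealPoints A) : RealPoints B := comap P.coact (pair x g)

theorem act_act (x : RealPoints B) (g h : RealPoints A) : P.act (P.act x g) h = P.act x (g * h) :=
  P.mul x g h

theorem act_one (x : RealPoints B) : P.act x 1 = x := P.one x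

theorem continuous_act : Continuous (fun p : RealPoints B × RealPoints A => P.act p.1 p.2) :=
  (continuous_comap _).comp continuous_pair

theorem exists_act_eq (b : B) : ∃ S : Finset (B × A), ∀ x g,
    P.act x g b = ∑ i ∈ S, x i.1 * g i.2 := by
  obtain ⟨S, hS⟩ := TensorProduct.exists_finset (P.coact b)
  refine ⟨S, fun x g => ?_⟩
  rw [act, comap_apply, hS, map_sum]
  simp

theorem exists_eq_sum_act (b : B) : ∃ S : Finset (B × A), ∀ x g,
    x b = ∑ i ∈ S, P.act x g i.1 * g i.2 := by
  obtain ⟨S, hS⟩ := TensorProduct.exists_finset (Algebra.TensorProduct.map (AlgHom.id ℝ B)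
    (HopfAlgebra.antipodeAlgHom ℝ A) (P.coact b))
  refine ⟨S, fun x g => ?_⟩
  have h1 : x b = P.act (P.act x g) g⁻¹ b := by
    rw [act_act, mul_inv_cancel, act_one]
  rw [h1, act, comap_apply, ← pair_map_antipode, hS, map_sum]
  simp

end PointAction

theorem invTranslation_act (x g : RealPoints A) : (invTranslation A).act x g = g⁻¹ * x :=
  comap_invTranslationCoact x g

/-! ### Integrability -/

theorem exists_nashDiffOp_integral_bound [Algebra.FinitePresentation ℝ A] (c : CoordinateSystem A)
    (μ : Measure (RealPoints A)) [μ.IsHaarMeasure] :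
    ∃ (W : nashDiffOps A) (J : ℝ), 0 ≤ J ∧ ∀ (Ξ : SchwartzSpace A) (f : RealPoints A → ℂ) (K : ℝ),
      0 ≤ K → Continuous f → (∀ g, ‖f g‖ ≤ K) →
      Integrable (fun g => Ξ g * f g) μ ∧
        ∫ g, ‖Ξ g * f g‖ ∂μ ≤ J * SchwartzSpace.seminorm W Ξ * K := by
  obtain ⟨M, hM⟩ := c.exists_integrable_wt_inv_pow μ
  have hw : ∀ g : RealPoints A, 0 < g c.wt ^ M := fun g =>
    pow_pos (zero_lt_one.trans_le (c.one_le_wt g)) _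
  refine ⟨nashMul (c.wt ^ M), ∫ g : RealPoints A, ((g c.wt) ^ M)⁻¹ ∂μ,
    integral_nonneg fun g => (inv_pos.2 (hw g)).le, fun Ξ f K hK hf hfK => ?_⟩
  have := c.secondCountableTopology
  have hb : ∀ g, ‖Ξ g * f g‖ ≤
      ((g c.wt) ^ M)⁻¹ * (SchwartzSpace.seminorm (nashMul (c.wt ^ M)) Ξ * K) := fun g => by
    have h1 := SchwartzSpace.norm_le_seminorm (nashMul (c.wt ^ M)) Ξ g
    change ‖((g (c.wt ^ M) : ℝ) : ℂ) * Ξ g‖ ≤ _ at h1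
    rw [norm_mul, Complex.norm_real, map_pow, Real.norm_of_nonneg (hw g).le] at h1
    rw [← mul_assoc, norm_mul]
    refine mul_le_mul ?_ (hfK g) (norm_nonneg _) ?_
    · rw [inv_mul_eq_div, le_div_iff₀ (hw g), mul_comm]; exact h1
    · exact mul_nonneg (inv_pos.2 (hw g)).le (apply_nonneg _ _)
  have hint := hM.mul_const (SchwartzSpace.seminorm (nashMul (c.wt ^ M)) Ξ * K)
  have hI : Integrable (fun g => Ξ g * f g) μ :=
    hint.mono' ((c.continuous_smoothFunction _).mul hf).aestronglyMeasurable
      (Filter.Eventually.of_forall hb)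
  refine ⟨hI, (integral_mono hI.norm hint hb).trans_eq ?_⟩
  rw [integral_mul_const, mul_assoc]

theorem integrable_mul_bounded [Algebra.FinitePresentation ℝ A] (c : CoordinateSystem A)
    (μ : Measure (RealPoints A)) [μ.IsHaarMeasure] (Ξ : SchwartzSpace A) {f : RealPoints A → ℂ}
    {K : ℝ} (hf : Continuous f) (hfK : ∀ g, ‖f g‖ ≤ K) : Integrable (fun g => Ξ g * f g) μ := by
  obtain ⟨W, J, _, h⟩ := exists_nashDiffOp_integral_bound c μ
  exact (h Ξ f K ((norm_nonneg _).trans (hfK 1)) hf hfK).1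

theorem integrable_schwartz [Algebra.FinitePresentation ℝ A] (c : CoordinateSystem A)
    (μ : Measure (RealPoints A)) [μ.IsHaarMeasure] (Ξ : SchwartzSpace A) :
    Integrable (fun g => Ξ g) μ := by
  simpa using integrable_mul_bounded c μ Ξ (f := fun _ => 1) (K := 1) continuous_const (by simp)

end

end SchwartzAction
end

noncomputable section
namespace SchwartzAction
open RealPoints MeasureTheory SchwartzSpace

/-! ### Smoothness of the action integral -/

namespace CoordinateSystem

variable {B : Type*} [CommRing B] [Algebra ℝ B] (c : CoordinateSystem B)

theorem contDiffOn_regular_comp {ρ : (Fin c.n → ℝ) → RealPoints B} {U : Set (Fin c.n → ℝ)}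
    (hρ : ContDiffOn ℝ ∞ (fun u => c.emb (ρ u)) U) (b : B) :
    ContDiffOn ℝ ∞ (fun u => ρ u b) U := by
  obtain ⟨p, rfl⟩ := c.surjective b
  simp only [apply_eq_eval_coord]
  exact ((contDiff_mvPolynomial_eval p).of_le le_top).comp_contDiffOn hρ

/-- The complexified derivative of a regular function along a parametrization. -/
def regularFDeriv (ρ : (Fin c.n → ℝ) → RealPoints B) (b : B) (u : Fin c.n → ℝ) :
    (Fin c.n → ℝ) →L[ℝ] ℂ :=
  Complex.ofRealCLM.comp (fderiv ℝ (fun u => ρ u b) u)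

theorem contDiffOn_regularFDeriv {ρ : (Fin c.n → ℝ) → RealPoints B} {U : Set (Fin c.n → ℝ)}
    (hU : IsOpen U) (hρ : ContDiffOn ℝ ∞ (fun u => c.emb (ρ u)) U) (b : B) :
    ContDiffOn ℝ ∞ (c.regularFDeriv ρ b) U :=
  contDiffOn_const.clm_comp
    ((contDiffOn_infty_iff_fderiv_of_isOpen hU).1 (c.contDiffOn_regular_comp hρ b)).2

end CoordinateSystem

section

variable {A B : Type*} [CommRing A] [HopfAlgebra ℝ A] [CommRing B] [Algebra ℝ B]

namespace PointAction

variable (P : PointAction A B) (μ : Measure (RealPoints A))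

theorem continuous_schwartz_act (c : CoordinateSystem B) (ξ : SchwartzSpace B) (x : RealPoints B) :
    Continuous (fun g => ξ (P.act x g)) := by
  have h : Continuous (fun g => P.act x g) :=
    P.continuous_act.comp (f := fun g => (x, g)) (continuous_const.prodMk continuous_id)
  exact (c.continuous_smoothFunction (toSmooth ξ)).comp h

/-- The function `Ξ ξ` on `X(ℝ)`. -/
def integral (Ξ : SchwartzSpace A) (ξ : SchwartzSpace B) (x : RealPoints B) : ℂ :=
  ∫ g, Ξ g * ξ (P.act x g) ∂μ

variable [Algebra.FinitePresentation ℝ A] (cA : CoordinateSystem A) (c : CoordinateSystem B)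
  [μ.IsHaarMeasure]

include cA c in
theorem integrable (Ξ : SchwartzSpace A) (ξ : SchwartzSpace B) (x : RealPoints B) :
    Integrable (fun g => Ξ g * ξ (P.act x g)) μ :=
  integrable_mul_bounded cA μ Ξ (P.continuous_schwartz_act c ξ x) fun _ => norm_apply_le _ _

section Derivative

variable {P c} {S : Fin c.n → Finset (B × A)}
  (hS : ∀ j x g, P.act x g (c.gen j) = ∑ i ∈ S j, x i.1 * g i.2)
  {ρ : (Fin c.n → ℝ) → RealPoints B} {U : Set (Fin c.n → ℝ)} (hU : IsOpen U)
  (hρ : ContDiffOn ℝ ∞ (fun u => c.emb (ρ u)) U)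

omit [Algebra.FinitePresentation ℝ A] in
include hS hU hρ in
theorem hasFDerivAt_schwartz_act (ξ : SchwartzSpace B) (g : RealPoints A)
    {u : Fin c.n → ℝ} (hu : u ∈ U) :
    HasFDerivAt (fun u => ξ (P.act (ρ u) g))
      (∑ j, ∑ i ∈ S j, ((g i.2 : ℂ) * mapOp (c.nashD j) ξ (P.act (ρ u) g)) •
        c.regularFDeriv ρ i.1 u) u := by
  have hreg : ∀ b : B, HasFDerivAt (fun u => ρ u b) (fderiv ℝ (fun u => ρ u b) u) u := fun b =>
    (((c.contDiffOn_regular_comp hρ b).contDiffAt (hU.mem_nhds hu)).differentiableAt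
      (by simp)).hasFDerivAt
  have h1 : HasFDerivAt (fun u => c.emb (P.act (ρ u) g))
      (ContinuousLinearMap.pi fun j => ∑ i ∈ S j, g i.2 • fderiv ℝ (fun u => ρ u i.1) u) u := by
    refine hasFDerivAt_pi.2 fun j => ?_
    simp only [CoordinateSystem.emb_apply, hS]
    exact HasFDerivAt.fun_sum fun i _ => (hreg i.1).mul_const (g i.2)
  refine (c.hasFDerivAt_comp (toSmooth ξ) h1).congr_fderiv ?_
  refine Finset.sum_congr rfl fun j _ => ?_
  ext v
  simp only [ContinuousLinearMap.smulRight_apply, ContinuousLinearMap.comp_apply,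
    ContinuousLinearMap.proj_apply, ContinuousLinearMap.pi_apply, sum_apply,
    smul_apply, CoordinateSystem.regularFDeriv, Complex.ofRealCLM_apply, smul_eq_mul,
    Complex.real_smul, Complex.ofReal_sum, Complex.ofReal_mul, Finset.sum_mul]
  refine Finset.sum_congr rfl fun i _ => ?_
  change _ = _ * (c.D j (toSmooth ξ)).1 _ * _
  ring

include cA hS hU hρ in
theorem hasFDerivAt_integral (Ξ : SchwartzSpace A) (ξ : SchwartzSpace B)
    {u₀ : Fin c.n → ℝ} (hu₀ : u₀ ∈ U) :
    HasFDerivAt (fun u => P.integral μ Ξ ξ (ρ u))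
      (∑ j, ∑ i ∈ S j, P.integral μ (mapOp (nashMul i.2) Ξ) (mapOp (c.nashD j) ξ) (ρ u₀) •
        c.regularFDeriv ρ i.1 u₀) u₀ := by
  have := cA.secondCountableTopology
  let F' : (Fin c.n → ℝ) → RealPoints A → ((Fin c.n → ℝ) →L[ℝ] ℂ) := fun u g =>
    ∑ j, ∑ i ∈ S j, (mapOp (nashMul i.2) Ξ g * mapOp (c.nashD j) ξ (P.act (ρ u) g)) •
      c.regularFDeriv ρ i.1 u
  have hcont : ∀ (j : Fin c.n) (i : B × A), Continuous fun g =>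
      mapOp (nashMul i.2) Ξ g * mapOp (c.nashD j) ξ (P.act (ρ u₀) g) := fun j i =>
    (cA.continuous_smoothFunction _).mul (P.continuous_schwartz_act c _ _)
  let s : Set (Fin c.n → ℝ) := {u | u ∈ U ∧ ∀ j, ∀ i ∈ S j,
    ‖c.regularFDeriv ρ i.1 u‖ < ‖c.regularFDeriv ρ i.1 u₀‖ + 1}
  have hs : s ∈ 𝓝 u₀ := by
    refine (hU.eventually_mem hu₀).and (Filter.eventually_all.2 fun j =>
      (Filter.eventually_all_finset _).2 fun i _ => ?_)
    have h1 : ContinuousAt (c.regularFDeriv ρ i.1) u₀ :=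
      ((c.contDiffOn_regularFDeriv hU hρ i.1).continuousOn).continuousAt (hU.mem_nhds hu₀)
    exact h1.norm.eventually (gt_mem_nhds (lt_add_one _))
  have hmain := hasFDerivAt_integral_of_dominated_of_fderiv_le (μ := μ) (𝕜 := ℝ)
    (F := fun u g => Ξ g * ξ (P.act (ρ u) g)) (F' := F') (x₀ := u₀)
    (bound := fun g => ∑ j, ∑ i ∈ S j, ‖mapOp (nashMul i.2) Ξ g‖ *
      (seminorm (1 : nashDiffOps B) (mapOp (c.nashD j) ξ) * (‖c.regularFDeriv ρ i.1 u₀‖ + 1)))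
    hs ?_ ?_ ?_ ?_ ?_ ?_
  · refine hmain.congr_fderiv ?_
    rw [MeasureTheory.integral_finsetSum]
    · refine Finset.sum_congr rfl fun j _ => ?_
      rw [MeasureTheory.integral_finsetSum]
      · refine Finset.sum_congr rfl fun i _ => ?_
        rw [_root_.integral_smul_const]
        rfl
      · exact fun i _ => (P.integrable μ cA c _ _ _).smul_const _
    · exact fun j _ => integrable_finsetSum _ fun i _ => (P.integrable μ cA c _ _ _).smul_const _
  · exact Filter.Eventually.of_forall fun u => (P.integrable μ cA c Ξ ξ (ρ u)).aestronglyMeasurable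
  · exact P.integrable μ cA c Ξ ξ (ρ u₀)
  · refine Continuous.aestronglyMeasurable ?_
    exact continuous_finsetSum _ fun j _ => continuous_finsetSum _ fun i _ =>
      (hcont j i).smul continuous_const
  · refine Filter.Eventually.of_forall fun g u hu => ?_
    refine (norm_sum_le _ _).trans (Finset.sum_le_sum fun j _ => (norm_sum_le _ _).trans
      (Finset.sum_le_sum fun i hi => ?_))
    rw [norm_smul, norm_mul, mul_assoc]
    have h1 := norm_apply_le (mapOp (c.nashD j) ξ) (P.act (ρ u) g)
    have h2 := (hu.2 j i hi).le
    gcongr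
  · exact integrable_finsetSum _ fun j _ => integrable_finsetSum _ fun i _ =>
      (integrable_schwartz cA μ _).norm.mul_const _
  · refine Filter.Eventually.of_forall fun g u hu => ?_
    refine ((hasFDerivAt_schwartz_act hS hU hρ ξ g hu.1).const_mul (Ξ g)).congr_fderiv ?_
    simp only [F', Finset.smul_sum, smul_smul]
    refine Finset.sum_congr rfl fun j _ => Finset.sum_congr rfl fun i _ => ?_
    congr 1
    change _ = ((g i.2 : ℝ) : ℂ) * Ξ g * _
    ring

include cA hS hU hρ in
theorem contDiffOn_integral (k : ℕ) : ∀ (Ξ : SchwartzSpace A) (ξ : SchwartzSpace B),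
    ContDiffOn ℝ k (fun u => P.integral μ Ξ ξ (ρ u)) U := by
  induction k with
  | zero =>
    intro Ξ ξ
    rw [Nat.cast_zero, contDiffOn_zero]
    exact fun u hu =>
      (hasFDerivAt_integral μ cA hS hU hρ Ξ ξ hu).continuousAt.continuousWithinAt
  | succ k ih =>
    intro Ξ ξ
    rw [Nat.cast_succ, contDiffOn_succ_iff_hasFDerivWithinAt_of_uniqueDiffOn hU.uniqueDiffOn]
    refine ⟨fun h => absurd h (by simp), _, ?_, fun u hu =>
      (hasFDerivAt_integral μ cA hS hU hρ Ξ ξ hu).hasFDerivWithinAt⟩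
    refine ContDiffOn.sum fun j _ => ContDiffOn.sum fun i _ => (ih _ _).smul ?_
    exact (c.contDiffOn_regularFDeriv hU hρ i.1).of_le (by exact_mod_cast le_top)

end Derivative

include cA c in
theorem isSmoothFunction_integral (Ξ : SchwartzSpace A) (ξ : SchwartzSpace B) :
    IsSmoothFunction (P.integral μ Ξ ξ) := by
  choose S hS using fun j => P.exists_act_eq (c.gen j)
  refine (isSmoothFunction_iff c.surjective).2 fun x => ?_
  obtain ⟨ρ, U, hU, hxU, hρ, hρx, -⟩ := c.retraction x
  have h1 : ContDiffOn ℝ ∞ (fun u => P.integral μ Ξ ξ (ρ u)) U :=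
    contDiffOn_infty.2 fun k => contDiffOn_integral μ cA hS hU hρ k Ξ ξ
  obtain ⟨ε, hε, hb⟩ := Metric.isOpen_iff.1 hU _ hxU
  let f : ContDiffBump (c.emb x) := ⟨ε / 4, ε / 2, by positivity, by linarith⟩
  refine ⟨fun u => (f u : ℝ) • P.integral μ Ξ ξ (ρ u), ?_, ?_⟩
  · refine contDiff_iff_contDiffAt.2 fun u => ?_
    by_cases hu : u ∈ U
    · exact f.contDiff.contDiffAt.smul (h1.contDiffAt (hU.mem_nhds hu))
    · have hu' : u ∉ tsupport f := fun h => hu (hb (by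
        rw [f.tsupport_eq] at h
        exact Metric.closedBall_subset_ball (by change ε / 2 < ε; linarith) h))
      refine (contDiffAt_const (c := (0 : ℂ))).congr_of_eventuallyEq ?_
      filter_upwards [notMem_tsupport_iff_eventuallyEq.1 hu'] with v hv
      rw [hv]
      simp
  · have h2 := ((continuous_coord c.π).tendsto x).eventually f.eventuallyEq_one
    filter_upwards [h2, hρx] with y hy hy'
    change _ = (f (c.emb y) : ℝ) • P.integral μ Ξ ξ (ρ (c.emb y))
    rw [hy, hy']
    simp

/-- The smooth function `Ξ ξ` on `X(ℝ)`, as a bilinear map. -/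
def smoothIntegral : SchwartzSpace A →ₗ[ℂ] SchwartzSpace B →ₗ[ℂ] smoothFunctions B :=
  LinearMap.mk₂ ℂ
    (fun Ξ ξ => ⟨P.integral μ Ξ ξ, P.isSmoothFunction_integral μ cA c Ξ ξ⟩)
    (fun Ξ Ξ' ξ => by
      ext x
      refine Eq.trans ?_ (integral_add (P.integrable μ cA c Ξ ξ x) (P.integrable μ cA c Ξ' ξ x))
      refine integral_congr_ae (Filter.Eventually.of_forall fun g => ?_)
      change (toSmooth (Ξ + Ξ')).1 g * _ = _
      rw [map_add]
      exact add_mul _ _ _)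
    (fun z Ξ ξ => by
      ext x
      refine Eq.trans ?_ (integral_const_mul z _)
      refine integral_congr_ae (Filter.Eventually.of_forall fun g => ?_)
      change (toSmooth (z • Ξ)).1 g * _ = _
      rw [map_smul]
      exact mul_assoc _ _ _)
    (fun Ξ ξ ξ' => by
      ext x
      refine Eq.trans ?_ (integral_add (P.integrable μ cA c Ξ ξ x) (P.integrable μ cA c Ξ ξ' x))
      refine integral_congr_ae (Filter.Eventually.of_forall fun g => ?_)
      change _ * (toSmooth (ξ + ξ')).1 _ = _
      rw [map_add]
      exact mul_add _ _ _)
    (fun z Ξ ξ => by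
      ext x
      refine Eq.trans ?_ (integral_const_mul z _)
      refine integral_congr_ae (Filter.Eventually.of_forall fun g => ?_)
      change _ * (toSmooth (z • ξ)).1 _ = _
      rw [map_smul]
      exact mul_left_comm _ _ _)

theorem smoothIntegral_apply (Ξ : SchwartzSpace A) (ξ : SchwartzSpace B) (x : RealPoints B) :
    (P.smoothIntegral μ cA c Ξ ξ).1 x = ∫ g, Ξ g * ξ (P.act x g) ∂μ := rfl

theorem mulRegular_smoothIntegral (b : B) {S : Finset (B × A)}
    (hS : ∀ x g, x b = ∑ i ∈ S, P.act x g i.1 * g i.2) (Ξ : SchwartzSpace A) (ξ : SchwartzSpace B) :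
    mulRegular b (P.smoothIntegral μ cA c Ξ ξ) =
      ∑ i ∈ S, P.smoothIntegral μ cA c (mapOp (nashMul i.2) Ξ) (mapOp (nashMul i.1) ξ) := by
  ext x
  rw [mulRegular_apply, smoothFunctions_sum_apply]
  simp only [smoothIntegral_apply]
  rw [← integral_const_mul, ← MeasureTheory.integral_finsetSum _ fun i _ => P.integrable μ cA c _ _ x]
  refine integral_congr_ae (Filter.Eventually.of_forall fun g => ?_)
  simp only
  rw [hS x g, Complex.ofReal_sum, Finset.sum_mul]
  refine Finset.sum_congr rfl fun i _ => ?_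
  change _ = ((g i.2 : ℝ) : ℂ) * Ξ g * (((P.act x g i.1 : ℝ) : ℂ) * ξ (P.act x g))
  push_cast
  ring

theorem opD_smoothIntegral {S : Fin c.n → Finset (B × A)}
    (hS : ∀ j x g, P.act x g (c.gen j) = ∑ i ∈ S j, x i.1 * g i.2)
    (m : Fin c.n) (Ξ : SchwartzSpace A) (ξ : SchwartzSpace B) :
    c.opD m (P.smoothIntegral μ cA c Ξ ξ) = ∑ j, ∑ i ∈ S j, mulRegular (c.d m i.1)
      (P.smoothIntegral μ cA c (mapOp (nashMul i.2) Ξ) (mapOp (c.nashD j) ξ)) := by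
  ext x
  obtain ⟨ρ, U, hU, hxU, hρ, hρx, -⟩ := c.retraction x
  have hd := hasFDerivAt_integral μ cA hS hU hρ Ξ ξ hxU
  have h0 : ρ (c.emb x) = x := hρx.self_of_nhds
  rw [CoordinateSystem.opD_apply, c.D_eq m (φ := P.smoothIntegral μ cA c Ξ ξ) hd.differentiableAt
    (hρx.mono fun y hy => by
      change _ = P.integral μ Ξ ξ (ρ (coord c.π y))
      rw [hy]; rfl), hd.fderiv, h0]
  simp only [smoothFunctions_sum_apply, sum_apply, smul_apply,
    mulRegular_apply]
  refine Finset.sum_congr rfl fun j _ => Finset.sum_congr rfl fun i _ => ?_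
  have h2 : c.regularFDeriv ρ i.1 (c.emb x) (c.vec m x) = ((x (c.d m i.1) : ℝ) : ℂ) := by
    have h3 : HasFDerivAt (fun u => ((ρ u i.1 : ℝ) : ℂ)) (c.regularFDeriv ρ i.1 (c.emb x))
        (c.emb x) := Complex.ofRealCLM.hasFDerivAt.comp (c.emb x)
      (((c.contDiffOn_regular_comp hρ i.1).contDiffAt (hU.mem_nhds hxU)).differentiableAt
        (by simp)).hasFDerivAt
    have h4 := c.D_eq m (φ := regularFunction i.1) h3.differentiableAt (hρx.mono fun y hy => by
      change _ = ((ρ (coord c.π y) i.1 : ℝ) : ℂ)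
      rw [hy]; rfl)
    rw [c.D_regularFunction, h3.fderiv] at h4
    exact h4.symm
  rw [h2, smul_eq_mul, mul_comm]
  rfl

end PointAction

end

end SchwartzAction
end

noncomputable section
namespace SchwartzAction
open RealPoints MeasureTheory SchwartzSpace

section

variable {A B : Type*} [CommRing A] [HopfAlgebra ℝ A] [CommRing B] [Algebra ℝ B]

namespace PointAction

variable (P : PointAction A B) (μ : Measure (RealPoints A)) [Algebra.FinitePresentation ℝ A]
  (cA : CoordinateSystem A) (c : CoordinateSystem B) [μ.IsHaarMeasure]

/-! ### Semi-norm estimates -/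

/-- The bilinear maps `(Ξ, ξ) ↦ ∑ (D Ξ) (E ξ)` for Nash differential operators `D` and `E`. -/
def integralSpan : Submodule ℂ (SchwartzSpace A →ₗ[ℂ] SchwartzSpace B →ₗ[ℂ] smoothFunctions B) :=
  Submodule.span ℂ {w | ∃ (D : nashDiffOps A) (E : nashDiffOps B),
    w = (P.smoothIntegral μ cA c).compl₁₂ (mapOp D) (mapOp E)}

theorem compr_mem_integralSpan_of {T : Module.End ℂ (smoothFunctions B)}
    (hT : ∀ (D : nashDiffOps A) (E : nashDiffOps B),
      ((P.smoothIntegral μ cA c).compl₁₂ (mapOp D) (mapOp E)).compr₂ T ∈ P.integralSpan μ cA c)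
    {w : SchwartzSpace A →ₗ[ℂ] SchwartzSpace B →ₗ[ℂ] smoothFunctions B}
    (hw : w ∈ P.integralSpan μ cA c) : w.compr₂ T ∈ P.integralSpan μ cA c := by
  refine Submodule.span_induction (p := fun w _ => w.compr₂ T ∈ P.integralSpan μ cA c)
    ?_ ?_ ?_ ?_ hw
  · rintro _ ⟨D, E, rfl⟩
    exact hT D E
  · have : (0 : SchwartzSpace A →ₗ[ℂ] SchwartzSpace B →ₗ[ℂ] smoothFunctions B).compr₂ T = 0 :=
      LinearMap.ext₂ fun Ξ ξ => map_zero T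
    rw [this]
    exact zero_mem _
  · intro v w _ _ hv hw
    have : (v + w).compr₂ T = v.compr₂ T + w.compr₂ T :=
      LinearMap.ext₂ fun Ξ ξ => map_add T _ _
    rw [this]
    exact add_mem hv hw
  · intro z v _ hv
    have : (z • v).compr₂ T = z • v.compr₂ T := LinearMap.ext₂ fun Ξ ξ => map_smul T _ _
    rw [this]
    exact Submodule.smul_mem _ _ hv

theorem compr_mulRegular_mem_integralSpan (b : B)
    {w : SchwartzSpace A →ₗ[ℂ] SchwartzSpace B →ₗ[ℂ] smoothFunctions B}
    (hw : w ∈ P.integralSpan μ cA c) : w.compr₂ (mulRegular b) ∈ P.integralSpan μ cA c := by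
  refine P.compr_mem_integralSpan_of μ cA c (fun D E => ?_) hw
  obtain ⟨S, hS⟩ := P.exists_eq_sum_act b
  have : ((P.smoothIntegral μ cA c).compl₁₂ (mapOp D) (mapOp E)).compr₂ (mulRegular b) =
      ∑ i ∈ S, (P.smoothIntegral μ cA c).compl₁₂ (mapOp (nashMul i.2 * D))
        (mapOp (nashMul i.1 * E)) := by
    refine LinearMap.ext₂ fun Ξ ξ => ?_
    simp only [LinearMap.sum_apply]
    exact P.mulRegular_smoothIntegral μ cA c b hS (mapOp D Ξ) (mapOp E ξ)
  rw [this]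
  exact sum_mem fun i _ => Submodule.subset_span ⟨_, _, rfl⟩

theorem compr_mem_integralSpan {T : Module.End ℂ (smoothFunctions B)} (hT : T ∈ c.regularOps) :
    ∀ w ∈ P.integralSpan μ cA c, w.compr₂ T ∈ P.integralSpan μ cA c := by
  refine Algebra.adjoin_induction
    (p := fun T _ => ∀ w ∈ P.integralSpan μ cA c, w.compr₂ T ∈ P.integralSpan μ cA c)
    ?_ ?_ ?_ ?_ hT
  · rintro _ (⟨b, rfl⟩ | ⟨m, rfl⟩) w hw
    · exact P.compr_mulRegular_mem_integralSpan μ cA c b hw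
    · refine P.compr_mem_integralSpan_of μ cA c (fun D E => ?_) hw
      choose S hS using fun j => P.exists_act_eq (c.gen j)
      have : ((P.smoothIntegral μ cA c).compl₁₂ (mapOp D) (mapOp E)).compr₂ (c.opD m) =
          ∑ j, ∑ i ∈ S j, ((P.smoothIntegral μ cA c).compl₁₂ (mapOp (nashMul i.2 * D))
            (mapOp (c.nashD j * E))).compr₂ (mulRegular (c.d m i.1)) := by
        refine LinearMap.ext₂ fun Ξ ξ => ?_
        simp only [LinearMap.sum_apply]
        exact P.opD_smoothIntegral μ cA c hS m (mapOp D Ξ) (mapOp E ξ)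
      rw [this]
      exact sum_mem fun j _ => sum_mem fun i _ =>
        P.compr_mulRegular_mem_integralSpan μ cA c _ (Submodule.subset_span ⟨_, _, rfl⟩)
  · intro z w hw
    have : w.compr₂ (algebraMap ℂ (Module.End ℂ (smoothFunctions B)) z) = z • w :=
      LinearMap.ext₂ fun Ξ ξ => rfl
    rw [this]
    exact Submodule.smul_mem _ _ hw
  · intro S T _ _ hS hT w hw
    have : w.compr₂ (S + T) = w.compr₂ S + w.compr₂ T := LinearMap.ext₂ fun Ξ ξ => rfl
    rw [this]
    exact add_mem (hS w hw) (hT w hw)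
  · intro S T _ _ hS hT w hw
    exact hS _ (hT w hw)

/-- A bilinear map bounded by a product of continuous semi-norms. -/
def IsBoundedBilinear (f : SchwartzSpace A → SchwartzSpace B → RealPoints B → ℝ) : Prop :=
  ∃ (p : Seminorm ℂ (SchwartzSpace A)) (q : Seminorm ℂ (SchwartzSpace B)),
    Continuous p ∧ Continuous q ∧ ∀ Ξ ξ x, f Ξ ξ x ≤ p Ξ * q ξ

omit [Algebra.FinitePresentation ℝ A] in
theorem IsBoundedBilinear.add {f f' : SchwartzSpace A → SchwartzSpace B → RealPoints B → ℝ}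
    (hf : IsBoundedBilinear f) (hf' : IsBoundedBilinear f') :
    IsBoundedBilinear fun Ξ ξ x => f Ξ ξ x + f' Ξ ξ x := by
  obtain ⟨p, q, hp, hq, h⟩ := hf
  obtain ⟨p', q', hp', hq', h'⟩ := hf'
  refine ⟨p + p', q + q', hp.add hp', hq.add hq', fun Ξ ξ x => ?_⟩
  refine (add_le_add (h Ξ ξ x) (h' Ξ ξ x)).trans ?_
  have h1 : 0 ≤ p Ξ * q' ξ := mul_nonneg (apply_nonneg _ _) (apply_nonneg _ _)
  have h2 : 0 ≤ p' Ξ * q ξ := mul_nonneg (apply_nonneg _ _) (apply_nonneg _ _)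
  change _ ≤ (p Ξ + p' Ξ) * (q ξ + q' ξ)
  nlinarith

omit [Algebra.FinitePresentation ℝ A] in
theorem IsBoundedBilinear.mono {f f' : SchwartzSpace A → SchwartzSpace B → RealPoints B → ℝ}
    (hf : IsBoundedBilinear f) (h : ∀ Ξ ξ x, f' Ξ ξ x ≤ f Ξ ξ x) : IsBoundedBilinear f' := by
  obtain ⟨p, q, hp, hq, h'⟩ := hf
  exact ⟨p, q, hp, hq, fun Ξ ξ x => (h Ξ ξ x).trans (h' Ξ ξ x)⟩

omit [Algebra.FinitePresentation ℝ A] in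
theorem isBoundedBilinear_zero :
    IsBoundedBilinear fun (_ : SchwartzSpace A) (_ : SchwartzSpace B) _ => 0 :=
  ⟨seminorm 1, seminorm 1, continuous_seminorm _, continuous_seminorm _, fun _ _ _ =>
    mul_nonneg (apply_nonneg _ _) (apply_nonneg _ _)⟩

omit [Algebra.FinitePresentation ℝ A] in
theorem IsBoundedBilinear.const_mul {f : SchwartzSpace A → SchwartzSpace B → RealPoints B → ℝ}
    (hf : IsBoundedBilinear f) {r : ℝ} (hr : 0 ≤ r) :
    IsBoundedBilinear fun Ξ ξ x => r * f Ξ ξ x := by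
  obtain ⟨p, q, hp, hq, h⟩ := hf
  refine ⟨r.toNNReal • p, q, hp.const_smul r.toNNReal, hq, fun Ξ ξ x => ?_⟩
  refine (mul_le_mul_of_nonneg_left (h Ξ ξ x) hr).trans_eq ?_
  rw [← mul_assoc]
  change _ = (r.toNNReal : ℝ) * p Ξ * q ξ
  rw [Real.coe_toNNReal r hr]

theorem isBoundedBilinear_of_mem
    {w : SchwartzSpace A →ₗ[ℂ] SchwartzSpace B →ₗ[ℂ] smoothFunctions B}
    (hw : w ∈ P.integralSpan μ cA c) : IsBoundedBilinear fun Ξ ξ x => ‖(w Ξ ξ).1 x‖ := by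
  refine Submodule.span_induction
    (p := fun w _ => IsBoundedBilinear fun Ξ ξ x => ‖(w Ξ ξ).1 x‖) ?_ ?_ ?_ ?_ hw
  · rintro _ ⟨D, E, rfl⟩
    obtain ⟨W, J, hJ, h⟩ := exists_nashDiffOp_integral_bound cA μ
    refine IsBoundedBilinear.mono (IsBoundedBilinear.const_mul
      ⟨seminorm (W * D), seminorm (1 * E), continuous_seminorm _, continuous_seminorm _,
        fun Ξ ξ x => le_rfl⟩ hJ) fun Ξ ξ x => ?_
    refine (norm_integral_le_integral_norm _).trans ?_
    refine (h (mapOp D Ξ) _ (seminorm (1 : nashDiffOps B) (mapOp E ξ)) (apply_nonneg _ _)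
      (P.continuous_schwartz_act c _ x) (fun g => norm_apply_le _ _)).2.trans_eq ?_
    rw [mul_assoc, seminorm_mapOp, seminorm_mapOp]
  · exact isBoundedBilinear_zero.mono fun Ξ ξ x => by simp
  · intro v w _ _ hv hw
    exact (hv.add hw).mono fun Ξ ξ x => norm_add_le _ _
  · intro z v _ hv
    exact (hv.const_mul (norm_nonneg z)).mono fun Ξ ξ x => (norm_mul z _).le

theorem isBoundedBilinear_nashDiffOp [Algebra.FinitePresentation ℝ B]
    {E : Module.End ℂ (smoothFunctions B)} (hE : E ∈ nashDiffOps B) :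
    IsBoundedBilinear fun Ξ ξ x => ‖(E (P.smoothIntegral μ cA c Ξ ξ)).1 x‖ := by
  obtain ⟨L, hL, h⟩ := c.exists_list_regularOps_bound hE
  refine IsBoundedBilinear.mono ?_ fun Ξ ξ x => h (P.smoothIntegral μ cA c Ξ ξ) x
  clear h
  induction L with
  | nil => exact isBoundedBilinear_zero
  | cons T L ih =>
    simp only [List.map_cons, List.sum_cons]
    refine IsBoundedBilinear.add ?_ (ih fun T hT => hL T (List.mem_cons_of_mem _ hT))
    refine P.isBoundedBilinear_of_mem μ cA c (w := (P.smoothIntegral μ cA c).compr₂ T)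
      (P.compr_mem_integralSpan μ cA c (hL T List.mem_cons_self) _
        (Submodule.subset_span ⟨1, 1, rfl⟩))

variable [Algebra.FinitePresentation ℝ B]

/-- The action of Schwartz functions on `G(ℝ)` on Schwartz functions on `X(ℝ)`. -/
def schwartzAct : SchwartzSpace A →ₗ[ℂ] SchwartzSpace B →ₗ[ℂ] SchwartzSpace B :=
  LinearMap.mk₂ ℂ
    (fun Ξ ξ => SchwartzSpace.mk (P.smoothIntegral μ cA c Ξ ξ) fun _ hE =>
      let ⟨p, q, _, _, h⟩ := P.isBoundedBilinear_nashDiffOp μ cA c hE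
      ⟨p Ξ * q ξ, h Ξ ξ⟩)
    (fun Ξ Ξ' ξ => toSmooth_injective (LinearMap.map_add₂ (P.smoothIntegral μ cA c) Ξ Ξ' ξ))
    (fun z Ξ ξ => toSmooth_injective (LinearMap.map_smul₂ (P.smoothIntegral μ cA c) z Ξ ξ))
    (fun Ξ ξ ξ' => toSmooth_injective (map_add (P.smoothIntegral μ cA c Ξ) ξ ξ'))
    (fun z Ξ ξ => toSmooth_injective (map_smul (P.smoothIntegral μ cA c Ξ) z ξ))

theorem schwartzAct_apply (Ξ : SchwartzSpace A) (ξ : SchwartzSpace B) (x : RealPoints B) :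
    P.schwartzAct μ cA c Ξ ξ x = ∫ g, Ξ g * ξ (P.act x g) ∂μ := rfl

theorem continuous_schwartzAct :
    Continuous (fun p : SchwartzSpace A × SchwartzSpace B => P.schwartzAct μ cA c p.1 p.2) := by
  refine continuous_iff_continuousAt.2 fun z => ?_
  refine (withSeminorms.tendsto_nhds _ _).2 fun D ε hε => ?_
  obtain ⟨p, q, hp, hq, h⟩ := P.isBoundedBilinear_nashDiffOp μ cA c D.2
  have hb : ∀ Ξ ξ, seminorm D (P.schwartzAct μ cA c Ξ ξ) ≤ p Ξ * q ξ := fun Ξ ξ =>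
    Real.iSup_le (fun x => h Ξ ξ x) (mul_nonneg (apply_nonneg _ _) (apply_nonneg _ _))
  have hcont : Continuous fun y : SchwartzSpace A × SchwartzSpace B =>
      p (y.1 - z.1) * q y.2 + p z.1 * q (y.2 - z.2) :=
    ((hp.comp (continuous_fst.sub continuous_const)).mul (hq.comp continuous_snd)).add
      (continuous_const.mul (hq.comp (continuous_snd.sub continuous_const)))
  have h0 := hcont.tendsto z
  simp only [sub_self, map_zero, zero_mul, mul_zero, add_zero] at h0
  filter_upwards [h0.eventually (gt_mem_nhds hε)] with y hy
  have hsub : P.schwartzAct μ cA c y.1 y.2 - P.schwartzAct μ cA c z.1 z.2 =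
      P.schwartzAct μ cA c (y.1 - z.1) y.2 + P.schwartzAct μ cA c z.1 (y.2 - z.2) := by
    rw [map_sub, map_sub, LinearMap.sub_apply]
    abel
  rw [hsub]
  exact (map_add_le_add _ _ _).trans_lt ((add_le_add (hb _ _) (hb _ _)).trans_lt hy)

/-! ### Compatibility with convolution -/

theorem schwartzAct_schwartzAct (Ξ Ξ' : SchwartzSpace A) (ξ : SchwartzSpace B) :
    P.schwartzAct μ cA c ((invTranslation A).schwartzAct μ cA cA Ξ Ξ') ξ =
      P.schwartzAct μ cA c Ξ (P.schwartzAct μ cA c Ξ' ξ) := by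
  have := cA.secondCountableTopology
  have := cA.sigmaCompactSpace
  refine SchwartzSpace.ext_apply fun x => ?_
  have hξ := P.continuous_schwartz_act c ξ x
  have hint : Integrable (Function.uncurry fun g h : RealPoints A =>
      Ξ g * Ξ' (g⁻¹ * h) * ξ (P.act x h)) (μ.prod μ) := by
    have h1 := (integrable_schwartz cA μ Ξ).mul_prod (integrable_schwartz cA μ Ξ')
    have h2 := (measurePreserving_prod_inv_mul μ μ).integrable_comp_of_integrable h1
    exact h2.mul_bdd (c := seminorm (1 : nashDiffOps B) ξ)
      (hξ.comp continuous_snd).aestronglyMeasurable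
      (Filter.Eventually.of_forall fun z => norm_apply_le _ _)
  rw [schwartzAct_apply, schwartzAct_apply]
  calc ∫ h, (invTranslation A).schwartzAct μ cA cA Ξ Ξ' h * ξ (P.act x h) ∂μ
      = ∫ h, ∫ g, Ξ g * Ξ' (g⁻¹ * h) * ξ (P.act x h) ∂μ ∂μ := by
        refine integral_congr_ae (Filter.Eventually.of_forall fun h => ?_)
        simp only [schwartzAct_apply, invTranslation_act]
        rw [integral_mul_const]
    _ = ∫ g, ∫ h, Ξ g * Ξ' (g⁻¹ * h) * ξ (P.act x h) ∂μ ∂μ := (integral_integral_swap hint).symm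
    _ = ∫ g, Ξ g * P.schwartzAct μ cA c Ξ' ξ (P.act x g) ∂μ := by
        refine integral_congr_ae (Filter.Eventually.of_forall fun g => ?_)
        simp only [schwartzAct_apply, mul_assoc]
        rw [integral_const_mul, ← integral_mul_left_eq_self _ g]
        simp only [inv_mul_cancel_left, act_act]

end PointAction

end

end SchwartzAction

end

open SchwartzAction in
theorem mainTheorem7 {A B : Type*} [CommRing A] [HopfAlgebra ℝ A] [Algebra.Smooth ℝ A]
    [CommRing B] [Algebra ℝ B] [Algebra.Smooth ℝ B] (ρ : RightAction A B)
    (μ : MeasureTheory.Measure (RealPoints A)) [μ.IsHaarMeasure] :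
    -- the convolution product of `𝒮(G)` and its action on `𝒮(X)`, as bilinear maps
    ∃ (conv : SchwartzSpace A →ₗ[ℂ] SchwartzSpace A →ₗ[ℂ] SchwartzSpace A)
      (act : SchwartzSpace A →ₗ[ℂ] SchwartzSpace B →ₗ[ℂ] SchwartzSpace B),
      -- `𝒮(G)` is a convolution algebra with continuous product
      (∀ (Ξ Ξ' : SchwartzSpace A) (h : RealPoints A),
        MeasureTheory.Integrable (fun g => Ξ g * Ξ' (g⁻¹ * h)) μ ∧
          conv Ξ Ξ' h = ∫ g, Ξ g * Ξ' (g⁻¹ * h) ∂μ) ∧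
      (∀ Ξ Ξ' Ξ'' : SchwartzSpace A, conv (conv Ξ Ξ') Ξ'' = conv Ξ (conv Ξ' Ξ'')) ∧
      Continuous (fun p : SchwartzSpace A × SchwartzSpace A => conv p.1 p.2) ∧
      -- the formula for the action
      (∀ (Ξ : SchwartzSpace A) (ξ : SchwartzSpace B) (x : RealPoints B),
        MeasureTheory.Integrable (fun g => Ξ g * ξ (ρ.act x g)) μ ∧
          act Ξ ξ x = ∫ g, Ξ g * ξ (ρ.act x g) ∂μ) ∧
      -- compatibility of the action with the product of `𝒮(G)`
      (∀ (Ξ Ξ' : SchwartzSpace A) (ξ : SchwartzSpace B),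
        act (conv Ξ Ξ') ξ = act Ξ (act Ξ' ξ)) ∧
      -- joint continuity of the action
      Continuous (fun p : SchwartzSpace A × SchwartzSpace B => act p.1 p.2) := by
  have : Algebra.FinitePresentation ℝ A := Algebra.Smooth.finitePresentation
  have : Algebra.FinitePresentation ℝ B := Algebra.Smooth.finitePresentation
  obtain ⟨cA⟩ := nonempty_coordinateSystem (B := A)
  obtain ⟨c⟩ := nonempty_coordinateSystem (B := B)
  refine ⟨(invTranslation A).schwartzAct μ cA cA, ρ.toPointAction.schwartzAct μ cA c,
    fun Ξ Ξ' h => ?_, (invTranslation A).schwartzAct_schwartzAct μ cA cA,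
    (invTranslation A).continuous_schwartzAct μ cA cA,
    fun Ξ ξ x => ⟨ρ.toPointAction.integrable μ cA c Ξ ξ x, rfl⟩,
    ρ.toPointAction.schwartzAct_schwartzAct μ cA c, ρ.toPointAction.continuous_schwartzAct μ cA c⟩
  have h1 := (invTranslation A).integrable μ cA cA Ξ Ξ' h
  have h2 := (invTranslation A).schwartzAct_apply μ cA cA Ξ Ξ' h
  simp only [invTranslation_act] at h1 h2
  exact ⟨h1, h2⟩
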